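/- Let $N,M\ge 0$ be integers and put $n=N+M$. Let the indices $i,j$ run through $\pm1,\dots,\pm n$, with $\bar\imath=0$ for $i>0$ and $\bar\imath=1$ for $i<0$. Let $E_{ij}$ be the matrix units of the complex Lie superalgebra $\mathfrak{gl}_{n|n}$, graded by $\deg E_{ij}=\bar\imath+\bar\jmath$ and equipped with the supercommutator $[X,Y]=XY-(-1)^{\deg X\deg Y}YX$. The queer Lie superalgebra $\mathfrak q_n$ is the fixed point subalgebra of the involution $E_{ij}\mapsto E_{-i,-j}$ of $\mathfrak{gl}_{n|n}$; it is spanned by the elements $F_{ij}=E_{ij}+E_{-i,-j}$. Regard $\mathfrak q_M$ as the subalgebra of $\mathfrak q_{N+M}$ spanned by the $F_{ij}$ with $|i|,|j|>N$ (so $\mathfrak q_M=0$ if $M=0$). Let $\mathrm S(\mathfrak q_{N+M})$ be the symmetric algebra of the Lie superalgebra $\mathfrak q_{N+M}$, that is, the free supercommutative algebra on this $\mathbb Z_2$-graded vector space: the quotient of the tensor algebra by the relations $XY=(-1)^{\deg X\deg Y}YX$ for homogeneous $X,Y\in\mathfrak q_{N+M}$. The adjoint action of a homogeneous $X\in\mathfrak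 q_{N+M}$ on it is the superderivation extending $Y\mapsto[X,Y]$. Let $\mathrm S(\mathfrak q_{N+M})^{\mathfrak q_M}$ be the subalgebra of the elements annihilated by the adjoint action of every $X\in\mathfrak q_M$. For $m\ge1$ define in $\mathrm S(\mathfrak q_{N+M})$ $$f^{(m)}_{ij|N+M}=\sum_{k_1,\dots,k_{m-1}}(-1)^{\bar k_1+\dots+\bar k_{m-1}}F_{ik_1}F_{k_1k_2}\cdots F_{k_{m-1}j},\qquad c^{(m)}_{N+M}=\sum_k f^{(m)}_{kk|N+M},$$ where $k,k_1,\dots,k_{m-1}$ run through $\pm1,\dots,\pm(N+M)$; thus $f^{(1)}_{ij|N+M}=F_{ij}$. **Proposition 2.5.** The subalgebra $\mathrm S(\mathfrak q_{N+M})^{\mathfrak q_M}$ of $\mathrm S(\mathfrak q_{N+M})$ is generated, as a unital complex algebra, by the elements $c^{(1)}_{N+M},c^{(3)}_{N+M},\dots$ together with the elements $f^{(1)}_{ij|N+M},f^{(2)}_{ij|N+M},\dots$ where $|i|,|j|\le N$. -/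

import Mathlib

noncomputable section

namespace Queer

/-! ### Indices and signs -/

/-- The index set `{±1, …, ±n}`. The pair `(a, 0)` stands for the index `a + 1` and the pair
`(a, 1)` for the index `-(a + 1)`. -/
abbrev Idx (n : ℕ) : Type := Fin n × ZMod 2

/-- The absolute value `|i|` of an index. -/
def Idx.abs {n : ℕ} (i : Idx n) : ℕ := i.1.val + 1

/-- The parity `ī` of an index: `0` if `i > 0` and `1` if `i < 0`. -/
def Idx.par {n : ℕ} (i : Idx n) : ZMod 2 := i.2

/-- The opposite index `-i`. -/
def Idx.opp {n : ℕ} (i : Idx n) : Idx n := (i.1, i.2 + 1)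

/-- The sign `(-1)^p` for `p` in `ℤ/2`. -/
def sgn (p : ZMod 2) : ℂ := if p = 0 then 1 else -1

@[simp] theorem Idx.opp_opp {n : ℕ} (i : Idx n) : i.opp.opp = i := by
  obtain ⟨a, e⟩ := i
  have h : e + 1 + 1 = e := by revert e; decide
  simp [Idx.opp, h]

theorem Idx.par_opp {n : ℕ} (i : Idx n) : i.opp.par = i.par + 1 := rfl

theorem Idx.opp_injective {n : ℕ} : Function.Injective (Idx.opp (n := n)) :=
  Function.LeftInverse.injective Idx.opp_opp

/-! ### The general linear and the queer Lie superalgebras -/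

/-- The matrices over `ℂ^{n|n}`; the matrix unit `E_ij` is `Matrix.single i j 1`. -/
abbrev gl (n : ℕ) : Type := Matrix (Idx n) (Idx n) ℂ

/-- The projection of `gl n` to its subspace of `ℤ/2`-degree `p`, where `deg E_ij = ī + j̄`. -/
def glProj (n : ℕ) (p : ZMod 2) : gl n →ₗ[ℂ] gl n where
  toFun X := Matrix.of fun i j => if i.par + j.par = p then X i j else 0
  map_add' X Y := by
    ext i j
    by_cases h : i.par + j.par = p <;> simp [h]
  map_smul' c X := by
    ext i j
    by_cases h : i.par + j.par = p <;> simp [h]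

theorem glProj_apply {n : ℕ} (p : ZMod 2) (X : gl n) (i j : Idx n) :
    glProj n p X i j = if i.par + j.par = p then X i j else 0 := rfl

/-- The supercommutator on `gl n`: it is `X Y - (-1)^{pq} Y X` for `X` of degree `p` and `Y` of
degree `q`, and is extended bilinearly. -/
def glBracket (n : ℕ) (X Y : gl n) : gl n :=
  ∑ p : ZMod 2, ∑ q : ZMod 2,
    (glProj n p X * glProj n q Y - sgn (p * q) • (glProj n q Y * glProj n p X))

/-- The involution `η` of `gl n`, which sends `E_ij` to `E_{-i,-j}`. -/
def eta (n : ℕ) (X : gl n) : gl n := Matrix.of fun i j => X i.opp j.opp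

/-- The queer Lie superalgebra `q_n`: the fixed points of `η` in `gl n`. -/
def q (n : ℕ) : Submodule ℂ (gl n) where
  carrier := {X | eta n X = X}
  zero_mem' := rfl
  add_mem' {X Y} hX hY := by
    ext i j
    exact congrArg₂ (· + ·) (congrFun (congrFun hX i) j) (congrFun (congrFun hY i) j)
  smul_mem' c X hX := by
    ext i j
    exact congrArg (c * ·) (congrFun (congrFun hX i) j)

theorem mem_q_iff {n : ℕ} {X : gl n} : X ∈ q n ↔ ∀ i j : Idx n, X i.opp j.opp = X i j :=
  ⟨fun h i j => congrFun (congrFun h i) j, fun h => by ext i j; exact h i j⟩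

theorem mul_mem_q {n : ℕ} {X Y : gl n} (hX : X ∈ q n) (hY : Y ∈ q n) : X * Y ∈ q n := by
  rw [mem_q_iff] at *
  intro i j
  simp only [Matrix.mul_apply]
  refine Fintype.sum_bijective Idx.opp ⟨Idx.opp_injective, fun k => ⟨k.opp, k.opp_opp⟩⟩ _ _ ?_
  intro k
  rw [← hX i k.opp, ← hY k.opp j, Idx.opp_opp]

theorem opp_par_add {n : ℕ} (i j : Idx n) : i.opp.par + j.opp.par = i.par + j.par := by
  rw [Idx.par_opp, Idx.par_opp]
  generalize i.par = a
  generalize j.par = b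
  revert a b
  decide

theorem glProj_mem_q {n : ℕ} (p : ZMod 2) {X : gl n} (hX : X ∈ q n) : glProj n p X ∈ q n := by
  rw [mem_q_iff] at *
  intro i j
  rw [glProj_apply, glProj_apply, opp_par_add, hX]

theorem glBracket_mem_q {n : ℕ} {X Y : gl n} (hX : X ∈ q n) (hY : Y ∈ q n) :
    glBracket n X Y ∈ q n :=
  Submodule.sum_mem _ fun p _ => Submodule.sum_mem _ fun r _ =>
    Submodule.sub_mem _ (mul_mem_q (glProj_mem_q p hX) (glProj_mem_q r hY))
      (Submodule.smul_mem _ _ (mul_mem_q (glProj_mem_q r hY) (glProj_mem_q p hX)))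

/-- The projection of `q_n` to its subspace of `ℤ/2`-degree `p`. -/
def qProj (n : ℕ) (p : ZMod 2) : q n →ₗ[ℂ] q n :=
  (glProj n p).restrict fun _ hX => glProj_mem_q p hX

/-- The subspace of `ℤ/2`-degree `p` in `q_n`. -/
def qDeg (n : ℕ) (p : ZMod 2) : Submodule ℂ (q n) where
  carrier := {X | qProj n p X = X}
  zero_mem' := map_zero _
  add_mem' {X Y} hX hY := by
    change qProj n p (X + Y) = X + Y
    rw [map_add, show qProj n p X = X from hX, show qProj n p Y = Y from hY]
  smul_mem' c X hX := by
    change qProj n p (c • X) = c • X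
    rw [map_smul, show qProj n p X = X from hX]

/-- The bracket `Y ↦ [X, Y]` on `q_n`, the restriction of the supercommutator on `gl n`. -/
def qBracket (n : ℕ) (X : q n) : q n →ₗ[ℂ] q n where
  toFun Y := ⟨glBracket n X Y, glBracket_mem_q X.2 Y.2⟩
  map_add' Y Z := by
    apply Subtype.ext
    simp only [glBracket, Submodule.coe_add, map_add, mul_add, add_mul, smul_add,
      ← Finset.sum_add_distrib]
    refine Finset.sum_congr rfl fun p _ => Finset.sum_congr rfl fun r _ => ?_
    abel
  map_smul' c Y := by
    apply Subtype.ext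
    simp only [glBracket, Submodule.coe_smul, map_smul, RingHom.id_apply, Finset.smul_sum,
      Matrix.mul_smul, Matrix.smul_mul, smul_sub]
    refine Finset.sum_congr rfl fun p _ => Finset.sum_congr rfl fun r _ => ?_
    rw [smul_comm c]

/-- The element `F_ij = E_ij + E_{-i,-j}` of `q_n`. -/
def F {n : ℕ} (i j : Idx n) : q n :=
  ⟨Matrix.single i j 1 + Matrix.single i.opp j.opp 1, by
    rw [mem_q_iff]
    intro a b
    have h : ∀ k l : Idx n, k = l.opp ↔ k.opp = l := fun k l =>
      ⟨fun e => by rw [e, Idx.opp_opp], fun e => by rw [← e, Idx.opp_opp]⟩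
    simp only [Matrix.add_apply, Matrix.single_apply, h, Idx.opp_opp]
    exact add_comm _ _⟩

/-- The subalgebra `q_M` of `q_{N+M}`: the span of the `F_ij` with `|i|, |j| > N`. -/
def qM (N M : ℕ) : Submodule ℂ (q (N + M)) :=
  Submodule.span ℂ {X | ∃ i j : Idx (N + M), N < i.abs ∧ N < j.abs ∧ X = F i j}

/-! ### The symmetric algebra -/

/-- The relations `X Y = (-1)^{pr} Y X`, where `X, Y` in `q_n` have the degrees `p, r`. -/
inductive SymRel (n : ℕ) : TensorAlgebra ℂ (q n) → TensorAlgebra ℂ (q n) → Prop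
  | swap {p r : ZMod 2} {X Y : q n} (hX : X ∈ qDeg n p) (hY : Y ∈ qDeg n r) :
      SymRel n (TensorAlgebra.ι ℂ X * TensorAlgebra.ι ℂ Y)
        (sgn (p * r) • (TensorAlgebra.ι ℂ Y * TensorAlgebra.ι ℂ X))

/-- The symmetric algebra `S(q_n)` of the Lie superalgebra `q_n`, the free supercommutative
algebra on the `ℤ/2`-graded vector space `q_n`. -/
abbrev S (n : ℕ) : Type := RingQuot (SymRel n)

/-- The canonical map from `q_n` to `S(q_n)`. -/
def S.ι (n : ℕ) : q n →ₗ[ℂ] S n :=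
  (RingQuot.mkAlgHom ℂ (SymRel n)).toLinearMap ∘ₗ TensorAlgebra.ι ℂ

theorem S.ι_swap {n : ℕ} {p r : ZMod 2} {X Y : q n} (hX : X ∈ qDeg n p) (hY : Y ∈ qDeg n r) :
    S.ι n X * S.ι n Y = sgn (p * r) • (S.ι n Y * S.ι n X) := by
  have h := RingQuot.mkAlgHom_rel ℂ (SymRel.swap hX hY)
  rw [map_smul, map_mul, map_mul] at h
  exact h

theorem S.induction {n : ℕ} {C : S n → Prop} (scalar : ∀ c : ℂ, C (algebraMap ℂ (S n) c))
    (gen : ∀ X : q n, C (S.ι n X)) (mul : ∀ a b, C a → C b → C (a * b))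
    (add : ∀ a b, C a → C b → C (a + b)) (a : S n) : C a := by
  obtain ⟨t, rfl⟩ := RingQuot.mkAlgHom_surjective ℂ (SymRel n) a
  induction t using TensorAlgebra.induction with
  | algebraMap c => rw [AlgHom.commutes]; exact scalar c
  | ι X => exact gen X
  | mul x y hx hy => rw [map_mul]; exact mul _ _ hx hy
  | add x y hx hy => rw [map_add]; exact add _ _ hx hy

/-- The universal property of `S(q_n)`. -/
def S.lift {n : ℕ} {A : Type} [Ring A] [Algebra ℂ A] (f : q n →ₗ[ℂ] A)
    (h : ∀ (p r : ZMod 2) (X Y : q n), X ∈ qDeg n p → Y ∈ qDeg n r →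
      f X * f Y = sgn (p * r) • (f Y * f X)) : S n →ₐ[ℂ] A :=
  RingQuot.liftAlgHom ℂ ⟨TensorAlgebra.lift ℂ f, by
    rintro _ _ ⟨hX, hY⟩
    simp only [map_mul, map_smul, TensorAlgebra.lift_ι_apply]
    exact h _ _ _ _ hX hY⟩

theorem S.lift_ι {n : ℕ} {A : Type} [Ring A] [Algebra ℂ A] (f : q n →ₗ[ℂ] A)
    (h : ∀ (p r : ZMod 2) (X Y : q n), X ∈ qDeg n p → Y ∈ qDeg n r →
      f X * f Y = sgn (p * r) • (f Y * f X)) (X : q n) : S.lift f h (S.ι n X) = f X := by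
  have e : S.ι n X = RingQuot.mkAlgHom ℂ (SymRel n) (TensorAlgebra.ι ℂ X) := rfl
  rw [e, S.lift, RingQuot.liftAlgHom_mkAlgHom_apply, TensorAlgebra.lift_ι_apply]

/-! ### The adjoint action -/

theorem sgn_mul_self (p : ZMod 2) : sgn p * sgn p = 1 := by
  by_cases h : p = 0 <;> simp [sgn, h]

theorem sgn_add (p r : ZMod 2) : sgn (p + r) = sgn p * sgn r := by
  have h : ∀ p : ZMod 2, p = 0 ∨ p = 1 := by decide
  have e : (1 : ZMod 2) + 1 = 0 := by decide
  rcases h p with rfl | rfl <;> rcases h r with rfl | rfl <;> simp [sgn, e]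

theorem glProj_glProj {n : ℕ} (p r : ZMod 2) (X : gl n) :
    glProj n p (glProj n r X) = if p = r then glProj n r X else 0 := by
  ext i j
  by_cases h : p = r
  · subst h
    rw [glProj_apply, if_pos rfl, glProj_apply]
    split_ifs <;> rfl
  · simp only [glProj_apply, if_neg h, Matrix.zero_apply]
    split_ifs with h1 h2
    · exact absurd (h1.symm.trans h2) h
    · rfl
    · rfl

theorem qProj_qProj {n : ℕ} (p r : ZMod 2) (X : q n) :
    qProj n p (qProj n r X) = if p = r then qProj n r X else 0 := by
  apply Subtype.ext
  refine (glProj_glProj p r X.1).trans ?_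
  split_ifs <;> rfl

theorem qProj_mem {n : ℕ} (p : ZMod 2) (X : q n) : qProj n p X ∈ qDeg n p := by
  change qProj n p (qProj n p X) = qProj n p X
  rw [qProj_qProj, if_pos rfl]

theorem qProj_of_mem {n : ℕ} {p : ZMod 2} {X : q n} (hX : X ∈ qDeg n p) (r : ZMod 2) :
    qProj n r X = if r = p then X else 0 := by
  have h : qProj n p X = X := hX
  rw [← h, qProj_qProj]

theorem glProj_mul {n : ℕ} (p r : ZMod 2) (X Y : gl n) :
    glProj n (p + r) (glProj n p X * glProj n r Y) = glProj n p X * glProj n r Y := by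
  ext i j
  rw [glProj_apply]
  split_ifs with h
  · rfl
  · rw [Matrix.mul_apply, eq_comm]
    refine Finset.sum_eq_zero fun k _ => ?_
    rw [glProj_apply, glProj_apply]
    split_ifs with h1 h2
    · refine absurd ?_ h
      rw [← h1, ← h2]
      generalize i.par = a
      generalize j.par = b
      generalize k.par = c
      revert a b c
      decide
    · exact mul_zero _
    · exact zero_mul _
    · exact zero_mul _

theorem qBracket_mem {n : ℕ} {p r : ZMod 2} {X Y : q n} (hX : X ∈ qDeg n p)
    (hY : Y ∈ qDeg n r) : qBracket n X Y ∈ qDeg n (p + r) := by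
  have h : ∀ a b : ZMod 2, a = p → b = r →
      glProj n (p + r) (glProj n a X * glProj n b Y - sgn (a * b) •
        (glProj n b Y * glProj n a X)) =
      glProj n a X * glProj n b Y - sgn (a * b) • (glProj n b Y * glProj n a X) := by
    rintro a b rfl rfl
    rw [map_sub, map_smul, glProj_mul, add_comm, glProj_mul]
  have hX' : ∀ a, a ≠ p → glProj n a X = 0 := fun a ha =>
    (congrArg Subtype.val (qProj_of_mem hX a)).trans (by rw [if_neg ha]; rfl)
  have hY' : ∀ b, b ≠ r → glProj n b Y = 0 := fun b hb =>
    (congrArg Subtype.val (qProj_of_mem hY b)).trans (by rw [if_neg hb]; rfl)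
  apply Subtype.ext
  change glProj n (p + r) (glBracket n X Y) = glBracket n X Y
  simp only [glBracket, map_sum]
  refine Finset.sum_congr rfl fun a _ => Finset.sum_congr rfl fun b _ => ?_
  by_cases ha : a = p
  · by_cases hb : b = r
    · exact h a b ha hb
    · simp [hY' b hb]
  · simp [hX' a ha]

/-- The map on `q_n` which multiplies the elements of degree `r` by `(-1)^{pr}`. -/
def qTwist (n : ℕ) (p : ZMod 2) : q n →ₗ[ℂ] q n := ∑ r : ZMod 2, sgn (p * r) • qProj n r

theorem qTwist_of_mem {n : ℕ} (p : ZMod 2) {r : ZMod 2} {X : q n} (hX : X ∈ qDeg n r) :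
    qTwist n p X = sgn (p * r) • X := by
  simp only [qTwist, LinearMap.sum_apply, LinearMap.smul_apply, qProj_of_mem hX]
  rw [Finset.sum_eq_single r (fun b _ hb => by rw [if_neg hb, smul_zero])
    (fun h => absurd (Finset.mem_univ r) h), if_pos rfl]

/-- The automorphism of `S(q_n)` which multiplies the elements of degree `r` by `(-1)^{pr}`. -/
def S.twist (n : ℕ) (p : ZMod 2) : S n →ₐ[ℂ] S n :=
  S.lift (S.ι n ∘ₗ qTwist n p) (by
    intro a b X Y hX hY
    simp only [LinearMap.comp_apply, qTwist_of_mem p hX, qTwist_of_mem p hY, map_smul]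
    rw [smul_mul_smul_comm, smul_mul_smul_comm, S.ι_swap hX hY, smul_smul, smul_smul,
      mul_comm (sgn (a * b)), mul_comm (sgn (p * a))])

/-- An auxiliary map, used to extend `Y ↦ [X_p, Y]` to a superderivation of `S(q_n)`. -/
def adMatrixGen (n : ℕ) (p : ZMod 2) (X : q n) : q n →ₗ[ℂ] Matrix (Fin 2) (Fin 2) (S n) where
  toFun Y := !![S.ι n (qTwist n p Y), S.ι n (qBracket n (qProj n p X) Y); 0, S.ι n Y]
  map_add' Y Z := by
    ext i j
    fin_cases i <;> fin_cases j <;> simp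
  map_smul' c Y := by
    ext i j
    fin_cases i <;> fin_cases j <;> simp

/-- An auxiliary homomorphism: its value at `a` is the matrix with the rows
`((-1)^{p deg a} a, [X_p, a])` and `(0, a)`. -/
def adMatrix (n : ℕ) (p : ZMod 2) (X : q n) : S n →ₐ[ℂ] Matrix (Fin 2) (Fin 2) (S n) :=
  S.lift (adMatrixGen n p X) (by
    intro a b Y Z hY hZ
    have hB := qBracket_mem (qProj_mem p X) hY
    have hC := qBracket_mem (qProj_mem p X) hZ
    have h1 := S.ι_swap hY hC
    have h2 := S.ι_swap hB hZ
    have h3 := S.ι_swap hY hZ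
    have hp : ∀ p a b : ZMod 2, p * a + a * (p + b) = a * b ∧
      (p + a) * b = a * b + p * b := by decide
    simp only [adMatrixGen, LinearMap.coe_mk, AddHom.coe_mk, qTwist_of_mem p hY,
      qTwist_of_mem p hZ, map_smul, Matrix.mul_fin_two, Matrix.smul_of]
    ext i j
    fin_cases i <;> fin_cases j
    · simp [h3, smul_smul, mul_comm, mul_left_comm, mul_assoc]
    · simp only [Matrix.of_apply, Matrix.cons_val', Matrix.cons_val_zero, Matrix.cons_val_one,
        Fin.zero_eta, Fin.mk_one, Fin.isValue, smul_mul_assoc, h1, h2, smul_smul, smul_add,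
        Matrix.cons_val_fin_one, Matrix.smul_cons, Pi.smul_apply]
      rw [← sgn_add, (hp p a b).1, (hp p a b).2, sgn_add, add_comm]
    · simp
    · simp [h3])

theorem adMatrix_shape {n : ℕ} (p : ZMod 2) (X : q n) (a : S n) :
    adMatrix n p X a 0 0 = S.twist n p a ∧ adMatrix n p X a 1 0 = 0 ∧
      adMatrix n p X a 1 1 = a := by
  induction a using S.induction with
  | scalar c => simp [Matrix.algebraMap_matrix_apply]
  | gen Y => simp [adMatrix, S.twist, S.lift_ι, adMatrixGen]
  | mul a b ha hb =>
    obtain ⟨h1, h2, h3⟩ := ha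
    obtain ⟨g1, g2, g3⟩ := hb
    simp [map_mul, Matrix.mul_apply, h1, h2, h3, g1, g2, g3]
  | add a b ha hb =>
    obtain ⟨h1, h2, h3⟩ := ha
    obtain ⟨g1, g2, g3⟩ := hb
    simp [map_add, Matrix.add_apply, h1, h2, h3, g1, g2, g3]

/-- The adjoint action on `S(q_n)` of the component of degree `p` of `X`: the superderivation
of degree `p` which extends `Y ↦ [X_p, Y]`. -/
def adComp (n : ℕ) (p : ZMod 2) (X : q n) : S n →ₗ[ℂ] S n where
  toFun a := adMatrix n p X a 0 1
  map_add' a b := by rw [map_add, Matrix.add_apply]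
  map_smul' c a := by rw [map_smul, Matrix.smul_apply, RingHom.id_apply]

theorem adComp_ι {n : ℕ} (p : ZMod 2) (X Y : q n) :
    adComp n p X (S.ι n Y) = S.ι n (qBracket n (qProj n p X) Y) := by
  simp [adComp, adMatrix, S.lift_ι, adMatrixGen]

theorem adComp_mul {n : ℕ} (p : ZMod 2) (X : q n) (a b : S n) :
    adComp n p X (a * b) = adComp n p X a * b + S.twist n p a * adComp n p X b := by
  change adMatrix n p X (a * b) 0 1 = adMatrix n p X a 0 1 * b + _ * adMatrix n p X b 0 1
  rw [map_mul, Matrix.mul_apply, Fin.sum_univ_two, (adMatrix_shape p X a).1,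
    (adMatrix_shape p X b).2.2, add_comm]

theorem adComp_algebraMap {n : ℕ} (p : ZMod 2) (X : q n) (c : ℂ) :
    adComp n p X (algebraMap ℂ (S n) c) = 0 := by
  simp [adComp, Matrix.algebraMap_matrix_apply]

theorem adComp_congr {n : ℕ} {p : ZMod 2} {X Y : q n} (h : qProj n p X = qProj n p Y) :
    adComp n p X = adComp n p Y := by
  have e : adMatrixGen n p X = adMatrixGen n p Y := by
    simp only [adMatrixGen, h]
  simp only [adComp, adMatrix, e]

theorem adComp_eq_zero {n : ℕ} {p : ZMod 2} {X : q n} (h : qProj n p X = 0) (a : S n) :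
    adComp n p X a = 0 := by
  have hb : ∀ Y, qBracket n (qProj n p X) Y = 0 := fun Y => by
    rw [h]
    apply Subtype.ext
    change glBracket n 0 Y = 0
    simp [glBracket]
  induction a using S.induction with
  | scalar c => exact adComp_algebraMap p X c
  | gen Y => rw [adComp_ι, hb, map_zero]
  | mul a b ha hb => rw [adComp_mul, ha, hb, zero_mul, mul_zero, add_zero]
  | add a b ha hb => rw [map_add, ha, hb, add_zero]

/-- The adjoint action of `X` in `q_n` on `S(q_n)`. For `X` of degree `p` it is the linear map
with `ad X Y = [X, Y]` for `Y` in `q_n` and `ad X (a b) = ad X a · b + (-1)^{p deg a} a · ad X b`. -/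
def ad (n : ℕ) (X : q n) : S n →ₗ[ℂ] S n := ∑ p : ZMod 2, adComp n p X

theorem ad_qProj {n : ℕ} (p : ZMod 2) (X : q n) : ad n (qProj n p X) = adComp n p X := by
  rw [ad, Finset.sum_eq_single p]
  · exact adComp_congr (by rw [qProj_qProj, if_pos rfl])
  · intro r _ hr
    ext1 a
    exact adComp_eq_zero (by rw [qProj_qProj, if_neg hr]) a
  · exact fun h => absurd (Finset.mem_univ p) h

theorem qProj_F {n : ℕ} (p : ZMod 2) (i j : Idx n) :
    qProj n p (F i j) = if i.par + j.par = p then F i j else 0 := by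
  apply Subtype.ext
  change glProj n p (Matrix.single i j 1 + Matrix.single i.opp j.opp 1) = _
  have h : ∀ k l : Idx n, glProj n p (Matrix.single k l (1 : ℂ)) =
      if k.par + l.par = p then Matrix.single k l 1 else 0 := by
    intro k l
    ext a b
    by_cases e : k = a ∧ l = b
    · obtain ⟨rfl, rfl⟩ := e
      rw [glProj_apply]
      split_ifs <;> rfl
    · rw [glProj_apply]
      split_ifs <;> simp [e]
  rw [map_add, h, h, opp_par_add]
  split_ifs
  · rfl
  · exact add_zero _

theorem qProj_mem_qM {N M : ℕ} (p : ZMod 2) {X : q (N + M)} (hX : X ∈ qM N M) :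
    qProj (N + M) p X ∈ qM N M := by
  induction hX using Submodule.span_induction with
  | mem X h =>
    obtain ⟨i, j, hi, hj, rfl⟩ := h
    rw [qProj_F]
    split_ifs
    · exact Submodule.subset_span ⟨i, j, hi, hj, rfl⟩
    · exact Submodule.zero_mem _
  | zero => rw [map_zero]; exact Submodule.zero_mem _
  | add X Y _ _ hX hY => rw [map_add]; exact Submodule.add_mem _ hX hY
  | smul c X _ hX => rw [map_smul]; exact Submodule.smul_mem _ c hX

/-- The subalgebra `S(q_{N+M})^{q_M}` of the `q_M`-invariants in `S(q_{N+M})`. -/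
def invariants (N M : ℕ) : Subalgebra ℂ (S (N + M)) where
  carrier := {a | ∀ X ∈ qM N M, ad (N + M) X a = 0}
  mul_mem' {a b} ha hb X hX := by
    have h : ∀ p, adComp (N + M) p X (a * b) = 0 := fun p => by
      rw [adComp_mul, ← ad_qProj, ha _ (qProj_mem_qM p hX), hb _ (qProj_mem_qM p hX),
        zero_mul, mul_zero, add_zero]
    rw [ad, LinearMap.sum_apply]
    exact Finset.sum_eq_zero fun p _ => h p
  add_mem' {a b} ha hb X hX := by rw [map_add, ha X hX, hb X hX, add_zero]
  algebraMap_mem' c X _ := by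
    rw [ad, LinearMap.sum_apply]
    exact Finset.sum_eq_zero fun p _ => adComp_algebraMap p X c

/-! ### The generators -/

/-- The element `f_ij^(m)` of `S(q_n)` for `m ≥ 1`, the sum over `k_1, …, k_{m-1}` in
`{±1, …, ±n}` of `(-1)^{k̄_1 + … + k̄_{m-1}} F_{i k_1} F_{k_1 k_2} ⋯ F_{k_{m-1} j}`.
The value at `m = 0` is not used. -/
def f (n : ℕ) : ℕ → Idx n → Idx n → S n
  | 0, _, _ => 0
  | 1, i, j => S.ι n (F i j)
  | m + 2, i, j => ∑ k : Idx n, sgn k.par • (S.ι n (F i k) * f n (m + 1) k j)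

/-- The element `c^(m)`, the sum of `f_kk^(m)` over `k` in `{±1, …, ±n}`. -/
def c (n m : ℕ) : S n := ∑ k : Idx n, f n m k k

end Queer

end

/-! The argument is a first fundamental theorem obtained from Sergeev's analogue of Schur-Weyl
duality. Write n = N + M. An element a of S(q_n) is encoded by its polarizations `pol n k
Finset.univ a`, operators on the k-th tensor power of ℂ^{n|n}. On products of k elements of q_n,
`symb` undoes polarization up to the factor 2^k k!, and it kills the polarizations of products of
other lengths (`symb_pol_prod`). Hence it suffices that the symbols of all polarizations of an
invariant lie in `genAlg` (`mem_of_symb_pol_mem`).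

The polarization T of an invariant supercommutes with the diagonal action of q_M (`diag_mul_pol`).
Multiplying the odd part of T by the parity operator gives an operator which commutes in the
ordinary sense with the diagonal action of `core`, that is, of ℂ1 + q_M. By
`mem_sergeevAlg_of_commute` such an operator lies in the algebra generated by the transpositions of
tensor factors, the odd operator Π in each factor, and the even units E_ij with |i|, |j| ≤ N in each
factor. This algebra is closed under the adjoint, so by the bicommutant theorem only its commutant
has to be found. Averaging puts each tensor factor of an element of the commutant into `core`
(`avg_rho_mem`), commuting with transpositions makes it symmetric, and symmetric products are
polynomials in the diagonal action (`apply_one_mem_diagAlg`).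

Up to the parity operator, the Sergeev algebra is spanned by normal forms
(`exists_of_mem_sergeevAlg`). Just as a permutation is a product of cycles, a normal form is a
multiple of a product of traces of cyclic words in the letters 1, Π and E_ij (`Sergeev.exists_cyc`).
Its symbol is then a product of traces of words in the matrix of the F_ij (`Sergeev.symb_mem`). A
letter E_ij cuts such a word into entries f_ij^(m). Without such letters the Π gather on the left
and square to 1; what remains is c^(m) with m odd or a trace which vanishes (`cyc_const_mem`).

Conversely, all matrices of f^(m) obey the same commutator formula under the adjoint action as the
matrix of the F_ij (`adComp_fm`), and this makes the generators invariant. -/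

noncomputable section

namespace Queer

/-! ### The bicommutant of a matrix algebra closed under the adjoint -/

/-- Orthogonal projection for the form tr(X*Y). The adjoint of left multiplication by r is left
multiplication by r*, so R and its orthogonal complement are both stable under R and the projection
is left R-linear. -/
theorem exists_adjoint_projection {ι : Type*} [Fintype ι] [DecidableEq ι]
    (R : Subalgebra ℂ (Matrix ι ι ℂ)) (hstar : ∀ X ∈ R, X.conjTranspose ∈ R) :
    ∃ π : Matrix ι ι ℂ →ₗ[ℂ] Matrix ι ι ℂ, (∀ X, π X ∈ R) ∧ (∀ X ∈ R, π X = X) ∧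
      ∀ r ∈ R, ∀ X, π (r * X) = r * π X := by
  classical
  let e : Matrix ι ι ℂ ≃ₗ[ℂ] EuclideanSpace ℂ (ι × ι) :=
    (LinearEquiv.curry ℂ ℂ ι ι).symm ≪≫ₗ (WithLp.linearEquiv 2 ℂ (ι × ι → ℂ)).symm
  have he : ∀ X Y, inner ℂ (e X) (e Y) = (X.conjTranspose * Y).trace := by
    intro X Y
    simp only [PiLp.inner_apply, Matrix.trace, Matrix.diag, Matrix.mul_apply,
      Matrix.conjTranspose_apply, RCLike.inner_apply, Fintype.sum_prod_type]
    rw [Finset.sum_comm]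
    refine Finset.sum_congr rfl fun i _ => Finset.sum_congr rfl fun j _ => ?_
    exact mul_comm _ _
  let W : Submodule ℂ (EuclideanSpace ℂ (ι × ι)) := (Subalgebra.toSubmodule R).map e.toLinearMap
  have hW : ∀ X, e X ∈ W ↔ X ∈ R := fun X => by
    constructor
    · rintro ⟨Y, hY, h⟩
      rw [← e.injective h]
      exact hY
    · exact fun h => Submodule.mem_map_of_mem h
  have hW' : ∀ Y, e Y ∈ Wᗮ ↔ ∀ X ∈ R, (X.conjTranspose * Y).trace = 0 := by
    intro Y
    constructor
    · intro h X hX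
      rw [← he]
      exact (Submodule.mem_orthogonal _ _).1 h _ ((hW X).2 hX)
    · intro h
      refine (Submodule.mem_orthogonal _ _).2 ?_
      rintro _ ⟨X, hX, rfl⟩
      exact (he X Y).trans (h X hX)
  let π : Matrix ι ι ℂ →ₗ[ℂ] Matrix ι ι ℂ :=
    e.symm.toLinearMap ∘ₗ W.starProjection.toLinearMap ∘ₗ e.toLinearMap
  have hπ : ∀ X, e (π X) = W.starProjection (e X) := fun X => e.apply_symm_apply _
  have h1 : ∀ X, π X ∈ R := fun X => by
    rw [← hW, hπ]
    exact Submodule.starProjection_apply_mem _ _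
  refine ⟨π, h1, ?_, ?_⟩
  · intro X hX
    apply e.injective
    rw [hπ]
    exact Submodule.starProjection_eq_self_iff.2 ((hW X).2 hX)
  · intro r hr X
    apply e.injective
    rw [hπ]
    refine Submodule.eq_starProjection_of_mem_orthogonal ((hW _).2 (R.mul_mem hr (h1 X))) ?_
    rw [← map_sub, hW']
    intro Y hY
    have h := Submodule.sub_starProjection_mem_orthogonal (K := W) (e X)
    rw [← hπ, ← map_sub, hW'] at h
    rw [← mul_sub, ← mul_assoc]
    have h' := h (r.conjTranspose * Y) (R.mul_mem (hstar r hr) hY)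
    rwa [Matrix.conjTranspose_mul, Matrix.conjTranspose_conjTranspose] at h'

/-- A matrix which commutes with the commutant of a matrix algebra closed under the adjoint
belongs to this algebra. -/
theorem mem_of_commute_commutant {ι : Type*} [Fintype ι] [DecidableEq ι]
    (R : Subalgebra ℂ (Matrix ι ι ℂ)) (hstar : ∀ X ∈ R, X.conjTranspose ∈ R)
    (T : Matrix ι ι ℂ) (hT : ∀ A, (∀ X ∈ R, A * X = X * A) → A * T = T * A) : T ∈ R := by
  obtain ⟨π, h1, h2, h3⟩ := exists_adjoint_projection R hstar
  have hp : ∀ (X : Matrix ι ι ℂ) (i b : ι),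
      π X i b = ∑ c, ∑ j, X j c * π (Matrix.single j c 1) i b := by
    intro X i b
    conv_lhs => rw [Matrix.matrix_eq_sum_single X]
    simp only [map_sum, Matrix.sum_apply]
    rw [Finset.sum_comm]
    refine Finset.sum_congr rfl fun c _ => Finset.sum_congr rfl fun j _ => ?_
    have : Matrix.single j c (X j c) = X j c • Matrix.single j c (1 : ℂ) := by
      simp
    rw [this, map_smul]; rfl
  -- For fixed b and c this matrix puts a vector in column c, projects, and reads off column b. It
  -- is R-linear because `π` is.
  have hq : ∀ b c, ∀ r ∈ R, (Matrix.of fun i j => π (Matrix.single j c 1) i b) * r =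
      r * Matrix.of fun i j => π (Matrix.single j c 1) i b := by
    intro b c r hr
    ext i j
    have h := congrFun (congrFun (h3 r hr (Matrix.single j c 1)) i) b
    rw [hp] at h
    simp only [Matrix.mul_apply (M := r) (N := π _)] at h
    simp only [Matrix.mul_apply, Matrix.of_apply]
    rw [← h]
    symm
    rw [Finset.sum_eq_single c]
    · refine Finset.sum_congr rfl fun l _ => ?_
      simp [mul_comm]
    · intro a _ ha
      refine Finset.sum_eq_zero fun l _ => ?_
      simp [ha]
    · simp
  -- T commutes with all these blocks, hence with `π`; evaluating at 1 = ∑ E_cc gives T = π T, an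
  -- element of R.
  have h : T * π 1 = π (T * 1) := by
    ext i b
    have hs : (1 : Matrix ι ι ℂ) = ∑ c, Matrix.single c c 1 := (Matrix.sum_single_one).symm
    have hc : ∀ c : ι, ∑ j, T j c * π (Matrix.single j c 1) i b =
        ∑ l, T i l * π (Matrix.single c c 1) l b := by
      intro c
      have := congrFun (congrFun (hT _ (hq b c)) i) c
      simp only [Matrix.mul_apply, Matrix.of_apply] at this
      rw [← this]
      simp [mul_comm]
    rw [mul_one, hp, Matrix.mul_apply]
    simp only [hc]
    rw [Finset.sum_comm]
    refine Finset.sum_congr rfl fun l _ => ?_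
    rw [← Finset.mul_sum, ← Matrix.sum_apply, ← map_sum, ← hs]
  rw [h2 1 R.one_mem, mul_one] at h
  rw [h]
  exact h1 T

/-! ### Homogeneous matrices -/

theorem zmod_two_cases (p : ZMod 2) : p = 0 ∨ p = 1 := by
  revert p; decide

theorem zmod_two_add_self (p : ZMod 2) : p + p = 0 := by
  revert p; decide

@[simp] theorem sgn_zero : sgn 0 = 1 := if_pos rfl

@[simp] theorem sgn_one : sgn 1 = -1 := if_neg (by decide)

theorem sgn_ne_zero (p : ZMod 2) : sgn p ≠ 0 := by
  intro h
  have := sgn_mul_self p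
  rw [h, zero_mul] at this
  exact zero_ne_one this

/-- The matrix `x` is homogeneous of degree `p`. -/
def IsHom {n : ℕ} (p : ZMod 2) (x : gl n) : Prop := ∀ i j, x i j ≠ 0 → i.par + j.par = p

theorem isHom_glProj {n : ℕ} (p : ZMod 2) (x : gl n) : IsHom p (glProj n p x) := by
  intro i j h
  rw [glProj_apply] at h
  by_contra h'
  exact h (if_neg h')

theorem glProj_of_isHom {n : ℕ} {p : ZMod 2} {x : gl n} (hx : IsHom p x) (a : ZMod 2) :
    glProj n a x = if a = p then x else 0 := by
  ext i j
  rw [glProj_apply]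
  by_cases h : x i j = 0
  · split_ifs <;> simp [h]
  · rw [hx i j h]
    by_cases h' : p = a
    · rw [if_pos h', if_pos h'.symm]
    · rw [if_neg h', if_neg (Ne.symm h')]
      rfl

theorem isHom_single {n : ℕ} (i j : Idx n) (c : ℂ) :
    IsHom (i.par + j.par) (Matrix.single i j c) := by
  intro a b h
  by_cases e : i = a ∧ j = b
  · rw [e.1, e.2]
  · exact absurd (Matrix.single_apply_of_ne _ _ _ _ _ e) h

theorem isHom_one {n : ℕ} : IsHom 0 (1 : gl n) := by
  intro i j h
  by_cases e : i = j
  · rw [e, zmod_two_add_self]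
  · exact absurd (Matrix.one_apply_ne e) h

theorem IsHom.mul {n : ℕ} {p r : ZMod 2} {x y : gl n} (hx : IsHom p x) (hy : IsHom r y) :
    IsHom (p + r) (x * y) := by
  intro i j h
  rw [Matrix.mul_apply] at h
  obtain ⟨k, _, hk⟩ := Finset.exists_ne_zero_of_sum_ne_zero h
  rw [← hx i k (left_ne_zero_of_mul hk), ← hy k j (right_ne_zero_of_mul hk)]
  generalize i.par = a
  generalize j.par = b
  generalize k.par = c
  revert a b c
  decide

theorem IsHom.add {n : ℕ} {p : ZMod 2} {x y : gl n} (hx : IsHom p x) (hy : IsHom p y) :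
    IsHom p (x + y) := fun i j h => by
  by_cases h' : x i j = 0
  · exact hy i j fun h'' => h (by simp [h', h''])
  · exact hx i j h'

theorem sum_glProj {n : ℕ} (x : gl n) : ∑ a, glProj n a x = x := by
  ext i j
  rw [Matrix.sum_apply, Finset.sum_eq_single (i.par + j.par), glProj_apply, if_pos rfl]
  · intro b _ hb
    rw [glProj_apply, if_neg (Ne.symm hb)]
  · simp

theorem gl_induction {n : ℕ} {C : gl n → Prop} (hom : ∀ p x, IsHom p x → C x)
    (add : ∀ x y, C x → C y → C (x + y)) (x : gl n) : C x := by
  rw [← sum_glProj x]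
  have h : (Finset.univ : Finset (ZMod 2)) = {0, 1} := rfl
  rw [h, Finset.sum_pair (by decide)]
  exact add _ _ (hom _ _ (isHom_glProj _ _)) (hom _ _ (isHom_glProj _ _))

theorem gl_single_induction {n : ℕ} {C : gl n → Prop} (zero : C 0)
    (single : ∀ i j c, C (Matrix.single i j c))
    (add : ∀ x y, C x → C y → C (x + y)) (x : gl n) : C x := by
  rw [Matrix.matrix_eq_sum_single x]
  exact Finset.sum_induction _ C add zero fun i _ =>
    Finset.sum_induction _ C add zero fun j _ => single _ _ _

/-- The diagonal matrix with the entries `(-1)^{a ī}`. -/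
def Dp (n : ℕ) (a : ZMod 2) : gl n := Matrix.diagonal fun i => sgn (a * i.par)

@[simp] theorem Dp_zero (n : ℕ) : Dp n 0 = 1 := by
  simp [Dp]

theorem Dp_mul_Dp (n : ℕ) (a b : ZMod 2) : Dp n a * Dp n b = Dp n (a + b) := by
  rw [Dp, Dp, Dp, Matrix.diagonal_mul_diagonal]
  congr 1
  funext i
  rw [add_mul, sgn_add]

theorem Dp_mul_self (n : ℕ) (a : ZMod 2) : Dp n a * Dp n a = 1 := by
  rw [Dp_mul_Dp, zmod_two_add_self, Dp_zero]

theorem isHom_Dp (n : ℕ) (a : ZMod 2) : IsHom 0 (Dp n a) := by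
  intro i j h
  by_cases e : i = j
  · rw [e, zmod_two_add_self]
  · exact absurd (Matrix.diagonal_apply_ne _ e) h

theorem IsHom.Dp_mul {n : ℕ} {p : ZMod 2} {x : gl n} (hx : IsHom p x) (a : ZMod 2) :
    Dp n a * x = sgn (a * p) • (x * Dp n a) := by
  ext i j
  rw [Dp, Matrix.diagonal_mul, Matrix.smul_apply, Matrix.mul_diagonal]
  by_cases h : x i j = 0
  · simp [h]
  · rw [← hx i j h, mul_add, sgn_add, smul_eq_mul]
    linear_combination (-(sgn (a * i.par)) * x i j) * sgn_mul_self (a * j.par)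

theorem Dp_conjTranspose (n : ℕ) (a : ZMod 2) : (Dp n a).conjTranspose = Dp n a := by
  rw [Dp, Matrix.diagonal_conjTranspose]
  congr 1
  funext i
  rcases zmod_two_cases (a * i.par) with h | h <;> simp [h]

theorem Dp_transpose (n : ℕ) (a : ZMod 2) : (Dp n a).transpose = Dp n a :=
  Matrix.diagonal_transpose _

theorem IsHom.conjTranspose {n : ℕ} {p : ZMod 2} {x : gl n} (hx : IsHom p x) :
    IsHom p x.conjTranspose := fun i j h => by
  rw [add_comm]
  exact hx j i fun h' => h (by simp [h'])

theorem IsHom.transpose {n : ℕ} {p : ZMod 2} {x : gl n} (hx : IsHom p x) :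
    IsHom p x.transpose := fun i j h => by
  rw [add_comm]
  exact hx j i h

/-! ### Operators on tensor powers -/

/-- The operators on the `k`-th tensor power of `ℂ^{n|n}`. -/
abbrev Op (n k : ℕ) : Type := Matrix (Fin k → Idx n) (Fin k → Idx n) ℂ

/-- The tensor product of matrices, without any signs. -/
def pk {n k : ℕ} (M : Fin k → gl n) : Op n k := Matrix.of fun I J => ∏ r, M r (I r) (J r)

theorem pk_mul {n k : ℕ} (M M' : Fin k → gl n) : pk M * pk M' = pk fun r => M r * M' r := by
  ext I J
  simp only [pk, Matrix.mul_apply, Matrix.of_apply, Finset.prod_univ_sum, Fintype.piFinset_univ,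
    Finset.prod_mul_distrib]

theorem pk_one {n k : ℕ} : pk (fun _ : Fin k => (1 : gl n)) = 1 := by
  ext I J
  simp only [pk, Matrix.of_apply, Matrix.one_apply]
  by_cases h : I = J
  · simp [h]
  · rw [if_neg h]
    obtain ⟨r, hr⟩ := Function.ne_iff.1 h
    exact Finset.prod_eq_zero (Finset.mem_univ r) (if_neg hr)

theorem pk_conjTranspose {n k : ℕ} (M : Fin k → gl n) :
    (pk M).conjTranspose = pk fun r => (M r).conjTranspose := by
  ext I J
  simp [pk]

theorem pk_eq_smul {n k : ℕ} {M M' : Fin k → gl n} (p : Fin k) (c : ℂ) (hp : M p = c • M' p)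
    (h : ∀ r, r ≠ p → M r = M' r) : pk M = c • pk M' := by
  ext I J
  simp only [pk, Matrix.of_apply, Matrix.smul_apply, smul_eq_mul]
  rw [← Finset.mul_prod_erase _ _ (Finset.mem_univ p),
    ← Finset.mul_prod_erase (f := fun r => M' r (I r) (J r)) _ (Finset.mem_univ p), hp,
    Matrix.smul_apply, smul_eq_mul, mul_assoc]
  congr 2
  refine Finset.prod_congr rfl fun r hr => ?_
  rw [h r (Finset.ne_of_mem_erase hr)]

/-- The tensor factors of the action of a homogeneous `x` of degree `a` in the slot `p`. -/
def slot {n k : ℕ} (p : Fin k) (a : ZMod 2) (x : gl n) : Fin k → gl n :=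
  -- The sign matrices in the factors before p implement the Koszul rule, so that ordinary matrix
  -- multiplication makes different slots supercommute.
  fun r => if r < p then Dp n a else if r = p then x else 1

theorem pk_slot_apply {n k : ℕ} (p : Fin k) (a : ZMod 2) (x : gl n) (I J : Fin k → Idx n) :
    pk (slot p a x) I J = x (I p) (J p) *
      ∏ r ∈ Finset.univ.erase p, (if r < p then Dp n a else 1) (I r) (J r) := by
  rw [pk, Matrix.of_apply, ← Finset.mul_prod_erase _ _ (Finset.mem_univ p)]
  congr 1
  · simp [slot]
  · refine Finset.prod_congr rfl fun r hr => ?_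
    rw [slot, if_neg (Finset.ne_of_mem_erase hr)]

/-- The action of the matrix `x` in the slot `p` of a tensor power of `ℂ^{n|n}`. -/
def rho {n k : ℕ} (p : Fin k) : gl n →ₗ[ℂ] Op n k where
  toFun x := ∑ a, pk (slot p a (glProj n a x))
  map_add' x y := by
    rw [← Finset.sum_add_distrib]
    refine Finset.sum_congr rfl fun a _ => ?_
    ext I J
    simp only [pk_slot_apply, Matrix.add_apply, map_add, add_mul]
  map_smul' c x := by
    rw [RingHom.id_apply, Finset.smul_sum]
    refine Finset.sum_congr rfl fun a _ => ?_
    ext I J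
    simp only [pk_slot_apply, Matrix.smul_apply, map_smul, smul_eq_mul, mul_assoc]

theorem rho_apply {n k : ℕ} (p : Fin k) (x : gl n) :
    rho p x = ∑ a, pk (slot p a (glProj n a x)) := rfl

theorem rho_of_isHom {n k : ℕ} (p : Fin k) {a : ZMod 2} {x : gl n} (hx : IsHom a x) :
    rho p x = pk (slot p a x) := by
  rw [rho_apply, Finset.sum_eq_single a]
  · rw [glProj_of_isHom hx, if_pos rfl]
  · intro b _ hb
    rw [glProj_of_isHom hx, if_neg hb]
    ext I J
    rw [pk_slot_apply, Matrix.zero_apply, zero_mul, Matrix.zero_apply]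
  · simp

theorem slot_mul {n k : ℕ} (p : Fin k) (a b : ZMod 2) (x y : gl n) (r : Fin k) :
    slot p a x r * slot p b y r = slot p (a + b) (x * y) r := by
  simp only [slot]
  split_ifs
  · exact Dp_mul_Dp _ _ _
  · rfl
  · exact one_mul _

theorem rho_mul {n k : ℕ} (p : Fin k) (x y : gl n) : rho p (x * y) = rho p x * rho p y := by
  induction x using gl_induction with
  | hom a x hx =>
    induction y using gl_induction with
    | hom b y hy =>
      rw [rho_of_isHom p hx, rho_of_isHom p hy, rho_of_isHom p (hx.mul hy), pk_mul]
      simp only [slot_mul]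
    | add y z h1 h2 => rw [mul_add, map_add, map_add, h1, h2, mul_add]
  | add x z h1 h2 => rw [add_mul, map_add, map_add, h1, h2, add_mul]

theorem rho_one {n k : ℕ} (p : Fin k) : rho p (1 : gl n) = 1 := by
  rw [rho_of_isHom p isHom_one, ← pk_one]
  congr 1
  funext r
  simp [slot]

/-- The sign comes from slot p alone, where x meets the sign matrix of y; in the remaining slots the
factors commute. -/
theorem rho_swap_of_lt {n k : ℕ} {p r : Fin k} (h : p < r) {a b : ZMod 2} {x y : gl n}
    (hx : IsHom a x) (hy : IsHom b y) : rho p x * rho r y = sgn (a * b) • (rho r y * rho p x) := by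
  rw [rho_of_isHom p hx, rho_of_isHom r hy, pk_mul, pk_mul]
  refine pk_eq_smul p _ ?_ ?_
  · simp only [slot, if_pos h, lt_irrefl, if_true, if_false]
    rw [hx.Dp_mul, smul_smul, mul_comm b a, sgn_mul_self, one_smul]
  · intro u hu
    simp only [slot]
    by_cases h1 : u < p
    · rw [if_pos h1, if_pos (h1.trans h), Dp_mul_Dp, Dp_mul_Dp, add_comm]
    · rw [if_neg h1, if_neg hu, one_mul, mul_one]

theorem rho_swap {n k : ℕ} {p r : Fin k} (h : p ≠ r) {a b : ZMod 2} {x y : gl n}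
    (hx : IsHom a x) (hy : IsHom b y) : rho p x * rho r y = sgn (a * b) • (rho r y * rho p x) := by
  rcases lt_or_gt_of_ne h with h | h
  · exact rho_swap_of_lt h hx hy
  · rw [rho_swap_of_lt h hy hx, smul_smul, mul_comm b a, sgn_mul_self, one_smul]

/-- The sign matrices are real and diagonal. This makes the Sergeev algebra closed under the
adjoint, as the bicommutant theorem requires. -/
theorem rho_conjTranspose {n k : ℕ} (p : Fin k) (x : gl n) :
    (rho p x).conjTranspose = rho p x.conjTranspose := by
  induction x using gl_induction with
  | hom a x hx =>
    rw [rho_of_isHom p hx, rho_of_isHom p hx.conjTranspose, pk_conjTranspose]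
    congr 1
    funext r
    simp only [slot]
    split_ifs
    · exact Dp_conjTranspose _ _
    · rfl
    · exact Matrix.conjTranspose_one
  | add x y h1 h2 => rw [map_add, Matrix.conjTranspose_add, h1, h2, Matrix.conjTranspose_add, map_add]

/-- The parity operator on a tensor power of `ℂ^{n|n}`. -/
def parOp (n k : ℕ) : Op n k := pk fun _ => Dp n 1

theorem parOp_mul_self (n k : ℕ) : parOp n k * parOp n k = 1 := by
  rw [parOp, pk_mul, ← pk_one]
  simp only [Dp_mul_self]

theorem parOp_conjTranspose (n k : ℕ) : (parOp n k).conjTranspose = parOp n k := by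
  rw [parOp, pk_conjTranspose]
  simp only [Dp_conjTranspose]

theorem parOp_mul_rho {n k : ℕ} (p : Fin k) {a : ZMod 2} {x : gl n} (hx : IsHom a x) :
    parOp n k * rho p x = sgn a • (rho p x * parOp n k) := by
  rw [rho_of_isHom p hx, parOp, pk_mul, pk_mul]
  refine pk_eq_smul p _ ?_ ?_
  · simp only [slot, lt_irrefl, if_true, if_false]
    rw [hx.Dp_mul, one_mul]
  · intro r hr
    simp only [slot]
    split_ifs
    · rw [Dp_mul_Dp, Dp_mul_Dp, add_comm]
    · rw [mul_one, one_mul]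

/-! ### Transpositions of tensor factors -/

/-- The transposition of the tensor factors `p` and `r`, for `p ≠ r`. -/
def trans {n k : ℕ} (p r : Fin k) : Op n k :=
  ∑ i, ∑ j : Idx n, sgn j.par • (rho p (Matrix.single i j 1) * rho r (Matrix.single j i 1))

theorem trans_comm {n k : ℕ} {p r : Fin k} (h : p ≠ r) :
    trans (n := n) p r = trans r p := by
  rw [trans, trans, Finset.sum_comm]
  refine Finset.sum_congr rfl fun i _ => Finset.sum_congr rfl fun j _ => ?_
  rw [rho_swap h (isHom_single _ _ _) (isHom_single _ _ _), smul_smul]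
  congr 1
  generalize i.par = a
  generalize j.par = b
  have : (b + a) * (a + b) = a + b := by revert a b; decide
  rw [this, sgn_add, mul_comm, mul_assoc, mul_comm, mul_assoc, sgn_mul_self, mul_one]

/-- The unit E_ab collapses one of the two sums defining `trans`. `rho_single_mul_trans` has the
same right-hand side, and comparing the two yields the intertwining relation `trans_mul_rho_right`.
-/
theorem trans_mul_rho_single {n k : ℕ} (p r : Fin k) (a b : Idx n) :
    trans p r * rho r (Matrix.single a b 1) =
      ∑ i : Idx n, sgn i.par • (rho p (Matrix.single a i 1) * rho r (Matrix.single i b 1)) := by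
  rw [trans, Finset.sum_mul, Finset.sum_eq_single a]
  · rw [Finset.sum_mul]
    refine Finset.sum_congr rfl fun i _ => ?_
    rw [smul_mul_assoc, mul_assoc, ← rho_mul]
    simp
  · intro i _ hi
    rw [Finset.sum_mul]
    refine Finset.sum_eq_zero fun j _ => ?_
    rw [smul_mul_assoc, mul_assoc, ← rho_mul]
    simp [hi]
  · simp

theorem rho_single_mul_trans {n k : ℕ} (p r : Fin k) (a b : Idx n) :
    rho p (Matrix.single a b 1) * trans p r =
      ∑ i : Idx n, sgn i.par • (rho p (Matrix.single a i 1) * rho r (Matrix.single i b 1)) := by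
  rw [trans, Finset.mul_sum, Finset.sum_eq_single b]
  · rw [Finset.mul_sum]
    refine Finset.sum_congr rfl fun i _ => ?_
    rw [mul_smul_comm, ← mul_assoc, ← rho_mul]
    simp
  · intro i _ hi
    rw [Finset.mul_sum]
    refine Finset.sum_eq_zero fun j _ => ?_
    rw [mul_smul_comm, ← mul_assoc, ← rho_mul]
    simp [hi.symm]
  · simp

theorem smul_single_one {n : ℕ} (i j : Idx n) (c : ℂ) :
    (Matrix.single i j c : gl n) = c • Matrix.single i j 1 := by
  simp

theorem trans_mul_rho_right {n k : ℕ} (p r : Fin k) (x : gl n) :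
    trans p r * rho r x = rho p x * trans p r := by
  induction x using gl_single_induction with
  | zero => simp
  | single i j c =>
    rw [smul_single_one, map_smul, map_smul, mul_smul_comm, smul_mul_assoc, trans_mul_rho_single,
      rho_single_mul_trans]
  | add x y h1 h2 => rw [map_add, map_add, mul_add, add_mul, h1, h2]

theorem trans_mul_rho_left {n k : ℕ} {p r : Fin k} (h : p ≠ r) (x : gl n) :
    trans p r * rho p x = rho r x * trans p r := by
  rw [trans_comm h, trans_mul_rho_right]

theorem trans_mul_rho_of_ne {n k : ℕ} {p r u : Fin k} (hp : u ≠ p) (hr : u ≠ r) (x : gl n) :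
    trans p r * rho u x = rho u x * trans p r := by
  induction x using gl_induction with
  | hom a x hx =>
    rw [trans, Finset.sum_mul, Finset.mul_sum]
    refine Finset.sum_congr rfl fun i _ => ?_
    rw [Finset.sum_mul, Finset.mul_sum]
    refine Finset.sum_congr rfl fun j _ => ?_
    rw [smul_mul_assoc, mul_smul_comm, mul_assoc,
      rho_swap hr.symm (isHom_single _ _ _) hx, mul_smul_comm, ← mul_assoc,
      rho_swap hp.symm (isHom_single _ _ _) hx, smul_mul_assoc, smul_smul, mul_assoc,
      add_comm j.par, smul_smul, mul_assoc (sgn j.par), sgn_mul_self, mul_one]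
  | add x y h1 h2 => rw [map_add, mul_add, add_mul, h1, h2]

theorem trans_mul_trans_of_ne {n k : ℕ} {p r u v : Fin k} (h1 : u ≠ p) (h2 : u ≠ r) (h3 : v ≠ p)
    (h4 : v ≠ r) : trans (n := n) p r * trans u v = trans u v * trans p r := by
  rw [trans.eq_def u v]
  simp only [Finset.sum_mul, Finset.mul_sum, smul_mul_assoc, mul_smul_comm]
  refine Finset.sum_congr rfl fun i _ => Finset.sum_congr rfl fun j _ => ?_
  rw [← mul_assoc, trans_mul_rho_of_ne h1 h2, mul_assoc, trans_mul_rho_of_ne h3 h4, mul_assoc]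

theorem trans_mul_trans {n k : ℕ} {p r u : Fin k} (h1 : u ≠ p) (h2 : u ≠ r) :
    trans (n := n) p r * trans p u = trans r u * trans p r := by
  by_cases h : p = r
  · subst h
    rw [trans.eq_def p u]
    simp only [Finset.sum_mul, Finset.mul_sum, smul_mul_assoc, mul_smul_comm]
    refine Finset.sum_congr rfl fun i _ => Finset.sum_congr rfl fun j _ => ?_
    rw [← mul_assoc, trans_mul_rho_right, mul_assoc, trans_mul_rho_of_ne h1 h2, mul_assoc]
  rw [trans.eq_def p u, trans.eq_def r u]
  simp only [Finset.sum_mul, Finset.mul_sum, smul_mul_assoc, mul_smul_comm]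
  refine Finset.sum_congr rfl fun i _ => Finset.sum_congr rfl fun j _ => ?_
  rw [← mul_assoc, trans_mul_rho_left h, mul_assoc, trans_mul_rho_of_ne h1 h2, mul_assoc]

theorem trans_mul_self {n k : ℕ} {p r : Fin k} (h : p ≠ r) :
    trans (n := n) p r * trans p r = 1 := by
  have e : ∀ i j : Idx n, trans p r * (rho r (Matrix.single i j 1) * rho p (Matrix.single j i 1)) =
      sgn j.par • (rho p (Matrix.single i i 1) * rho r (Matrix.single j j 1)) := by
    intro i j
    rw [← mul_assoc, trans_mul_rho_single, Finset.sum_mul, Finset.sum_eq_single j]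
    · rw [smul_mul_assoc, mul_assoc, rho_swap h.symm (isHom_single _ _ _) (isHom_single _ _ _),
        zmod_two_add_self, zero_mul, sgn_zero, one_smul, ← mul_assoc, ← rho_mul]
      simp
    · intro u _ hu
      rw [smul_mul_assoc, mul_assoc, rho_swap h.symm (isHom_single _ _ _) (isHom_single _ _ _),
        mul_smul_comm, ← mul_assoc, ← rho_mul]
      simp [hu]
    · simp
  -- With its slots exchanged, the second factor expands into exactly the products treated in `e`.
  nth_rewrite 2 [trans_comm h]
  rw [trans.eq_def r p, Finset.mul_sum]
  simp only [Finset.mul_sum, mul_smul_comm, e, smul_smul, sgn_mul_self, one_smul]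
  simp only [← Finset.mul_sum, ← map_sum, Matrix.sum_single_one, rho_one,
    mul_one]

theorem trans_conjTranspose {n k : ℕ} {p r : Fin k} (h : p ≠ r) :
    (trans (n := n) p r).conjTranspose = trans p r := by
  conv_rhs => rw [trans_comm h]
  rw [trans, Matrix.conjTranspose_sum, trans]
  refine Finset.sum_congr rfl fun i _ => ?_
  rw [Matrix.conjTranspose_sum]
  refine Finset.sum_congr rfl fun j _ => ?_
  rw [Matrix.conjTranspose_smul, Matrix.conjTranspose_mul, rho_conjTranspose, rho_conjTranspose]
  have : star (sgn j.par) = sgn j.par := by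
    rcases zmod_two_cases j.par with h | h <;> simp [h]
  rw [this]
  simp

theorem parOp_mul_trans {n k : ℕ} (p r : Fin k) :
    parOp n k * trans p r = trans p r * parOp n k := by
  rw [trans, Finset.mul_sum, Finset.sum_mul]
  refine Finset.sum_congr rfl fun i _ => ?_
  rw [Finset.mul_sum, Finset.sum_mul]
  refine Finset.sum_congr rfl fun j _ => ?_
  rw [smul_mul_assoc, mul_smul_comm, ← mul_assoc, parOp_mul_rho p (isHom_single _ _ _),
    smul_mul_assoc, mul_assoc, parOp_mul_rho r (isHom_single _ _ _), mul_smul_comm, smul_smul,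
    mul_assoc, add_comm j.par, smul_smul, mul_assoc (sgn j.par), sgn_mul_self, mul_one]

/-! ### The flip -/

/-- The matrix which exchanges the indices `i` and `-i`. -/
def flp (n : ℕ) : gl n := Matrix.of fun i j => if i = j.opp then 1 else 0

theorem eq_opp_iff {n : ℕ} (i j : Idx n) : i = j.opp ↔ i.opp = j :=
  ⟨fun e => by rw [e, Idx.opp_opp], fun e => by rw [← e, Idx.opp_opp]⟩

theorem flp_mul {n : ℕ} (x : gl n) (i j : Idx n) : (flp n * x) i j = x i.opp j := by
  rw [Matrix.mul_apply, Finset.sum_eq_single i.opp]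
  · simp [flp]
  · intro k _ hk
    rw [flp, Matrix.of_apply, if_neg (fun h => hk ((eq_opp_iff _ _).1 h).symm), zero_mul]
  · simp

theorem mul_flp {n : ℕ} (x : gl n) (i j : Idx n) : (x * flp n) i j = x i j.opp := by
  rw [Matrix.mul_apply, Finset.sum_eq_single j.opp]
  · simp [flp]
  · intro k _ hk
    rw [flp, Matrix.of_apply, if_neg hk, mul_zero]
  · simp

theorem flp_mul_self (n : ℕ) : flp n * flp n = 1 := by
  ext i j
  rw [flp_mul, flp, Matrix.of_apply, Matrix.one_apply]
  simp only [Idx.opp_injective.eq_iff]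

theorem flp_mul_single {n : ℕ} (i j : Idx n) (c : ℂ) :
    flp n * Matrix.single i j c = Matrix.single i.opp j c := by
  ext a b
  rw [flp_mul, Matrix.single_apply, Matrix.single_apply]
  simp only [eq_opp_iff]

theorem single_mul_flp {n : ℕ} (i j : Idx n) (c : ℂ) :
    Matrix.single i j c * flp n = Matrix.single i j.opp c := by
  ext a b
  rw [mul_flp, Matrix.single_apply, Matrix.single_apply]
  simp only [eq_opp_iff]

theorem isHom_flp (n : ℕ) : IsHom 1 (flp n) := by
  intro i j h
  have : i = j.opp := by
    by_contra h'
    exact h (if_neg h')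
  rw [this, Idx.par_opp]
  generalize j.par = a
  revert a
  decide

theorem flp_transpose (n : ℕ) : (flp n).transpose = flp n := by
  ext i j
  have : j = i.opp ↔ i = j.opp := by rw [eq_opp_iff, eq_comm]
  simp only [flp, Matrix.transpose_apply, Matrix.of_apply, this]

theorem flp_conjTranspose (n : ℕ) : (flp n).conjTranspose = flp n := by
  ext i j
  simp only [flp, Matrix.conjTranspose_apply, Matrix.of_apply]
  have : j = i.opp ↔ i = j.opp := by rw [eq_opp_iff, eq_comm]
  by_cases h : i = j.opp <;> simp [this, h]

theorem Idx.opp_ne {n : ℕ} (i : Idx n) : i.opp ≠ i := by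
  intro h
  have h1 : i.par + 1 = i.par := congrArg Idx.par h
  revert h1
  generalize i.par = a
  revert a
  decide

/-! ### Words -/

/-- The matrix with the entries of `z`, regarded as scalars in the algebra `A`. -/
def cm {n : ℕ} {A : Type*} [Ring A] [Algebra ℂ A] : gl n →+* Matrix (Idx n) (Idx n) A :=
  (algebraMap ℂ A).mapMatrix

theorem cm_apply {n : ℕ} {A : Type*} [Ring A] [Algebra ℂ A] (z : gl n) (i j : Idx n) :
    (cm z : Matrix (Idx n) (Idx n) A) i j = algebraMap ℂ A (z i j) := rfl

theorem cm_smul {n : ℕ} {A : Type*} [Ring A] [Algebra ℂ A] (c : ℂ) (z : gl n) :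
    (cm (c • z) : Matrix (Idx n) (Idx n) A) = c • cm z := by
  ext i j
  rw [cm_apply, Matrix.smul_apply, Matrix.smul_apply, cm_apply, smul_eq_mul, map_mul,
    Algebra.smul_def]

theorem trace_cm_mul {n : ℕ} {A : Type*} [Ring A] [Algebra ℂ A] (z : gl n)
    (M : Matrix (Idx n) (Idx n) A) : (cm z * M).trace = (M * cm z).trace := by
  simp only [Matrix.trace, Matrix.diag, Matrix.mul_apply]
  rw [Finset.sum_comm]
  refine Finset.sum_congr rfl fun i _ => Finset.sum_congr rfl fun j _ => ?_
  rw [cm_apply]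
  exact Algebra.commutes _ _

theorem cm_Dp_mul {n : ℕ} {A : Type*} [Ring A] [Algebra ℂ A] (a : ZMod 2)
    (M : Matrix (Idx n) (Idx n) A) (i j : Idx n) :
    (cm (Dp n a) * M : Matrix (Idx n) (Idx n) A) i j = sgn (a * i.par) • M i j := by
  have : (cm (Dp n a) : Matrix (Idx n) (Idx n) A) =
      Matrix.diagonal fun i => algebraMap ℂ A (sgn (a * i.par)) := by
    ext i j
    rw [cm_apply, Dp]
    by_cases h : i = j
    · subst h; simp
    · simp [h]
  rw [this, Matrix.diagonal_mul, Algebra.smul_def]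

theorem mul_cm_Dp {n : ℕ} {A : Type*} [Ring A] [Algebra ℂ A] (a : ZMod 2)
    (M : Matrix (Idx n) (Idx n) A) (i j : Idx n) :
    (M * cm (Dp n a) : Matrix (Idx n) (Idx n) A) i j = sgn (a * j.par) • M i j := by
  have : (cm (Dp n a) : Matrix (Idx n) (Idx n) A) =
      Matrix.diagonal fun i => algebraMap ℂ A (sgn (a * i.par)) := by
    ext i j
    rw [cm_apply, Dp]
    by_cases h : i = j
    · subst h; simp
    · simp [h]
  rw [this, Matrix.mul_diagonal, Algebra.smul_def, Algebra.commutes]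

theorem cm_single_mul {n : ℕ} {A : Type*} [Ring A] [Algebra ℂ A] (a b : Idx n)
    (M : Matrix (Idx n) (Idx n) A) (i j : Idx n) :
    (cm (Matrix.single a b 1) * M : Matrix (Idx n) (Idx n) A) i j = if i = a then M b j else 0 := by
  rw [Matrix.mul_apply, Finset.sum_eq_single b]
  · rw [cm_apply, Matrix.single_apply]
    by_cases h : i = a
    · simp [h]
    · simp [h, Ne.symm h]
  · intro k _ hk
    rw [cm_apply, Matrix.single_apply_of_ne _ _ _ _ _ (fun h => hk h.2.symm), map_zero, zero_mul]
  · simp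

/-- The matrices which span the supercommutant of `q_M` in `gl n`: the identity, the flip, and the
matrix units `E_ij` with `|i|, |j| ≤ N`. -/
inductive Letter (n N : ℕ) : Type
  | one : Letter n N
  | flip : Letter n N
  | unit (i j : Idx n) (hi : i.abs ≤ N) (hj : j.abs ≤ N) : Letter n N

/-- The matrix of a letter. -/
def Letter.mat {n N : ℕ} : Letter n N → gl n
  | one => 1
  | flip => flp n
  | unit i j _ _ => Matrix.single i j 1

/-- The degree of a letter. -/
def Letter.deg {n N : ℕ} : Letter n N → ZMod 2
  | one => 0
  | flip => 1
  | unit i j _ _ => i.par + j.par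

theorem Letter.isHom {n N : ℕ} (y : Letter n N) : IsHom y.deg y.mat := by
  cases y
  · exact isHom_one
  · exact isHom_flp n
  · exact isHom_single _ _ _

section Word

variable {n N : ℕ} {κ A : Type*} [Ring A] [Algebra ℂ A]

/-- The product of the matrices `y E_p D` over a list of pairs `(y, p)`, where `D` is the diagonal
matrix with the entries `(-1)^ī`. -/
def word (E : κ → Matrix (Idx n) (Idx n) A) : List (Letter n N × κ) → Matrix (Idx n) (Idx n) A
  | [] => 1
  | y :: l => cm y.1.mat * (E y.2 * (cm (Dp n 1) * word E l))

/-- The sum of the degrees of the letters. -/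
def wdeg (l : List (Letter n N × κ)) : ZMod 2 := (l.map fun y => y.1.deg).sum

theorem wdeg_cons (y : Letter n N × κ) (l : List (Letter n N × κ)) :
    wdeg (y :: l) = y.1.deg + wdeg l := rfl

theorem wdeg_append (l l' : List (Letter n N × κ)) : wdeg (l ++ l') = wdeg l + wdeg l' := by
  simp [wdeg]

theorem word_append (E : κ → Matrix (Idx n) (Idx n) A) (l l' : List (Letter n N × κ)) :
    word E (l ++ l') = word E l * word E l' := by
  induction l with
  | nil => rw [List.nil_append, word, one_mul]
  | cons y l ih => simp only [List.cons_append, word, ih, mul_assoc]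

/-- The invariant trace of a word. -/
def cyc (E : κ → Matrix (Idx n) (Idx n) A) (l : List (Letter n N × κ)) : A :=
  -- With this exponent the trace is cyclic up to a sign independent of the entries, see
  -- `cyc_append_comm`. For a nonempty word of degree 0 the sign matrix cancels the one at the end
  -- of the word.
  (cm (Dp n (wdeg l + 1)) * word E l).trace

/-- The entries of the matrix `M` of degree `d` supercommute with `b` of degree `β`. -/
def SuperComm (b : A) (β d : ZMod 2) (M : Matrix (Idx n) (Idx n) A) : Prop :=
  ∀ i j, M i j * b = sgn ((i.par + j.par + d) * β) • (b * M i j)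

theorem SuperComm.mul {b : A} {β d d' : ZMod 2} {M M' : Matrix (Idx n) (Idx n) A}
    (h : SuperComm b β d M) (h' : SuperComm b β d' M') : SuperComm b β (d + d') (M * M') := by
  intro i j
  rw [Matrix.mul_apply, Finset.sum_mul, Finset.mul_sum, Finset.smul_sum]
  refine Finset.sum_congr rfl fun k _ => ?_
  rw [mul_assoc, h', mul_smul_comm, ← mul_assoc, h, smul_mul_assoc, smul_smul, ← sgn_add, mul_assoc]
  congr 2
  generalize i.par = a
  generalize j.par = c
  generalize k.par = e
  clear h h'
  revert a c e d d' β
  decide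

theorem superComm_cm (b : A) (β : ZMod 2) {d : ZMod 2} {z : gl n} (hz : IsHom d z) :
    SuperComm b β d (cm z) := by
  intro i j
  rw [cm_apply, Algebra.commutes]
  by_cases h : z i j = 0
  · simp [h]
  · rw [hz i j h, zmod_two_add_self, zero_mul, sgn_zero, one_smul]

theorem superComm_word {E : κ → Matrix (Idx n) (Idx n) A} {b : A} {β : ZMod 2}
    (l : List (Letter n N × κ)) (h : ∀ y ∈ l, SuperComm b β 0 (E y.2)) :
    SuperComm b β (wdeg l) (word E l) := by
  induction l with
  | nil =>
    have := superComm_cm b β (isHom_one (n := n))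
    rwa [map_one] at this
  | cons y l ih =>
    have h1 := superComm_cm b β y.1.isHom
    have h2 := h y List.mem_cons_self
    have h3 := superComm_cm b β (isHom_Dp n 1)
    have h4 := ih fun y hy => h y (List.mem_cons_of_mem _ hy)
    have := h1.mul (h2.mul (h3.mul h4))
    rwa [zero_add, zero_add, ← wdeg_cons] at this

theorem SuperComm.symm {b : A} {β d : ZMod 2} {M : Matrix (Idx n) (Idx n) A}
    (h : SuperComm b β d M) (i j : Idx n) :
    b * M i j = sgn (β * (i.par + j.par + d)) • (M i j * b) := by
  rw [h i j, smul_smul, mul_comm β, sgn_mul_self, one_smul]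

/-- `superComm_word` is used twice: on l' against a single entry of `E y.2`, then on l against an
entry of the word of l'. -/
theorem superComm_word_word {E : κ → Matrix (Idx n) (Idx n) A} {l l' : List (Letter n N × κ)}
    (h : ∀ y ∈ l, ∀ y' ∈ l', ∀ i j, SuperComm (E y'.2 i j) (i.par + j.par) 0 (E y.2))
    (i j : Idx n) : SuperComm (word E l' i j) (i.par + j.par + wdeg l') (wdeg l) (word E l) := by
  refine superComm_word l fun y hy a b => ?_
  have := (superComm_word (E := E) (b := E y.2 a b) (β := a.par + b.par) l' fun y' hy' c d => by
    rw [(h y hy y' hy' c d).symm a b, add_zero, add_zero]).symm i j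
  rw [this, add_zero]

/-- The entries of the two words supercommute, and the part of the sign that depends on the
summation indices is absorbed by the diagonal sign matrices under the traces. -/
theorem cyc_append_comm {E : κ → Matrix (Idx n) (Idx n) A} {l l' : List (Letter n N × κ)}
    (h : ∀ y ∈ l, ∀ y' ∈ l', ∀ i j, SuperComm (E y'.2 i j) (i.par + j.par) 0 (E y.2)) :
    cyc E (l ++ l') = sgn (wdeg l * wdeg l') • cyc E (l' ++ l) := by
  rw [cyc, cyc, word_append, word_append]
  simp only [Matrix.trace, Matrix.diag, cm_Dp_mul]
  simp only [Matrix.mul_apply, Finset.smul_sum]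
  rw [Finset.sum_comm]
  refine Finset.sum_congr rfl fun i _ => Finset.sum_congr rfl fun j _ => ?_
  rw [superComm_word_word h i j j i, smul_smul, smul_smul, ← sgn_add, ← sgn_add, wdeg_append,
    wdeg_append]
  congr 2
  generalize i.par = a
  generalize j.par = b
  generalize wdeg l = c
  generalize wdeg l' = d
  revert a b c d
  decide

end Word


theorem cm_flp_mul {n : ℕ} {A : Type*} [Ring A] [Algebra ℂ A] (M : Matrix (Idx n) (Idx n) A)
    (i j : Idx n) : (cm (flp n) * M : Matrix (Idx n) (Idx n) A) i j = M i.opp j := by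
  rw [Matrix.mul_apply, Finset.sum_eq_single i.opp]
  · simp [cm_apply, flp]
  · intro k _ hk
    rw [cm_apply, flp, Matrix.of_apply, if_neg (fun h => hk ((eq_opp_iff _ _).1 h).symm), map_zero,
      zero_mul]
  · simp

theorem mul_cm_flp {n : ℕ} {A : Type*} [Ring A] [Algebra ℂ A] (M : Matrix (Idx n) (Idx n) A)
    (i j : Idx n) : (M * cm (flp n) : Matrix (Idx n) (Idx n) A) i j = M i j.opp := by
  rw [Matrix.mul_apply, Finset.sum_eq_single j.opp]
  · simp [cm_apply, flp]
  · intro k _ hk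
    rw [cm_apply, flp, Matrix.of_apply, if_neg hk, map_zero, mul_zero]
  · simp

theorem trace_flp_conj {n : ℕ} {A : Type*} [Ring A] [Algebra ℂ A]
    (M : Matrix (Idx n) (Idx n) A) :
    (cm (flp n) * (M * cm (flp n)) : Matrix (Idx n) (Idx n) A).trace = M.trace := by
  rw [trace_cm_mul, mul_assoc, ← map_mul, flp_mul_self, map_one, mul_one]

theorem eq_zero_of_eq_neg {V : Type*} [AddCommGroup V] [Module ℂ V] {v : V} (h : v = -v) :
    v = 0 := by
  have h2 : (2 : ℂ) • v = 0 := by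
    rw [two_smul]
    nth_rewrite 1 [h]
    exact neg_add_cancel v
  exact (smul_eq_zero.1 h2).resolve_left two_ne_zero

/-! ### Words in a single matrix -/

section SingleMatrix

variable {n : ℕ} {A : Type*} [Ring A] [Algebra ℂ A] {E : Matrix (Idx n) (Idx n) A}

/-- Π commutes with E and anticommutes with D, so it passes each factor ED with a minus sign. -/
theorem mul_Dp_pow_mul_flp (hE : E * cm (flp n) = cm (flp n) * E) (m : ℕ) :
    (E * cm (Dp n 1)) ^ m * cm (flp n) =
      (-1 : ℂ) ^ m • (cm (flp n) * (E * cm (Dp n 1)) ^ m) := by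
  have h1 : E * cm (Dp n 1) * cm (flp n) = -(cm (flp n) * (E * cm (Dp n 1))) := by
    rw [mul_assoc, ← map_mul, (isHom_flp n).Dp_mul, mul_one, sgn_one, cm_smul, mul_smul_comm,
      map_mul, ← mul_assoc, hE, mul_assoc, neg_one_smul]
  induction m with
  | zero => simp
  | succ m ih =>
    rw [pow_succ' (E * cm (Dp n 1)), mul_assoc, ih, mul_smul_comm, ← mul_assoc, h1, neg_mul,
      pow_succ (-1 : ℂ), mul_neg_one, neg_smul, smul_neg, mul_assoc]

theorem word_const_cons {N : ℕ} {κ : Type*} (y : Letter n N × κ) (l : List (Letter n N × κ)) :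
    word (fun _ => E) (y :: l) = cm y.1.mat * (E * cm (Dp n 1) * word (fun _ => E) l) := by
  rw [word, mul_assoc E]

theorem word_replicate_one (N m : ℕ) :
    word (fun _ : Unit => E) (List.replicate m ((Letter.one : Letter n N), ())) =
      (E * cm (Dp n 1)) ^ m := by
  induction m with
  | zero => rfl
  | succ m ih =>
    rw [List.replicate_succ, word_const_cons, ih, pow_succ', Letter.mat, map_one, one_mul]

theorem wdeg_replicate_one (n N m : ℕ) :
    wdeg (List.replicate m ((Letter.one : Letter n N), ())) = 0 := by
  induction m with
  | zero => rfl
  | succ m ih => rw [List.replicate_succ, wdeg_cons, ih]; rfl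

/-- Conjugation by Π preserves the trace and the even power of ED but negates D. This is why only
the c^(m) with m odd are needed. -/
theorem trace_Dp_mul_pow_of_even (hE : E * cm (flp n) = cm (flp n) * E) {m : ℕ} (hm : Even m) :
    (cm (Dp n 1) * (E * cm (Dp n 1)) ^ m).trace = 0 := by
  refine eq_zero_of_eq_neg ?_
  have h1 : flp n * (Dp n 1) * flp n = - Dp n 1 := by
    rw [mul_assoc, (isHom_flp n).Dp_mul, mul_smul_comm, ← mul_assoc, flp_mul_self, one_mul]
    simp
  have h2 : cm (flp n) * ((cm (Dp n 1) * (E * cm (Dp n 1)) ^ m) * cm (flp n)) =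
      -(cm (Dp n 1) * (E * cm (Dp n 1)) ^ m) := by
    rw [mul_assoc, mul_Dp_pow_mul_flp hE, hm.neg_one_pow, one_smul, ← mul_assoc, ← mul_assoc,
      ← map_mul, ← map_mul, h1, map_neg, neg_mul]
  rw [← Matrix.trace_neg, ← h2, trace_flp_conj]

/-- For odd m, moving Π around the trace changes the sign. For even positive m this gives nothing,
and instead the whole block ΠED is rotated to the end; Π then returns to the front through an odd
power. The rotation uses that the entries of E supercommute. -/
theorem trace_flp_mul_pow (hE : E * cm (flp n) = cm (flp n) * E)
    (hc : ∀ i j, SuperComm (E i j) (i.par + j.par) 0 E) (m : ℕ) :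
    (cm (flp n) * (E * cm (Dp n 1)) ^ m).trace = 0 := by
  rcases Nat.even_or_odd m with hm | hm
  · cases m with
    | zero =>
      rw [pow_zero, mul_one]
      refine Finset.sum_eq_zero fun i _ => ?_
      rw [Matrix.diag, cm_apply, flp, Matrix.of_apply, if_neg (Idx.opp_ne i).symm, map_zero]
    | succ m =>
      -- No unit letters occur here, so the value 0 for N is as good as any.
      have h := cyc_append_comm (E := fun _ : Unit => E) (N := 0) (l := [(Letter.flip, ())])
        (l' := List.replicate m (Letter.one, ())) (fun _ _ _ _ i j => hc i j)
      have e : word (fun _ : Unit => E) [((Letter.flip : Letter n 0), ())] =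
          cm (flp n) * (E * cm (Dp n 1)) := by
        rw [word_const_cons, word, mul_one]; rfl
      have d : wdeg [((Letter.flip : Letter n 0), ())] = 1 := rfl
      have d0 : (1 : ZMod 2) + 0 + 1 = 0 := by decide
      have d1 : (0 : ZMod 2) + 1 + 1 = 0 := by decide
      have hm' : Odd m := by
        rcases Nat.even_or_odd m with h' | h'
        · exact absurd hm (Nat.not_even_iff_odd.2 h'.add_one)
        · exact h'
      rw [wdeg_replicate_one, mul_zero, sgn_zero, one_smul, cyc, cyc, word_append, word_append,
        wdeg_append, wdeg_append, wdeg_replicate_one, word_replicate_one, e, d, d0, d1, Dp_zero,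
        map_one, one_mul, one_mul, mul_assoc, ← pow_succ', ← mul_assoc, mul_Dp_pow_mul_flp hE,
        smul_mul_assoc, mul_assoc, ← pow_succ, hm'.neg_one_pow, neg_one_smul,
        Matrix.trace_neg] at h
      exact eq_zero_of_eq_neg h
  · refine eq_zero_of_eq_neg ?_
    conv_lhs => rw [trace_cm_mul, mul_Dp_pow_mul_flp hE, hm.neg_one_pow, neg_one_smul,
      Matrix.trace_neg]

/-- In the absence of unit letters all Π can be collected on the left at the cost of a sign; as Π² =
1, only their number modulo 2 matters, and this is `wdeg l`. -/
theorem exists_word_eq_or_unit (hE : E * cm (flp n) = cm (flp n) * E) {N : ℕ} {κ : Type*}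
    (l : List (Letter n N × κ)) :
    (∃ c : ℂ, word (fun _ => E) l =
      c • (cm (if wdeg l = 0 then 1 else flp n) * (E * cm (Dp n 1)) ^ l.length)) ∨
    ∃ l₁ l₂ i j hi hj p, l = l₁ ++ (Letter.unit i j hi hj, p) :: l₂ := by
  induction l with
  | nil =>
    left
    refine ⟨1, ?_⟩
    simp [word, wdeg]
  | cons y l ih =>
    rcases ih with ⟨c, hc⟩ | ⟨l₁, l₂, i, j, hi, hj, p, rfl⟩
    · obtain ⟨y, p⟩ := y
      have comm : E * cm (Dp n 1) * cm (if wdeg l = 0 then 1 else flp n) =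
          (if wdeg l = 0 then 1 else -1 : ℂ) •
            (cm (if wdeg l = 0 then 1 else flp n) * (E * cm (Dp n 1))) := by
        split_ifs
        · simp
        · have := mul_Dp_pow_mul_flp hE 1
          rwa [pow_one, pow_one] at this
      have step : E * cm (Dp n 1) * word (fun _ => E) l =
          (c * (if wdeg l = 0 then 1 else -1 : ℂ)) •
          (cm (if wdeg l = 0 then 1 else flp n) * (E * cm (Dp n 1)) ^ (l.length + 1)) := by
        rw [hc, mul_smul_comm, ← mul_assoc, comm, smul_mul_assoc, smul_smul, mul_assoc, pow_succ']
      cases y with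
      | one =>
        left
        refine ⟨c * (if wdeg l = 0 then 1 else -1 : ℂ), ?_⟩
        rw [word_const_cons, step, Letter.mat, map_one, one_mul, wdeg_cons, Letter.deg, zero_add]
        rfl
      | flip =>
        left
        refine ⟨c * (if wdeg l = 0 then 1 else -1 : ℂ), ?_⟩
        rw [word_const_cons, step, Letter.mat, mul_smul_comm, ← mul_assoc, ← map_mul, wdeg_cons,
          Letter.deg, List.length_cons]
        congr 3
        rcases zmod_two_cases (wdeg l) with h | h
        · rw [h, if_pos rfl, if_neg (by decide), mul_one]
        · rw [h, if_neg (by decide), if_pos (by decide), flp_mul_self]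
      | unit i j hi hj => exact Or.inr ⟨[], l, i, j, hi, hj, p, rfl⟩
    · exact Or.inr ⟨y :: l₁, l₂, i, j, hi, hj, p, rfl⟩

/-- The leading power of ED absorbs identity letters. A Π is moved to the far left, where it
replaces i by -i and so keeps |i|; a unit letter cuts the entry into a product of two. -/
theorem pow_mul_word_mem (hE : E * cm (flp n) = cm (flp n) * E) {N : ℕ} {B : Subalgebra ℂ A}
    (hB : ∀ (m : ℕ) (i j : Idx n), i.abs ≤ N → j.abs ≤ N →
      ((E * cm (Dp n 1)) ^ (m + 1) : Matrix (Idx n) (Idx n) A) i j ∈ B) {κ : Type*} (l : List (Letter n N × κ)) :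
    ∀ (m : ℕ) {i j : Idx n}, i.abs ≤ N → j.abs ≤ N →
      ((E * cm (Dp n 1)) ^ (m + 1) * word (fun _ => E) l : Matrix (Idx n) (Idx n) A) i j ∈ B := by
  induction l with
  | nil =>
    intro m i j hi hj
    rw [word, mul_one]
    exact hB m i j hi hj
  | cons y l ih =>
    intro m i j hi hj
    rw [word_const_cons]
    obtain ⟨y, p⟩ := y
    cases y with
    | one =>
      rw [Letter.mat, map_one, one_mul, ← mul_assoc, ← pow_succ]
      exact ih _ hi hj
    | flip =>
      rw [Letter.mat, ← mul_assoc, mul_Dp_pow_mul_flp hE, smul_mul_assoc, mul_assoc,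
        ← mul_assoc ((E * cm (Dp n 1)) ^ _), ← pow_succ, Matrix.smul_apply, cm_flp_mul]
      exact Subalgebra.smul_mem _ (ih _ (i := i.opp) hi hj) _
    | unit a b ha hb =>
      rw [Letter.mat, Matrix.mul_apply, Finset.sum_eq_single a]
      · rw [cm_single_mul, if_pos rfl]
        refine Subalgebra.mul_mem _ (hB m i a hi ha) ?_
        have := ih 0 hb hj
        rwa [zero_add, pow_one] at this
      · intro k _ hk
        rw [cm_single_mul, if_neg hk, mul_zero]
      · simp

theorem cyc_const_mem (hE : E * cm (flp n) = cm (flp n) * E)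
    (hc : ∀ i j, SuperComm (E i j) (i.par + j.par) 0 E) {N : ℕ} {B : Subalgebra ℂ A}
    (hB : ∀ (m : ℕ) (i j : Idx n), i.abs ≤ N → j.abs ≤ N →
      ((E * cm (Dp n 1)) ^ (m + 1) : Matrix (Idx n) (Idx n) A) i j ∈ B)
    (hB' : ∀ m, Odd m → (cm (Dp n 1) * (E * cm (Dp n 1)) ^ m).trace ∈ B)
    {κ : Type*} (l : List (Letter n N × κ)) :
    cyc (fun _ => E) l ∈ B := by
  rcases exists_word_eq_or_unit hE l with ⟨c, h0⟩ | ⟨l₁, l₂, i, j, hi, hj, p, rfl⟩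
  · rw [cyc, h0, mul_smul_comm, Matrix.trace_smul]
    refine Subalgebra.smul_mem _ ?_ _
    rcases zmod_two_cases (wdeg l) with h | h
    · rw [h, if_pos rfl, map_one, one_mul, zero_add]
      rcases Nat.even_or_odd l.length with hm | hm
      · rw [trace_Dp_mul_pow_of_even hE hm]
        exact B.zero_mem
      · exact hB' _ hm
    · rw [h, if_neg (by decide), show (1 : ZMod 2) + 1 = 0 by decide, Dp_zero, map_one, one_mul,
        trace_flp_mul_pow hE hc]
      exact B.zero_mem
  -- After rotation the word begins with E_ij, so the trace has a single nonzero term, a multiple of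
  -- the (j, i) entry of the rest.
  · rw [cyc_append_comm (fun _ _ _ _ i j => hc i j)]
    refine Subalgebra.smul_mem _ ?_ _
    have e : word (fun _ => E) ((Letter.unit i j hi hj, p) :: l₂ ++ l₁) =
        cm (Matrix.single i j 1) * ((E * cm (Dp n 1)) ^ (0 + 1) * word (fun _ => E) (l₂ ++ l₁)) := by
      rw [List.cons_append, word_const_cons, zero_add, pow_one, Letter.mat]
    rw [cyc, e, Matrix.trace, Finset.sum_eq_single i]
    · rw [Matrix.diag, cm_Dp_mul, cm_single_mul, if_pos rfl]
      exact Subalgebra.smul_mem _ (pow_mul_word_mem hE hB _ 0 hj hi) _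
    · intro a _ ha
      rw [Matrix.diag, cm_Dp_mul, cm_single_mul, if_neg ha, smul_zero]
    · simp

end SingleMatrix

/-! ### Words in the symmetric algebra -/

/-- The matrix of the generators `F_ij`. -/
def Fm (n : ℕ) : Matrix (Idx n) (Idx n) (S n) := Matrix.of fun i j => S.ι n (F i j)

/-- The matrix of the elements `f_ij^(m)`. -/
def fm (n m : ℕ) : Matrix (Idx n) (Idx n) (S n) := Matrix.of fun i j => f n m i j

theorem fm_succ_succ (n m : ℕ) : fm n (m + 2) = Fm n * cm (Dp n 1) * fm n (m + 1) := by
  ext i j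
  rw [mul_assoc, Matrix.mul_apply]
  simp only [cm_Dp_mul, one_mul]
  refine Finset.sum_congr rfl fun k _ => ?_
  rw [mul_smul_comm]
  rfl

theorem Fm_mul_Dp_pow (n m : ℕ) :
    (Fm n * cm (Dp n 1)) ^ (m + 1) = fm n (m + 1) * cm (Dp n 1) := by
  induction m with
  | zero => rw [zero_add, pow_one]; rfl
  | succ m ih => rw [pow_succ', ih, fm_succ_succ, ← mul_assoc]

theorem F_opp {n : ℕ} (i j : Idx n) : F i.opp j.opp = F i j := by
  apply Subtype.ext
  change Matrix.single _ _ _ + Matrix.single _ _ _ = Matrix.single _ _ _ + Matrix.single _ _ _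
  rw [Idx.opp_opp, Idx.opp_opp, add_comm]

theorem Fm_mul_flp (n : ℕ) : Fm n * cm (flp n) = cm (flp n) * Fm n := by
  ext i j
  rw [mul_cm_flp, cm_flp_mul, Fm, Matrix.of_apply, Matrix.of_apply, ← F_opp i j.opp, Idx.opp_opp]

theorem F_mem_qDeg {n : ℕ} (i j : Idx n) : F i j ∈ qDeg n (i.par + j.par) := by
  change qProj n _ _ = _
  rw [qProj_F, if_pos rfl]

theorem superComm_Fm {n : ℕ} (i j : Idx n) :
    SuperComm (Fm n i j) (i.par + j.par) 0 (Fm n) := by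
  intro a b
  rw [add_zero]
  exact S.ι_swap (F_mem_qDeg a b) (F_mem_qDeg i j)

/-- The subalgebra generated by the elements `c^(m)` with odd `m` and `f_ij^(m)` with
`|i|, |j| ≤ N`. -/
def genAlg (n N : ℕ) : Subalgebra ℂ (S n) :=
  Algebra.adjoin ℂ ({a | ∃ m : ℕ, Odd m ∧ a = c n m} ∪
    {a | ∃ (m : ℕ) (i j : Idx n), 1 ≤ m ∧ i.abs ≤ N ∧ j.abs ≤ N ∧ a = f n m i j})

theorem f_mem_genAlg {n N : ℕ} (m : ℕ) {i j : Idx n} (hi : i.abs ≤ N) (hj : j.abs ≤ N) :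
    f n (m + 1) i j ∈ genAlg n N :=
  Algebra.subset_adjoin (Or.inr ⟨m + 1, i, j, Nat.le_add_left _ _, hi, hj, rfl⟩)

theorem c_mem_genAlg {n : ℕ} (N : ℕ) {m : ℕ} (hm : Odd m) : c n m ∈ genAlg n N :=
  Algebra.subset_adjoin (Or.inl ⟨m, hm, rfl⟩)

/-- The invariant trace of a word in the symmetric algebra belongs to the subalgebra generated
by the elements `c^(m)` with odd `m` and `f_ij^(m)` with `|i|, |j| ≤ N`. -/
theorem cyc_Fm_mem {n N : ℕ} {κ : Type*} (l : List (Letter n N × κ)) :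
    cyc (fun _ => Fm n) l ∈ genAlg n N := by
  refine cyc_const_mem (Fm_mul_flp n) superComm_Fm ?_ ?_ l
  · intro m i j hi hj
    rw [Fm_mul_Dp_pow, mul_cm_Dp]
    exact Subalgebra.smul_mem _ (f_mem_genAlg m hi hj) _
  · rintro m ⟨k, rfl⟩
    -- The D in front of the word cancels the D at its end, which leaves the trace c^(m).
    rw [Fm_mul_Dp_pow, trace_cm_mul, mul_assoc, ← map_mul, Dp_mul_self, map_one, mul_one]
    exact c_mem_genAlg N ⟨k, rfl⟩

/-! ### Operators generated by transpositions and letters -/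

/-- The transposed letter. -/
def Letter.tr {n N : ℕ} : Letter n N → Letter n N
  | one => one
  | flip => flip
  | unit i j hi hj => unit j i hj hi

theorem Letter.mat_tr {n N : ℕ} (y : Letter n N) : y.tr.mat = y.mat.transpose := by
  cases y
  · exact Matrix.transpose_one.symm
  · exact (flp_transpose n).symm
  · exact (Matrix.transpose_single _ _ _).symm

theorem Letter.deg_tr {n N : ℕ} (y : Letter n N) : y.tr.deg = y.deg := by
  cases y
  · rfl
  · rfl
  · exact add_comm _ _

/-- The matrix of a letter, multiplied by a sign matrix so that it supercommutes with `q_M`. -/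
def Letter.sup {n N : ℕ} (y : Letter n N) : gl n := Dp n y.deg * y.mat

theorem Letter.isHom_sup {n N : ℕ} (y : Letter n N) : IsHom y.deg y.sup := by
  have := (isHom_Dp n y.deg).mul y.isHom
  rwa [zero_add] at this

/-- The matrix with the entries `rho p E_ij`. -/
def Em {n k : ℕ} (p : Fin k) : Matrix (Idx n) (Idx n) (Op n k) :=
  Matrix.of fun i j => rho p (Matrix.single i j 1)

theorem superComm_Em {n k : ℕ} {p r : Fin k} (h : r ≠ p) {β : ZMod 2} {x : gl n}
    (hx : IsHom β x) : SuperComm (rho p x) β 0 (Em r) := by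
  intro i j
  rw [add_zero]
  exact rho_swap h (isHom_single _ _ _) hx

theorem superComm_Em_trans {n k : ℕ} {p r u : Fin k} (hp : u ≠ p) (hr : u ≠ r) :
    SuperComm (trans p r) 0 0 (Em (n := n) u) := by
  intro i j
  rw [mul_zero, sgn_zero, one_smul]
  exact (trans_mul_rho_of_ne hp hr _).symm

theorem SuperComm.mul_left {n : ℕ} {A : Type*} [Ring A] [Algebra ℂ A] {b b' : A} {β β' : ZMod 2}
    {M : Matrix (Idx n) (Idx n) A} {d : ZMod 2} (h : SuperComm b β d M)
    (h' : SuperComm b' β' d M) : SuperComm (b * b') (β + β') d M := by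
  intro i j
  rw [← mul_assoc, h, smul_mul_assoc, mul_assoc, h', mul_smul_comm, smul_smul, ← sgn_add, mul_add,
    mul_assoc]

theorem cyc_mul {n N : ℕ} {κ A : Type*} [Ring A] [Algebra ℂ A] {E : κ → Matrix (Idx n) (Idx n) A}
    {b : A} {β : ZMod 2} {l : List (Letter n N × κ)} (h : ∀ y ∈ l, SuperComm b β 0 (E y.2)) :
    b * cyc E l = sgn (wdeg l * β) • (cyc E l * b) := by
  simp only [cyc, Matrix.trace, Matrix.diag, cm_Dp_mul, Finset.sum_mul, Finset.mul_sum,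
    Finset.smul_sum]
  refine Finset.sum_congr rfl fun i _ => ?_
  rw [smul_mul_assoc, superComm_word l h, mul_smul_comm, zmod_two_add_self, zero_add, smul_comm,
    smul_smul (sgn (wdeg l * β)), sgn_mul_self, one_smul]

theorem prod_cyc_mul {n N : ℕ} {κ A : Type*} [Ring A] [Algebra ℂ A]
    {E : κ → Matrix (Idx n) (Idx n) A} {b : A} {β : ZMod 2} (C : List (List (Letter n N × κ)))
    (h : ∀ l ∈ C, ∀ y ∈ l, SuperComm b β 0 (E y.2)) :
    ∃ c : ℂ, b * (C.map (cyc E)).prod = c • ((C.map (cyc E)).prod * b) := by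
  induction C with
  | nil => exact ⟨1, by simp⟩
  | cons l C ih =>
    obtain ⟨c, hc⟩ := ih fun l hl => h l (List.mem_cons_of_mem _ hl)
    refine ⟨sgn (wdeg l * β) * c, ?_⟩
    rw [List.map_cons, List.prod_cons, ← mul_assoc, cyc_mul (h l List.mem_cons_self),
      smul_mul_assoc, mul_assoc, hc, mul_smul_comm, smul_smul, mul_assoc]

/-- Carrying b past the entry M i k costs a sign depending on i and k; conjugation by `Dp n β`
produces this dependence, and a global sign remains. -/
theorem SuperComm.smul_mul {n : ℕ} {A : Type*} [Ring A] [Algebra ℂ A] {b : A} {β d : ZMod 2}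
    {M : Matrix (Idx n) (Idx n) A} (h : SuperComm b β d M) (M' : Matrix (Idx n) (Idx n) A) :
    b • (M * M') = sgn (d * β) • (cm (Dp n β) * M * cm (Dp n β) * (b • M')) := by
  ext i j
  rw [Matrix.smul_apply, Matrix.smul_apply, Matrix.mul_apply, Matrix.mul_apply, Finset.smul_sum,
    Finset.smul_sum]
  refine Finset.sum_congr rfl fun k _ => ?_
  rw [mul_cm_Dp, cm_Dp_mul, Matrix.smul_apply, smul_eq_mul, smul_eq_mul, smul_mul_assoc,
    smul_mul_assoc, ← mul_assoc, ← mul_assoc, h i k, smul_mul_assoc, smul_smul, smul_smul,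
    smul_smul, ← sgn_add, ← sgn_add, ← sgn_add]
  have e : d * β + (β * k.par + β * i.par) + (i.par + k.par + d) * β = 0 := by
    generalize i.par = a
    generalize k.par = c
    clear h
    revert a c d β
    decide
  rw [← add_assoc] at e
  rw [e, sgn_zero, one_smul]

theorem trace_cm_mul_Em {n k : ℕ} (p : Fin k) (z : gl n) :
    (cm z * Em p).trace = rho p z.transpose := by
  conv_rhs => rw [Matrix.matrix_eq_sum_single z.transpose]
  simp only [Matrix.trace, Matrix.diag, Matrix.mul_apply, map_sum]
  rw [Finset.sum_comm]
  refine Finset.sum_congr rfl fun i _ => Finset.sum_congr rfl fun j _ => ?_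
  rw [smul_single_one, map_smul, cm_apply, ← Algebra.smul_def]
  rfl

/-- Left multiplication by x acts on the first index of E_ij, hence through the transposed matrix.
For this reason the letters of operators appear transposed in words. -/
theorem rho_smul_Em {n k : ℕ} (p : Fin k) (x : gl n) :
    rho p x • Em p = cm x.transpose * Em p := by
  ext1 i j
  rw [Matrix.smul_apply, Matrix.mul_apply, Em, Matrix.of_apply, smul_eq_mul, ← rho_mul]
  have : x * Matrix.single i j (1 : ℂ) = ∑ a, x a i • Matrix.single a j (1 : ℂ) := by
    ext a b
    rw [Matrix.sum_apply, Finset.sum_eq_single a]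
    · by_cases h : j = b
      · subst h; simp
      · simp [h, Matrix.mul_apply]
    · intro c _ hc
      simp [hc]
    · simp
  rw [this, map_sum]
  refine Finset.sum_congr rfl fun a _ => ?_
  rw [map_smul, cm_apply, ← Algebra.smul_def]
  rfl

/-- This is how cyclic words grow: a transposition puts the new factor E_l D in front of E_q, as
multiplication by a transposition inserts a new element into a cycle. -/
theorem trans_smul_Em {n k : ℕ} {q l : Fin k} (h : q ≠ l) :
    trans (n := n) q l • Em (n := n) q = Em l * (cm (Dp n 1) * Em q) := by
  ext1 a b
  rw [Matrix.smul_apply, Em, Matrix.of_apply, smul_eq_mul, trans_comm h, trans_mul_rho_single,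
    Matrix.mul_apply]
  refine Finset.sum_congr rfl fun i _ => ?_
  rw [cm_Dp_mul, one_mul, mul_smul_comm]
  rfl

theorem exists_cyc_singleton {n N k : ℕ} (l : Fin k) (y : Letter n N) :
    ∃ c : ℂ, rho l y.sup = c • cyc Em [(y.tr, l)] := by
  refine ⟨sgn (y.deg * y.deg), ?_⟩
  have e : wdeg [(y.tr, l)] = y.deg := by
    rw [wdeg_cons, Letter.deg_tr]
    exact add_zero _
  have h2 : (1 : ZMod 2) + (y.deg + 1) = y.deg := by
    generalize y.deg = a
    revert a
    decide
  rw [cyc, e, word, word, mul_one, ← mul_assoc, ← mul_assoc, ← trace_cm_mul, ← mul_assoc,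
    ← map_mul, ← map_mul, ← mul_assoc, Dp_mul_Dp, h2, trace_cm_mul_Em,
    Matrix.transpose_mul, Letter.mat_tr, Matrix.transpose_transpose, Dp_transpose, Letter.sup,
    y.isHom.Dp_mul, map_smul]

theorem rho_trans_smul_Em {n N k : ℕ} {q l : Fin k} (hql : q ≠ l) (y : Letter n N) :
    (rho q y.sup * trans q l) • Em q = sgn (y.deg * y.deg) •
      (cm (Dp n y.deg) * Em l * (cm (Dp n 1) * (cm y.tr.mat * Em q))) := by
  have h1 := (superComm_Em (r := l) hql.symm y.isHom_sup).smul_mul (cm (Dp n 1) * Em q)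
  have h2 := (superComm_cm (rho q y.sup) y.deg (isHom_Dp n 1)).smul_mul (Em q)
  have h3 : y.sup.transpose = sgn (y.deg * y.deg) • (Dp n y.deg * y.tr.mat) := by
    rw [Letter.sup, Matrix.transpose_mul, Dp_transpose, ← Letter.mat_tr, y.tr.isHom.Dp_mul,
      Letter.deg_tr, smul_smul, sgn_mul_self, one_smul]
  have h4 : Dp n y.deg * (Dp n y.deg * Dp n 1 * Dp n y.deg * (Dp n y.deg * y.tr.mat)) =
      Dp n 1 * y.tr.mat := by
    simp only [← mul_assoc, Dp_mul_Dp]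
    congr 2
    generalize y.deg = a
    revert a
    decide
  have h5 := congrArg (cm : gl n →+* Matrix (Idx n) (Idx n) (Op n k)) h4
  simp only [map_mul] at h5
  rw [mul_smul, trans_smul_Em hql, h1, h2, rho_smul_Em, h3, cm_smul, zero_mul, sgn_zero,
    one_smul, one_smul, smul_mul_assoc, mul_smul_comm, mul_smul_comm,
    map_mul, mul_assoc (cm (Dp n y.deg) * Em l), ← mul_assoc (_ * _ * _) (_ * _) (Em q),
    ← mul_assoc (cm (Dp n y.deg)) (_ * _) (Em q), h5, mul_assoc (cm (Dp n 1))]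

/-- The operator is carried past the prefix l₁ and the letter y₀ by `SuperComm.smul_mul`, acts on
E_q by `rho_trans_smul_Em`, and the sign matrices left over cancel in pairs. -/
theorem exists_cyc_insert {n N k : ℕ} {q l : Fin k} (hql : q ≠ l) (y y₀ : Letter n N)
    {l₁ : List (Letter n N × Fin k)} (l₂ : List (Letter n N × Fin k))
    (h₁ : ∀ z ∈ l₁, z.2 ≠ q ∧ z.2 ≠ l) :
    ∃ c : ℂ, rho q y.sup * trans q l * cyc Em (l₁ ++ (y₀, q) :: l₂) =
      c • cyc Em (l₁ ++ (y₀, l) :: (y.tr, q) :: l₂) := by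
  set b := rho q y.sup * trans q l with hb
  set β := y.deg with hβ
  have hd : wdeg (l₁ ++ (y₀, l) :: (y.tr, q) :: l₂) = wdeg (l₁ ++ (y₀, q) :: l₂) + β := by
    rw [wdeg_append, wdeg_append, wdeg_cons, wdeg_cons, wdeg_cons, Letter.deg_tr]
    ring
  set s := wdeg (l₁ ++ (y₀, q) :: l₂) + 1 with hs
  have hM : SuperComm b β (0 + (wdeg l₁ + y₀.deg))
      (cm (Dp n s) * (word Em l₁ * cm y₀.mat)) := by
    refine (superComm_cm _ _ (isHom_Dp n s)).mul
      (SuperComm.mul (superComm_word l₁ fun z hz => ?_) (superComm_cm _ _ y₀.isHom))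
    have := (superComm_Em (h₁ z hz).1 y.isHom_sup).mul_left
      (superComm_Em_trans (h₁ z hz).1 (h₁ z hz).2)
    rwa [add_zero] at this
  have hE := rho_trans_smul_Em hql y
  rw [← hb, ← hβ] at hE
  refine ⟨sgn ((0 + (wdeg l₁ + y₀.deg)) * β) * sgn (β * β), ?_⟩
  have h0 : b * cyc Em (l₁ ++ (y₀, q) :: l₂) =
      (b • (cm (Dp n s) * (word Em l₁ * cm y₀.mat) *
        (Em q * (cm (Dp n 1) * word Em l₂)))).trace := by
    rw [Matrix.trace_smul, smul_eq_mul, cyc, word_append, word, ← hs]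
    simp only [mul_assoc]
  rw [h0, hM.smul_mul, ← Matrix.smul_mul b (Em q), hE, cyc, hd, word_append, word, word, Matrix.smul_mul,
    mul_smul_comm, Matrix.trace_smul, Matrix.trace_smul, smul_smul]
  congr 2
  have e : wdeg (l₁ ++ (y₀, q) :: l₂) + β + 1 = β + s := by rw [hs]; ring
  rw [e, ← Dp_mul_Dp n β s, map_mul]
  have e2 : (cm (Dp n β) * cm (Dp n β) : Matrix (Idx n) (Idx n) (Op n k)) = 1 := by
    rw [← map_mul, Dp_mul_self, map_one]
  simp only [mul_assoc]
  rw [← mul_assoc (cm (Dp n β)) (cm (Dp n β)) (Em l * _), e2, one_mul]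

/-- The products of transpositions and letters, indexed by lists of tensor factors. -/
inductive Sergeev {n k : ℕ} (N : ℕ) : List (Fin k) → ZMod 2 → Op n k → Prop
  | nil : Sergeev N [] 0 1
  | self {L : List (Fin k)} {d : ZMod 2} {t : Op n k} (l : Fin k) (y : Letter n N) :
      Sergeev N L d t → Sergeev N (l :: L) (y.deg + d) (rho l y.sup * t)
  -- The identity and the transpositions (q l) with q in L represent the cosets of the permutations
  -- of L among those of l :: L.
  | swap {L : List (Fin k)} {d : ZMod 2} {t : Op n k} (l q : Fin k) (hq : q ∈ L) (y : Letter n N) :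
      Sergeev N L d t → Sergeev N (l :: L) (y.deg + d) (trans q l * (rho l y.sup * t))

/-- The tensor factors which occur in a list of words. -/
def slots {n N k : ℕ} (C : List (List (Letter n N × Fin k))) : List (Fin k) :=
  C.flatten.map Prod.snd

/-- The analogue of building the cycle decomposition one point at a time: `self` adds a cycle of
length one, `swap` inserts l into the cycle containing q. Each slot is used once, so operators can
be moved past all other cycles. -/
theorem Sergeev.exists_cyc {n N k : ℕ} {L : List (Fin k)} {d : ZMod 2} {t : Op n k}
    (h : Sergeev N L d t) (hL : L.Nodup) :
    ∃ (C : List (List (Letter n N × Fin k))) (c : ℂ), (slots C).Perm L ∧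
      t = c • (C.map (cyc Em)).prod := by
  induction h with
  | nil => exact ⟨[], 1, List.Perm.refl _, by simp⟩
  | @self L d t l y ht ih =>
    obtain ⟨C, c, hC, rfl⟩ := ih (List.nodup_cons.1 hL).2
    obtain ⟨c', hc'⟩ := exists_cyc_singleton l y
    refine ⟨[(y.tr, l)] :: C, c' * c, ?_, ?_⟩
    · exact List.Perm.cons l hC
    · rw [hc', List.map_cons, List.prod_cons, smul_mul_smul_comm]
  | @swap L d t l q hq y ht ih =>
    obtain ⟨C, c, hC, rfl⟩ := ih (List.nodup_cons.1 hL).2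
    have hlL := (List.nodup_cons.1 hL).1
    have hql : q ≠ l := fun h => hlL (h ▸ hq)
    have hq' : q ∈ slots C := hC.symm.subset hq
    obtain ⟨⟨y₀, q'⟩, hy₀, rfl⟩ := List.mem_map.1 hq'
    obtain ⟨w, hw, hyw⟩ := List.mem_flatten.1 hy₀
    obtain ⟨C₁, C₂, rfl⟩ := List.append_of_mem hw
    obtain ⟨l₁, l₂, rfl⟩ := List.append_of_mem hyw
    dsimp only at *
    have hnd : (slots (C₁ ++ (l₁ ++ (y₀, q') :: l₂) :: C₂)).Nodup :=
      hC.symm.nodup (List.nodup_cons.1 hL).2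
    have hsub : ∀ z ∈ slots (C₁ ++ (l₁ ++ (y₀, q') :: l₂) :: C₂), z ≠ l := fun z hz h =>
      hlL (h ▸ hC.subset hz)
    have hC₁ : ∀ w ∈ C₁, ∀ z ∈ w, z.2 ≠ q' ∧ z.2 ≠ l := by
      intro w hw z hz
      refine ⟨?_, hsub _ (List.mem_map_of_mem (List.mem_flatten.2 ⟨w, by simp [hw], hz⟩))⟩
      intro h
      simp only [slots, List.flatten_append, List.flatten_cons, List.map_append] at hnd
      refine List.disjoint_of_nodup_append hnd (a := q') ?_ ?_
      · exact h ▸ List.mem_map_of_mem (List.mem_flatten.2 ⟨w, hw, hz⟩)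
      · simp
    have h₁ : ∀ z ∈ l₁, z.2 ≠ q' ∧ z.2 ≠ l := by
      intro z hz
      refine ⟨?_, hsub _ (List.mem_map_of_mem
        (List.mem_flatten.2 ⟨l₁ ++ (y₀, q') :: l₂, by simp, by simp [hz]⟩))⟩
      intro h
      simp only [slots, List.flatten_append, List.flatten_cons, List.map_append] at hnd
      have := (List.nodup_append.1 (List.nodup_append.1 hnd).2.1).1
      refine List.disjoint_of_nodup_append this (a := q') ?_ ?_
      · exact h ▸ List.mem_map_of_mem hz
      · simp
    obtain ⟨c₁, hc₁⟩ := prod_cyc_mul (E := Em) (b := rho q' y.sup * trans q' l) (β := y.deg) C₁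
      (fun w hw z hz => by
        have := (superComm_Em (hC₁ w hw z hz).1 y.isHom_sup).mul_left
          (superComm_Em_trans (hC₁ w hw z hz).1 (hC₁ w hw z hz).2)
        rwa [add_zero] at this)
    obtain ⟨c₂, hc₂⟩ := exists_cyc_insert hql y y₀ l₂ h₁
    refine ⟨C₁ ++ (l₁ ++ (y₀, l) :: (y.tr, q') :: l₂) :: C₂, c * (c₁ * c₂), ?_, ?_⟩
    · refine List.Perm.trans ?_ (List.Perm.cons l hC)
      simp only [slots, List.flatten_append, List.flatten_cons, List.map_append, List.map_cons]
      rw [← List.append_assoc, ← List.append_assoc, ← List.append_assoc, ← List.append_assoc]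
      simp only [List.append_assoc, List.cons_append]
      rw [← List.append_assoc]
      refine List.perm_middle.trans (List.Perm.cons l ?_)
      simp
    -- The letter moves from slot l to slot q' through the transposition, so that the operator takes
    -- the form used in `exists_cyc_insert`.
    · rw [← mul_assoc, trans_mul_rho_right, mul_smul_comm, List.map_append, List.prod_append,
        List.map_cons, List.prod_cons, ← mul_assoc, hc₁, smul_mul_assoc, mul_assoc _ _ (_ * _),
        ← mul_assoc (rho q' y.sup * _), hc₂, smul_mul_assoc, mul_smul_comm, smul_smul, smul_smul,
        List.map_append, List.prod_append, List.map_cons, List.prod_cons, mul_assoc c]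

/-! ### The projection from `gl n` to the queer Lie superalgebra -/

theorem eta_eq {n : ℕ} (x : gl n) : eta n x = flp n * x * flp n := by
  ext i j
  rw [mul_flp, flp_mul]
  rfl

/-- The linear map from `gl n` to `q_n` which sends `E_ij` to `F_ij`. -/
def toQ (n : ℕ) : gl n →ₗ[ℂ] q n where
  toFun x := ⟨x + eta n x, by
    rw [mem_q_iff]
    intro i j
    change x i.opp j.opp + x i.opp.opp j.opp.opp = x i j + x i.opp j.opp
    rw [Idx.opp_opp, Idx.opp_opp, add_comm]⟩
  map_add' x y := by
    apply Subtype.ext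
    change x + y + eta n (x + y) = x + eta n x + (y + eta n y)
    rw [eta_eq, eta_eq, eta_eq]
    noncomm_ring
  map_smul' c x := by
    apply Subtype.ext
    change c • x + eta n (c • x) = c • (x + eta n x)
    rw [eta_eq, eta_eq, smul_add, mul_smul_comm, smul_mul_assoc]

theorem toQ_coe {n : ℕ} (x : gl n) : (toQ n x : gl n) = x + flp n * x * flp n := by
  rw [← eta_eq]
  rfl

theorem toQ_single {n : ℕ} (i j : Idx n) : toQ n (Matrix.single i j 1) = F i j := by
  apply Subtype.ext
  rw [toQ_coe, flp_mul_single, single_mul_flp]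
  rfl

/-- This doubling, once per tensor factor, is the source of the constant 2^k in the polarization
formulas. -/
theorem toQ_of_mem {n : ℕ} (X : q n) : toQ n X = (2 : ℂ) • X := by
  apply Subtype.ext
  have : eta n X = X := X.2
  rw [toQ_coe, ← eta_eq, this, Submodule.coe_smul, two_smul]

theorem mem_qDeg_iff {n : ℕ} {p : ZMod 2} {X : q n} : X ∈ qDeg n p ↔ IsHom p (X : gl n) := by
  constructor
  · intro h
    have : glProj n p X = X := congrArg Subtype.val (show qProj n p X = X from h)
    rw [← this]
    exact isHom_glProj _ _
  · intro h
    apply Subtype.ext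
    exact (glProj_of_isHom h p).trans (if_pos rfl)

theorem toQ_mem_qDeg {n : ℕ} {p : ZMod 2} {x : gl n} (hx : IsHom p x) : toQ n x ∈ qDeg n p := by
  rw [mem_qDeg_iff, toQ_coe]
  refine hx.add ?_
  have := ((isHom_flp n).mul hx).mul (isHom_flp n)
  have e : 1 + p + 1 = p := by
    clear hx this
    revert p
    decide
  rwa [e] at this

/-! ### Corresponding products of operators and of elements of the symmetric algebra -/

/-- The pair which consists of the operator `x` in the slot `p` and of the image of `x` in
the symmetric algebra. -/
def ep {n k : ℕ} (p : Fin k) : gl n →ₗ[ℂ] Op n k × S n :=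
  (rho p).prod (S.ι n ∘ₗ toQ n)

theorem ep_swap {n k : ℕ} {p r : Fin k} (h : p ≠ r) {a b : ZMod 2} {x y : gl n}
    (hx : IsHom a x) (hy : IsHom b y) : ep p x * ep r y = sgn (a * b) • (ep r y * ep p x) :=
  Prod.ext (rho_swap h hx hy) (S.ι_swap (toQ_mem_qDeg hx) (toQ_mem_qDeg hy))

/-- The span of the products of the pairs `ep p x`, where `p` runs through the list `L`. -/
def corr (n : ℕ) {k : ℕ} (L : List (Fin k)) : Submodule ℂ (Op n k × S n) :=
  -- Working in the product algebra allows one computation with words to be read off in both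
  -- components.
  (L.map fun p => LinearMap.range (ep (n := n) p)).prod

theorem corr_append (n : ℕ) {k : ℕ} (L L' : List (Fin k)) :
    corr n (L ++ L') = corr n L * corr n L' := by
  simp [corr]

theorem range_ep_mul_le {n k : ℕ} {p r : Fin k} (h : p ≠ r) :
    LinearMap.range (ep (n := n) p) * LinearMap.range (ep r) ≤
      LinearMap.range (ep r) * LinearMap.range (ep p) := by
  rw [Submodule.mul_le]
  rintro _ ⟨x, rfl⟩ _ ⟨y, rfl⟩
  induction x using gl_induction with
  | hom a x hx =>
    induction y using gl_induction with
    | hom b y hy =>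
      rw [ep_swap h hx hy]
      exact Submodule.smul_mem _ _ (Submodule.mul_mem_mul ⟨y, rfl⟩ ⟨x, rfl⟩)
    | add y z h1 h2 =>
      rw [map_add, mul_add]
      exact Submodule.add_mem _ h1 h2
  | add x z h1 h2 =>
    rw [map_add, add_mul]
    exact Submodule.add_mem _ h1 h2

/-- Both components obey the same sign rule for distinct slots, so the order of the slots is
immaterial. -/
theorem corr_perm {n k : ℕ} {L L' : List (Fin k)} (h : L.Perm L') (hL : L.Nodup) :
    corr n L = corr n L' := by
  refine (h.map _).prod_eq' ?_
  rw [List.pairwise_map]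
  exact hL.imp fun h => le_antisymm (range_ep_mul_le h) (range_ep_mul_le h.symm)

theorem corr_le_span {n k : ℕ} (L : List (Fin k)) :
    corr n L ≤ Submodule.span ℂ {t | ∃ w : List (Idx n × Idx n), w.length = L.length ∧
      t = (List.zipWith (fun p u => ep p (Matrix.single u.1 u.2 1)) L w).prod} := by
  induction L with
  | nil =>
    rw [corr, List.map_nil, List.prod_nil, Submodule.one_le]
    exact Submodule.subset_span ⟨[], rfl, rfl⟩
  | cons p L ih =>
    have e : corr n (p :: L) = LinearMap.range (ep p) * corr n L := List.prod_cons
    rw [e, Submodule.mul_le]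
    rintro _ ⟨x, rfl⟩ t ht
    replace ht := ih ht
    induction ht using Submodule.span_induction with
    | mem t h =>
      obtain ⟨w, hw, rfl⟩ := h
      induction x using gl_single_induction with
      | zero => rw [map_zero, zero_mul]; exact Submodule.zero_mem _
      | single i j c =>
        rw [smul_single_one, map_smul, smul_mul_assoc]
        exact Submodule.smul_mem _ _ (Submodule.subset_span ⟨(i, j) :: w, by simp [hw], by simp⟩)
      | add x y h1 h2 => rw [map_add, add_mul]; exact Submodule.add_mem _ h1 h2
    | zero => rw [mul_zero]; exact Submodule.zero_mem _
    | add a b _ _ h1 h2 => rw [mul_add]; exact Submodule.add_mem _ h1 h2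
    | smul c a _ h => rw [mul_smul_comm]; exact Submodule.smul_mem _ _ h

theorem prod_slot_of_not_mem {n k : ℕ} (a : Fin k → ZMod 2) (x : Fin k → gl n) (r : Fin k)
    (L : List (Fin k)) (hr : r ∉ L) :
    ∃ b, (L.map fun p => slot p (a p) (x p) r).prod = Dp n b := by
  induction L with
  | nil => exact ⟨0, (Dp_zero n).symm⟩
  | cons p L ih =>
    obtain ⟨b, hb⟩ := ih fun h => hr (List.mem_cons_of_mem _ h)
    have hp : r ≠ p := fun h => hr (h ▸ List.mem_cons_self)
    rw [List.map_cons, List.prod_cons, hb, slot]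
    split_ifs
    · exact ⟨_, Dp_mul_Dp _ _ _⟩
    · exact ⟨b, one_mul _⟩

theorem exists_prod_slot_single {n k : ℕ} (a : Fin k → ZMod 2) (I J : Fin k → Idx n) (r : Fin k)
    (L : List (Fin k)) (hL : L.Nodup) (hr : r ∈ L) :
    ∃ c : ℂ, c ≠ 0 ∧ (L.map fun p => slot p (a p) (Matrix.single (I p) (J p) 1) r).prod =
      c • Matrix.single (I r) (J r) 1 := by
  obtain ⟨L₁, L₂, rfl⟩ := List.append_of_mem hr
  have h1 : r ∉ L₁ := fun h => List.disjoint_of_nodup_append hL h List.mem_cons_self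
  have h2 : r ∉ L₂ := (List.nodup_cons.1 (List.nodup_append.1 hL).2.1).1
  obtain ⟨b, hb⟩ := prod_slot_of_not_mem a (fun p => Matrix.single (I p) (J p) 1) r L₁ h1
  obtain ⟨c, hc⟩ := prod_slot_of_not_mem a (fun p => Matrix.single (I p) (J p) 1) r L₂ h2
  refine ⟨sgn (b * (I r).par) * sgn (c * (J r).par),
    mul_ne_zero (sgn_ne_zero _) (sgn_ne_zero _), ?_⟩
  rw [List.map_append, List.prod_append, List.map_cons, List.prod_cons, hb, hc, slot,
    if_neg (lt_irrefl _), if_pos rfl]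
  ext i j
  rw [Dp, Dp, Matrix.diagonal_mul, Matrix.mul_diagonal, Matrix.smul_apply, smul_eq_mul]
  by_cases h : I r = i ∧ J r = j
  · obtain ⟨rfl, rfl⟩ := h
    simp
  · rw [Matrix.single_apply_of_ne _ _ _ _ _ h]
    simp

theorem pk_smul_single {n k : ℕ} (c : Fin k → ℂ) (I J : Fin k → Idx n) :
    pk (fun r => c r • Matrix.single (I r) (J r) (1 : ℂ)) = (∏ r, c r) • Matrix.single I J 1 := by
  ext I' J'
  simp only [pk, Matrix.of_apply, Matrix.smul_apply, smul_eq_mul, Finset.prod_mul_distrib]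
  congr 1
  by_cases h : I = I' ∧ J = J'
  · obtain ⟨rfl, rfl⟩ := h
    simp
  · rw [Matrix.single_apply_of_ne _ _ _ _ _ h]
    have : ∃ r, ¬(I r = I' r ∧ J r = J' r) := by
      by_contra h'
      push Not at h'
      exact h ⟨funext fun r => (h' r).1, funext fun r => (h' r).2⟩
    obtain ⟨r, hr⟩ := this
    exact Finset.prod_eq_zero (Finset.mem_univ r) (Matrix.single_apply_of_ne _ _ _ _ _ hr)

theorem prod_pk {n k : ℕ} {κ : Type*} (L : List κ) (M : κ → Fin k → gl n) :
    (L.map fun p => pk (M p)).prod = pk fun r => (L.map fun p => M p r).prod := by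
  induction L with
  | nil => exact pk_one.symm
  | cons p L ih => rw [List.map_cons, List.prod_cons, ih, pk_mul]; rfl

/-- In slot r every other operator contributes only a sign matrix or the identity, which rescales
E_{I r, J r} by a sign. The total sign is never computed: `symb` divides by it. -/
theorem exists_prod_rho_single {n k : ℕ} (I J : Fin k → Idx n) :
    ∃ c : ℂ, c ≠ 0 ∧ ((List.finRange k).map fun p => rho p (Matrix.single (I p) (J p) 1)).prod =
      c • Matrix.single I J 1 := by
  have h := fun r => exists_prod_slot_single (fun p => (I p).par + (J p).par) I J r
    (List.finRange k) (List.nodup_finRange k) (List.mem_finRange r)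
  choose c hc hc' using h
  refine ⟨∏ r, c r, Finset.prod_ne_zero_iff.2 fun r _ => hc r, ?_⟩
  simp only [fun p => rho_of_isHom p (isHom_single (I p) (J p) 1), prod_pk, hc', pk_smul_single]

/-- The coefficient of `E_IJ` in the ordered product of the operators `E_ij` in the slots. -/
def unitSign {n k : ℕ} (I J : Fin k → Idx n) : ℂ := (exists_prod_rho_single I J).choose

theorem unitSign_ne_zero {n k : ℕ} (I J : Fin k → Idx n) : unitSign I J ≠ 0 :=
  (exists_prod_rho_single I J).choose_spec.1

theorem prod_rho_single {n k : ℕ} (I J : Fin k → Idx n) :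
    ((List.finRange k).map fun p => rho p (Matrix.single (I p) (J p) 1)).prod =
      unitSign I J • Matrix.single I J 1 :=
  (exists_prod_rho_single I J).choose_spec.2

/-- The linear map to the symmetric algebra which sends the ordered product of operators in the
slots to the product of their images. -/
def symb (n k : ℕ) : Op n k →ₗ[ℂ] S n :=
  ∑ I, ∑ J, (unitSign I J)⁻¹ • LinearMap.smulRight (Matrix.entryLinearMap ℂ ℂ I J)
    ((List.finRange k).map fun p => S.ι n (F (I p) (J p))).prod

theorem symb_single {n k : ℕ} (I J : Fin k → Idx n) :
    symb n k (Matrix.single I J 1) =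
      (unitSign I J)⁻¹ • ((List.finRange k).map fun p => S.ι n (F (I p) (J p))).prod := by
  simp only [symb, LinearMap.sum_apply, LinearMap.smul_apply, LinearMap.smulRight_apply,
    Matrix.entryLinearMap_apply]
  rw [Finset.sum_eq_single I, Finset.sum_eq_single J]
  · rw [Matrix.single_apply_same, one_smul]
  · intro J' _ h
    rw [Matrix.single_apply_of_ne _ _ _ _ _ (fun e => h e.2.symm), zero_smul, smul_zero]
  · simp
  · intro I' _ h
    refine Finset.sum_eq_zero fun J' _ => ?_
    rw [Matrix.single_apply_of_ne _ _ _ _ _ (fun e => h e.1.symm), zero_smul, smul_zero]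
  · simp

theorem fst_list_prod {R R' : Type*} [Monoid R] [Monoid R'] (l : List (R × R')) :
    l.prod.1 = (l.map Prod.fst).prod := map_list_prod (MonoidHom.fst R R') l

theorem snd_list_prod {R R' : Type*} [Monoid R] [Monoid R'] (l : List (R × R')) :
    l.prod.2 = (l.map Prod.snd).prod := map_list_prod (MonoidHom.snd R R') l

/-- For a list containing every slot once, `corr` lies in the graph of `symb`; by `corr_perm` only
the standard order of slots has to be checked, on products of units. -/
theorem symb_of_mem_corr {n k : ℕ} {L : List (Fin k)} (hL : (List.finRange k).Perm L)
    {t : Op n k × S n} (ht : t ∈ corr n L) : symb n k t.1 = t.2 := by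
  rw [← corr_perm hL (List.nodup_finRange k)] at ht
  replace ht := corr_le_span _ ht
  induction ht using Submodule.span_induction with
  | mem t h =>
    obtain ⟨w, hw, rfl⟩ := h
    rw [List.length_finRange] at hw
    subst hw
    have e : List.zipWith (fun p u => ep p (Matrix.single u.1 u.2 1))
        (List.finRange w.length) w = (List.finRange w.length).map
          fun p => ep p (Matrix.single (w.get p).1 (w.get p).2 1) := by
      apply List.ext_getElem
      · simp
      · intro i h1 h2
        simp
    rw [e, fst_list_prod, snd_list_prod, List.map_map, List.map_map]
    have h1 := prod_rho_single (fun p => (w.get p).1) (fun p => (w.get p).2)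
    have h2 := symb_single (fun p => (w.get p).1) (fun p => (w.get p).2)
    have e1 : (Prod.fst ∘ fun p => ep p (Matrix.single (w.get p).1 (w.get p).2 1)) =
      fun p => rho p (Matrix.single (w.get p).1 (w.get p).2 1) := rfl
    have e2 : (Prod.snd ∘ fun p : Fin w.length => ep p (Matrix.single (w.get p).1 (w.get p).2 1)) =
        fun p => S.ι n (F (w.get p).1 (w.get p).2) := by
      funext p
      change S.ι n (toQ n _) = _
      rw [toQ_single]
    rw [e1, e2, h1, map_smul, h2, smul_smul, mul_inv_cancel₀ (unitSign_ne_zero _ _), one_smul]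
  | zero => exact map_zero _
  | add a b _ _ h1 h2 => rw [Prod.fst_add, Prod.snd_add, map_add, h1, h2]
  | smul c a _ h => rw [Prod.smul_fst, Prod.smul_snd, map_smul, h]

/-! ### The images of words in the symmetric algebra -/

theorem word_map {n N : ℕ} {κ A A' : Type*} [Ring A] [Algebra ℂ A] [Ring A'] [Algebra ℂ A']
    (φ : A →ₐ[ℂ] A') (E : κ → Matrix (Idx n) (Idx n) A) (l : List (Letter n N × κ)) :
    (word E l).map φ = word (fun p => (E p).map φ) l := by
  have hc : ∀ z : gl n, (cm z : Matrix (Idx n) (Idx n) A).map φ = cm z := by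
    intro z
    ext i j
    rw [Matrix.map_apply, cm_apply, cm_apply, AlgHom.commutes]
  have hm : ∀ M M' : Matrix (Idx n) (Idx n) A, (M * M').map φ = M.map φ * M'.map φ :=
    fun M M' => Matrix.map_mul (f := φ)
  induction l with
  | nil => exact Matrix.map_one _ (map_zero φ) (map_one φ)
  | cons y l ih => rw [word, hm, hm, hm, hc, hc, ih, word]

theorem cyc_map {n N : ℕ} {κ A A' : Type*} [Ring A] [Algebra ℂ A] [Ring A'] [Algebra ℂ A']
    (φ : A →ₐ[ℂ] A') (E : κ → Matrix (Idx n) (Idx n) A) (l : List (Letter n N × κ)) :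
    φ (cyc E l) = cyc (fun p => (E p).map φ) l := by
  simp only [cyc, Matrix.trace, Matrix.diag, cm_Dp_mul, map_sum, map_smul, ← word_map,
    Matrix.map_apply]

/-- The matrix with the entries `ep p E_ij`. -/
def epm {n k : ℕ} (p : Fin k) : Matrix (Idx n) (Idx n) (Op n k × S n) :=
  Matrix.of fun i j => ep p (Matrix.single i j 1)

theorem cm_mul_mem {n : ℕ} {A : Type*} [Ring A] [Algebra ℂ A] {V : Submodule ℂ A} (z : gl n)
    {M : Matrix (Idx n) (Idx n) A} (hM : ∀ i j, M i j ∈ V) (i j : Idx n) :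
    (cm z * M : Matrix (Idx n) (Idx n) A) i j ∈ V := by
  rw [Matrix.mul_apply]
  refine Submodule.sum_mem _ fun k _ => ?_
  rw [cm_apply, ← Algebra.smul_def]
  exact Submodule.smul_mem _ _ (hM k j)

theorem word_mem_corr {n N k : ℕ} (l : List (Letter n N × Fin k)) (i j : Idx n) :
    word epm l i j ∈ corr n (l.map Prod.snd) := by
  induction l generalizing i j with
  | nil =>
    by_cases h : i = j
    · subst h
      rw [word, Matrix.one_apply_eq]
      exact Submodule.one_le.1 le_rfl
    · rw [word, Matrix.one_apply_ne h]
      exact Submodule.zero_mem _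
  | cons y l ih =>
    have e : corr n ((y :: l).map Prod.snd) =
      LinearMap.range (ep y.2) * corr n (l.map Prod.snd) := List.prod_cons
    rw [e, word]
    refine cm_mul_mem _ (fun i j => ?_) i j
    rw [Matrix.mul_apply]
    exact Submodule.sum_mem _ fun k _ =>
      Submodule.mul_mem_mul ⟨_, rfl⟩ (cm_mul_mem _ ih k j)

theorem cyc_mem_corr {n N k : ℕ} (l : List (Letter n N × Fin k)) :
    cyc epm l ∈ corr n (l.map Prod.snd) :=
  Submodule.sum_mem _ fun i _ => cm_mul_mem _ (word_mem_corr l) i i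

theorem prod_cyc_mem_corr {n N k : ℕ} (C : List (List (Letter n N × Fin k))) :
    (C.map (cyc epm)).prod ∈ corr n (slots C) := by
  induction C with
  | nil => exact Submodule.one_le.1 le_rfl
  | cons l C ih =>
    have e : slots (l :: C) = l.map Prod.snd ++ slots C := by simp [slots]
    rw [e, corr_append, List.map_cons, List.prod_cons]
    exact Submodule.mul_mem_mul (cyc_mem_corr l) ih

/-- The same cyclic words, formed with the matrices `epm`, lie in `corr` and project to products of
traces of operators and to products of traces in the symmetric algebra. So the symbol is read off in
the second component. -/
theorem Sergeev.symb_mem {n N k : ℕ} {L : List (Fin k)} {d : ZMod 2} {t : Op n k}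
    (h : Sergeev N L d t) (hL : (List.finRange k).Perm L) : symb n k t ∈ genAlg n N := by
  obtain ⟨C, c, hC, rfl⟩ := h.exists_cyc (hL.nodup (List.nodup_finRange k))
  rw [map_smul]
  refine Subalgebra.smul_mem _ ?_ _
  have h1 := symb_of_mem_corr (hL.trans hC.symm) (prod_cyc_mem_corr C)
  rw [fst_list_prod, snd_list_prod, List.map_map, List.map_map] at h1
  have e1 : (Prod.fst ∘ cyc epm : List (Letter n N × Fin k) → Op n k) = cyc Em := by
    funext l
    exact cyc_map (AlgHom.fst ℂ (Op n k) (S n)) epm l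
  have e2 : (Prod.snd ∘ cyc epm : List (Letter n N × Fin k) → S n) = cyc fun _ => Fm n := by
    funext l
    have h3 : (fun p : Fin k => (epm p).map (AlgHom.snd ℂ (Op n k) (S n))) = fun _ => Fm n := by
      funext p
      ext i j
      change S.ι n (toQ n _) = _
      rw [toQ_single]
      rfl
    have h2 := cyc_map (AlgHom.snd ℂ (Op n k) (S n)) epm l
    rw [h3] at h2
    exact h2
  rw [e1, e2] at h1
  rw [h1]
  refine Subalgebra.list_prod_mem _ fun a ha => ?_
  obtain ⟨l, _, rfl⟩ := List.mem_map.1 ha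
  exact cyc_Fm_mem l

/-! ### Invariance of the generators -/

theorem glBracket_of_isHom {n : ℕ} {p r : ZMod 2} {x y : gl n} (hx : IsHom p x) (hy : IsHom r y) :
    glBracket n x y = x * y - sgn (p * r) • (y * x) := by
  rw [glBracket, Finset.sum_eq_single p, Finset.sum_eq_single r]
  · rw [glProj_of_isHom hx, glProj_of_isHom hy, if_pos rfl, if_pos rfl]
  · intro b _ hb
    rw [glProj_of_isHom hy, if_neg hb, mul_zero, zero_mul, smul_zero, sub_zero]
  · exact fun h => absurd (Finset.mem_univ _) h
  · intro a _ ha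
    refine Finset.sum_eq_zero fun b _ => ?_
    rw [glProj_of_isHom hx, if_neg ha, mul_zero, zero_mul, smul_zero, sub_zero]
  · exact fun h => absurd (Finset.mem_univ _) h

theorem commute_flp_of_mem_q {n : ℕ} {x : gl n} (hx : x ∈ q n) : x * flp n = flp n * x := by
  have h : eta n x = x := hx
  rw [eta_eq] at h
  nth_rewrite 1 [← h]
  rw [mul_assoc, flp_mul_self, mul_one]

theorem toQ_mul_left {n : ℕ} {x : gl n} (hx : x ∈ q n) (y : gl n) :
    (toQ n (x * y) : gl n) = x * toQ n y := by
  have := commute_flp_of_mem_q hx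
  rw [toQ_coe, toQ_coe, mul_add, ← mul_assoc (flp n), ← this]
  simp only [mul_assoc]

theorem toQ_mul_right {n : ℕ} {x : gl n} (hx : x ∈ q n) (y : gl n) :
    (toQ n (y * x) : gl n) = toQ n y * x := by
  have := commute_flp_of_mem_q hx
  rw [toQ_coe, toQ_coe, add_mul, mul_assoc _ (flp n) x, ← this]
  simp only [mul_assoc]

theorem qBracket_toQ {n : ℕ} {p r : ZMod 2} {x : q n} {y : gl n} (hx : IsHom p (x : gl n))
    (hy : IsHom r y) :
    qBracket n x (toQ n y) = toQ n (x * y) - sgn (p * r) • toQ n (y * x) := by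
  apply Subtype.ext
  rw [Submodule.coe_sub, Submodule.coe_smul, toQ_mul_left x.2, toQ_mul_right x.2]
  exact glBracket_of_isHom hx (mem_qDeg_iff.1 (toQ_mem_qDeg hy))

theorem mul_single_one {n : ℕ} (x : gl n) (i j : Idx n) :
    x * Matrix.single i j 1 = ∑ k, x k i • (Matrix.single k j 1 : gl n) := by
  ext a b
  rw [Matrix.sum_apply, Finset.sum_eq_single a]
  · by_cases h : j = b
    · subst h
      simp
    · rw [Matrix.mul_single_apply_of_ne _ _ _ _ _ (Ne.symm h), Matrix.smul_apply,
        Matrix.single_apply_of_ne _ _ _ _ _ fun e => h e.2, smul_zero]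
  · intro k _ hk
    rw [Matrix.smul_apply, Matrix.single_apply_of_ne _ _ _ _ _ fun e => hk e.1, smul_zero]
  · exact fun h => absurd (Finset.mem_univ _) h

theorem single_one_mul {n : ℕ} (x : gl n) (i j : Idx n) :
    Matrix.single i j 1 * x = ∑ k, x j k • (Matrix.single i k 1 : gl n) := by
  ext a b
  rw [Matrix.sum_apply, Finset.sum_eq_single b]
  · by_cases h : i = a
    · subst h
      simp
    · rw [Matrix.single_mul_apply_of_ne _ _ _ _ _ (Ne.symm h), Matrix.smul_apply,
        Matrix.single_apply_of_ne _ _ _ _ _ fun e => h e.1, smul_zero]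
  · intro k _ hk
    rw [Matrix.smul_apply, Matrix.single_apply_of_ne _ _ _ _ _ fun e => hk e.2, smul_zero]
  · exact fun h => absurd (Finset.mem_univ _) h

/-! ### Superderivations applied entrywise to products of matrices. -/

section Superderivation

variable {n : ℕ} {A : Type*} [Ring A] [Algebra ℂ A] {δ : A →ₗ[ℂ] A} {τ : A →ₐ[ℂ] A}

theorem map_superderivation_mul (h : ∀ a b, δ (a * b) = δ a * b + τ a * δ b)
    (M M' : Matrix (Idx n) (Idx n) A) :
    (M * M').map δ = M.map δ * M' + M.map τ * M'.map δ := by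
  ext i j
  simp only [Matrix.map_apply, Matrix.add_apply, Matrix.mul_apply, map_sum, h,
    Finset.sum_add_distrib]

theorem map_superderivation_cm (h : ∀ c, δ (algebraMap ℂ A c) = 0) (z : gl n) :
    (cm z : Matrix (Idx n) (Idx n) A).map δ = 0 := by
  ext i j
  rw [Matrix.map_apply, cm_apply, h, Matrix.zero_apply]

theorem map_algHom_cm (z : gl n) : (cm z : Matrix (Idx n) (Idx n) A).map τ = cm z := by
  ext i j
  rw [Matrix.map_apply, cm_apply, AlgHom.commutes]

/-- The two middle terms cancel because x, of degree r, commutes with the product of `Dp n r` and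
`Dp n 1`, as (r + 1) r = 0 modulo 2. -/
theorem superderivation_step (h : ∀ a b, δ (a * b) = δ a * b + τ a * δ b)
    (h0 : ∀ c, δ (algebraMap ℂ A c) = 0) {r : ZMod 2} {x : gl n} (hx : IsHom r x)
    {E G : Matrix (Idx n) (Idx n) A}
    (hτ : E.map τ = cm (Dp n r) * E * cm (Dp n r))
    (hE : E.map δ = cm x * E - cm (Dp n r) * E * cm x * cm (Dp n r))
    (hG : G.map δ = cm x * G - cm (Dp n r) * G * cm x * cm (Dp n r)) :
    (E * cm (Dp n 1) * G).map δ = cm x * (E * cm (Dp n 1) * G) -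
      cm (Dp n r) * (E * cm (Dp n 1) * G) * cm x * cm (Dp n r) := by
  have h1 : (E * cm (Dp n 1)).map τ = E.map τ * (cm (Dp n 1) : Matrix (Idx n) (Idx n) A) := by
    nth_rewrite 2 [← map_algHom_cm (A := A) (τ := τ) (Dp n 1)]
    exact Matrix.map_mul (f := τ)
  rw [map_superderivation_mul h, map_superderivation_mul h, map_superderivation_cm h0, mul_zero,
    add_zero, h1, hτ, hE, hG]
  have e1 : (cm x : Matrix (Idx n) (Idx n) A) * cm (Dp n r) * cm (Dp n 1) =
      cm (Dp n r) * cm (Dp n 1) * cm x := by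
    have : (r + 1) * r = 0 := by
      clear hx hτ hE hG
      revert r
      decide
    have h2 := hx.Dp_mul (r + 1)
    rw [this, sgn_zero, one_smul, ← Dp_mul_Dp] at h2
    rw [← map_mul, ← map_mul, ← map_mul, mul_assoc, ← h2, map_mul]
  have e2 : (cm (Dp n r) : Matrix (Idx n) (Idx n) A) * cm (Dp n 1) * cm (Dp n r) =
      cm (Dp n 1) := by
    rw [← map_mul, ← map_mul, Dp_mul_Dp, Dp_mul_Dp, add_comm, ← add_assoc, zmod_two_add_self,
      zero_add]
  generalize (cm x : Matrix (Idx n) (Idx n) A) = u at *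
  generalize (cm (Dp n r) : Matrix (Idx n) (Idx n) A) = d at *
  generalize (cm (Dp n 1) : Matrix (Idx n) (Idx n) A) = e at *
  have k1 : d * E * u * d * e * G = d * E * d * e * (u * G) := by
    calc d * E * u * d * e * G = d * E * (u * d * e) * G := by noncomm_ring
      _ = _ := by rw [e1]; noncomm_ring
  have k2 : d * E * d * e * (d * G * u * d) = d * (E * e * G) * u * d := by
    calc d * E * d * e * (d * G * u * d) = d * E * (d * e * d) * G * u * d := by noncomm_ring
      _ = _ := by rw [e2]; noncomm_ring
  rw [sub_mul, sub_mul, mul_sub, k1, k2]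
  noncomm_ring

end Superderivation

theorem adComp_Fm {n : ℕ} {r : ZMod 2} {x : q n} (hx : x ∈ qDeg n r) :
    (Fm n).map (adComp n r x) = cm (x : gl n).transpose * Fm n -
      cm (Dp n r) * Fm n * cm (x : gl n).transpose * cm (Dp n r) := by
  have hx' := mem_qDeg_iff.1 hx
  ext i j
  rw [Matrix.sub_apply, mul_cm_Dp, mul_assoc, cm_Dp_mul, Matrix.map_apply]
  change adComp n r x (S.ι n (F i j)) = _
  rw [adComp_ι, show qProj n r x = x from hx, ← toQ_single, qBracket_toQ hx' (isHom_single _ _ _),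
    mul_single_one, single_one_mul, map_sub, map_smul, mul_add, sgn_add, Matrix.mul_apply,
    Matrix.mul_apply, smul_smul, mul_comm (sgn (r * i.par))]
  simp only [map_sum, map_smul, toQ_single, cm_apply, Matrix.transpose_apply]
  refine congrArg₂ _ (Finset.sum_congr rfl fun k _ => ?_)
    (congrArg _ (Finset.sum_congr rfl fun k _ => ?_))
  · exact Algebra.smul_def _ _
  · rw [← Algebra.commutes]
    exact Algebra.smul_def _ _

theorem twist_Fm (n : ℕ) (r : ZMod 2) :
    (Fm n).map (S.twist n r) = cm (Dp n r) * Fm n * cm (Dp n r) := by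
  ext i j
  rw [mul_cm_Dp, cm_Dp_mul, smul_smul, Matrix.map_apply]
  change S.twist n r (S.ι n (F i j)) = _
  rw [S.twist, S.lift_ι, LinearMap.comp_apply, qTwist_of_mem r (F_mem_qDeg i j), map_smul,
    mul_add, sgn_add, mul_comm (sgn (r * i.par))]
  rfl

theorem adComp_fm {n : ℕ} {r : ZMod 2} {x : q n} (hx : x ∈ qDeg n r) (m : ℕ) :
    (fm n (m + 1)).map (adComp n r x) = cm (x : gl n).transpose * fm n (m + 1) -
      cm (Dp n r) * fm n (m + 1) * cm (x : gl n).transpose * cm (Dp n r) := by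
  induction m with
  | zero => exact adComp_Fm hx
  | succ m ih =>
    rw [fm_succ_succ]
    exact superderivation_step (adComp_mul r x) (adComp_algebraMap r x)
      (mem_qDeg_iff.1 hx).transpose (twist_Fm n r) (adComp_Fm hx) ih

theorem apply_eq_zero_of_mem_qM {N M : ℕ} {x : q (N + M)} (hx : x ∈ qM N M)
    {i j : Idx (N + M)} (h : i.abs ≤ N ∨ j.abs ≤ N) : (x : gl (N + M)) i j = 0 := by
  induction hx using Submodule.span_induction with
  | mem x hx =>
    obtain ⟨a, b, ha, hb, rfl⟩ := hx
    change Matrix.single a b 1 i j + Matrix.single a.opp b.opp 1 i j = (0 : ℂ)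
    have ha' : N < a.opp.abs := ha
    have hb' : N < b.opp.abs := hb
    rw [Matrix.single_apply_of_ne, Matrix.single_apply_of_ne, add_zero]
    · rintro ⟨rfl, rfl⟩
      rcases h with h | h <;> omega
    · rintro ⟨rfl, rfl⟩
      rcases h with h | h <;> omega
  | zero => rfl
  | add x y _ _ h1 h2 =>
    rw [Submodule.coe_add, Matrix.add_apply, h1, h2, add_zero]
  | smul c x _ h1 => rw [Submodule.coe_smul, Matrix.smul_apply, h1, smul_zero]

theorem mem_invariants_of_adComp {N M : ℕ} {a : S (N + M)}
    (h : ∀ r, ∀ x ∈ qM N M, x ∈ qDeg (N + M) r → adComp (N + M) r x a = 0) :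
    a ∈ invariants N M := by
  intro x hx
  rw [ad, LinearMap.sum_apply]
  refine Finset.sum_eq_zero fun r _ => ?_
  rw [← adComp_congr (X := qProj (N + M) r x) (by rw [qProj_qProj, if_pos rfl])]
  exact h r _ (qProj_mem_qM r hx) (qProj_mem r x)

theorem f_mem_invariants {N M : ℕ} (m : ℕ) {i j : Idx (N + M)} (hi : i.abs ≤ N)
    (hj : j.abs ≤ N) : f (N + M) (m + 1) i j ∈ invariants N M := by
  refine mem_invariants_of_adComp fun r x hx hr => ?_
  have h := congrFun (congrFun (adComp_fm hr m) i) j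
  rw [Matrix.map_apply, Matrix.sub_apply, mul_cm_Dp, Matrix.mul_apply, Matrix.mul_apply,
    Finset.sum_eq_zero, Finset.sum_eq_zero, smul_zero, sub_zero] at h
  · exact h
  · intro k _
    rw [cm_apply, Matrix.transpose_apply, apply_eq_zero_of_mem_qM hx (Or.inl hj), map_zero,
      mul_zero]
  · intro k _
    rw [cm_apply, Matrix.transpose_apply, apply_eq_zero_of_mem_qM hx (Or.inr hi), map_zero,
      zero_mul]

/-- Scalar matrices move cyclically under the trace, so the two terms of `adComp_fm` have the same
trace. -/
theorem c_mem_invariants (N M m : ℕ) : c (N + M) (m + 1) ∈ invariants N M := by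
  refine mem_invariants_of_adComp fun r x _ hr => ?_
  have h := congrArg Matrix.trace (adComp_fm hr m)
  have e : c (N + M) (m + 1) = (fm (N + M) (m + 1)).trace := rfl
  rw [e, AddMonoidHom.map_trace (adComp (N + M) r x), ← sub_self (Matrix.trace
    (cm (x : gl (N + M)).transpose * fm (N + M) (m + 1)))]
  refine h.trans ?_
  rw [Matrix.trace_sub, mul_assoc, mul_assoc, trace_cm_mul (Dp (N + M) r), mul_assoc, mul_assoc,
    ← map_mul, Dp_mul_self, map_one, mul_one, ← trace_cm_mul]

theorem genAlg_le_invariants (N M : ℕ) : genAlg (N + M) N ≤ invariants N M := by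
  refine Algebra.adjoin_le ?_
  rintro a (⟨m, hm, rfl⟩ | ⟨m, i, j, hm, hi, hj, rfl⟩)
  · obtain ⟨m, rfl⟩ := Nat.exists_eq_add_of_le' hm.pos
    exact c_mem_invariants N M m
  · obtain ⟨m, rfl⟩ := Nat.exists_eq_add_of_le' hm
    exact f_mem_invariants m hi hj

/-! ### The polarization of elements of the symmetric algebra -/

theorem q_induction {n : ℕ} {C : q n → Prop} (hom : ∀ p X, X ∈ qDeg n p → C X)
    (add : ∀ X Y, C X → C Y → C (X + Y)) (X : q n) : C X := by
  have h : X = qProj n 0 X + qProj n 1 X := by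
    apply Subtype.ext
    have h1 : (Finset.univ : Finset (ZMod 2)) = {0, 1} := rfl
    have h2 := sum_glProj (X : gl n)
    rw [h1, Finset.sum_pair (by decide)] at h2
    exact h2.symm
  rw [h]
  exact add _ _ (hom 0 _ (qProj_mem _ _)) (hom 1 _ (qProj_mem _ _))

/-- The families of operators indexed by the sets of slots. -/
abbrev Fam (n k : ℕ) : Type := Finset (Fin k) → Op n k

/-- The operator on families which inserts `y` in one more slot. -/
def ins (n k : ℕ) : gl n →ₗ[ℂ] Module.End ℂ (Fam n k) where
  toFun y :=
    -- These are creation operators; a product of k of them applied to `vac` gives, at a set of k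
    -- slots, the sum over all distributions of the factors among the slots.
    { toFun := fun v I => ∑ p ∈ I, rho p y * v (I.erase p)
      map_add' := fun v w => by
        funext I
        simp only [Pi.add_apply, mul_add, Finset.sum_add_distrib]
      map_smul' := fun c v => by
        funext I
        simp only [Pi.smul_apply, mul_smul_comm, RingHom.id_apply, Finset.smul_sum] }
  map_add' x y := by
    refine LinearMap.ext fun v => funext fun I => ?_
    simp only [LinearMap.coe_mk, AddHom.coe_mk, LinearMap.add_apply, Pi.add_apply, map_add,
      add_mul, Finset.sum_add_distrib]
  map_smul' c x := by
    refine LinearMap.ext fun v => funext fun I => ?_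
    simp only [LinearMap.coe_mk, AddHom.coe_mk, LinearMap.smul_apply, Pi.smul_apply, map_smul,
      smul_mul_assoc, RingHom.id_apply, Finset.smul_sum]

theorem ins_apply {n k : ℕ} (y : gl n) (v : Fam n k) (I : Finset (Fin k)) :
    ins n k y v I = ∑ p ∈ I, rho p y * v (I.erase p) := rfl

/-- Both composites are sums over ordered pairs of distinct slots in I, and `rho_swap` compares them
term by term. By the universal property the symmetric algebra then acts on families. -/
theorem ins_swap {n k : ℕ} {a b : ZMod 2} {x y : gl n} (hx : IsHom a x) (hy : IsHom b y) :
    ins n k x * ins n k y = sgn (a * b) • (ins n k y * ins n k x) := by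
  refine LinearMap.ext fun v => funext fun I => ?_
  simp only [Module.End.mul_apply, LinearMap.smul_apply, Pi.smul_apply, ins_apply,
    Finset.mul_sum, Finset.smul_sum]
  rw [Finset.sum_comm' (t' := I) (s' := fun r => I.erase r)
    (h := by intro p r; simp only [Finset.mem_erase]; tauto)]
  refine Finset.sum_congr rfl fun r hr => Finset.sum_congr rfl fun p hp => ?_
  rw [← mul_assoc, ← mul_assoc, rho_swap (Finset.ne_of_mem_erase hp) hx hy, smul_mul_assoc,
    Finset.erase_right_comm]

/-- The action of the symmetric algebra on families by insertions. -/
def insAlg (n k : ℕ) : S n →ₐ[ℂ] Module.End ℂ (Fam n k) :=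
  S.lift (ins n k ∘ₗ (q n).subtype) fun _ _ _ _ hX hY =>
    ins_swap (mem_qDeg_iff.1 hX) (mem_qDeg_iff.1 hY)

theorem insAlg_ι {n k : ℕ} (X : q n) : insAlg n k (S.ι n X) = ins n k X := S.lift_ι _ _ _

/-- The diagonal action of `gl n` on a tensor product of `k` copies of `ℂ^{n|n}`. -/
def diag (n k : ℕ) : gl n →ₗ[ℂ] Op n k := ∑ p, rho p

theorem diag_apply {n k : ℕ} (x : gl n) : diag n k x = ∑ p, rho p x := LinearMap.sum_apply _ _ _

theorem diag_mul_rho {n k : ℕ} {r b : ZMod 2} {x y : gl n} (hx : IsHom r x) (hy : IsHom b y)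
    (p : Fin k) : diag n k x * rho p y =
      rho p (x * y - sgn (r * b) • (y * x)) + sgn (r * b) • (rho p y * diag n k x) := by
  rw [diag_apply, Finset.sum_mul, Finset.mul_sum, Finset.smul_sum,
    ← Finset.add_sum_erase _ _ (Finset.mem_univ p),
    ← Finset.add_sum_erase _ (fun u => sgn (r * b) • (rho p y * rho u x)) (Finset.mem_univ p),
    map_sub, map_smul, rho_mul, rho_mul, ← add_assoc, sub_add_cancel]
  refine congrArg _ (Finset.sum_congr rfl fun u hu => ?_)
  exact rho_swap (Finset.ne_of_mem_erase hu) hx hy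

theorem insAlg_mulRight {n k : ℕ} (a : S n) (v : Fam n k) (T : Op n k) :
    (insAlg n k a fun I => v I * T) = fun I => insAlg n k a v I * T := by
  induction a using S.induction generalizing v with
  | scalar c =>
    rw [AlgHom.commutes]
    funext I
    exact (smul_mul_assoc c (v I) T).symm
  | gen X =>
    rw [insAlg_ι]
    funext I
    simp only [ins_apply, Finset.sum_mul, mul_assoc]
  | mul a b ha hb => rw [map_mul, Module.End.mul_apply, hb, ha, Module.End.mul_apply]
  | add a b ha hb =>
    rw [map_add, LinearMap.add_apply, ha, hb]
    funext I
    exact (add_mul _ _ _).symm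

theorem twist_ι {n : ℕ} (r : ZMod 2) {b : ZMod 2} {X : q n} (hX : X ∈ qDeg n b) :
    S.twist n r (S.ι n X) = sgn (r * b) • S.ι n X := by
  rw [S.twist, S.lift_ι, LinearMap.comp_apply, qTwist_of_mem r hX, map_smul]

/-- On generators this is the commutation of the diagonal action with one insertion
(`diag_mul_rho`); the Leibniz rule `adComp_mul` carries it over to products. -/
theorem diag_mul_insAlg {n k : ℕ} {r : ZMod 2} {X : q n} (hX : X ∈ qDeg n r) (a : S n)
    (v : Fam n k) : (fun I => diag n k X * insAlg n k a v I) =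
      insAlg n k (adComp n r X a) v + insAlg n k (S.twist n r a) fun I => diag n k X * v I := by
  induction a using S.induction generalizing v with
  | scalar c =>
    rw [adComp_algebraMap, map_zero, LinearMap.zero_apply, zero_add]
    simp only [AlgHom.commutes]
    funext I
    exact mul_smul_comm c (diag n k (X : gl n)) (v I)
  | gen Y =>
    induction Y using q_induction with
    | hom b Y hY =>
      rw [adComp_ι, show qProj n r X = X from hX, twist_ι r hY, map_smul, insAlg_ι, insAlg_ι]
      funext I
      rw [Pi.add_apply, LinearMap.smul_apply, Pi.smul_apply, ins_apply, ins_apply, ins_apply,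
        Finset.mul_sum, Finset.smul_sum, ← Finset.sum_add_distrib]
      refine Finset.sum_congr rfl fun p _ => ?_
      have hb : (qBracket n X Y : gl n) = _ :=
        glBracket_of_isHom (mem_qDeg_iff.1 hX) (mem_qDeg_iff.1 hY)
      rw [hb, ← mul_assoc, diag_mul_rho (mem_qDeg_iff.1 hX) (mem_qDeg_iff.1 hY), add_mul,
        smul_mul_assoc, mul_assoc]
    | add Y Z h1 h2 =>
      simp only [map_add, LinearMap.add_apply, Pi.add_apply, mul_add]
      have e : (fun I => diag n k X * insAlg n k (S.ι n Y) v I +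
          diag n k X * insAlg n k (S.ι n Z) v I) =
        (fun I => diag n k X * insAlg n k (S.ι n Y) v I) +
          fun I => diag n k X * insAlg n k (S.ι n Z) v I := rfl
      rw [e, h1, h2]
      abel
  | mul a b ha hb =>
    rw [adComp_mul, map_add, map_mul, map_mul, map_mul, map_mul, map_mul, LinearMap.add_apply,
      Module.End.mul_apply, Module.End.mul_apply, Module.End.mul_apply, Module.End.mul_apply,
      ha, hb, map_add, add_assoc]
  | add a b ha hb =>
    have e : (fun I => diag n k X * insAlg n k (a + b) v I) =
        (fun I => diag n k X * insAlg n k a v I) + fun I => diag n k X * insAlg n k b v I := by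
      funext I
      rw [map_add, LinearMap.add_apply, Pi.add_apply, mul_add]
      rfl
    rw [e, ha, hb]
    simp only [map_add, LinearMap.add_apply]
    abel

theorem parOp_mul_insAlg {n k : ℕ} (a : S n) (v : Fam n k) :
    (fun I => parOp n k * insAlg n k a v I) =
      insAlg n k (S.twist n 1 a) fun I => parOp n k * v I := by
  induction a using S.induction generalizing v with
  | scalar c =>
    simp only [AlgHom.commutes]
    funext I
    exact mul_smul_comm c (parOp n k) (v I)
  | gen Y =>
    induction Y using q_induction with
    | hom b Y hY =>
      rw [twist_ι 1 hY, map_smul, insAlg_ι]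
      funext I
      rw [LinearMap.smul_apply, Pi.smul_apply, ins_apply, ins_apply, Finset.mul_sum,
        Finset.smul_sum]
      refine Finset.sum_congr rfl fun p _ => ?_
      rw [← mul_assoc, parOp_mul_rho p (mem_qDeg_iff.1 hY), one_mul, smul_mul_assoc, mul_assoc]
    | add Y Z h1 h2 =>
      have e : (fun I => parOp n k * insAlg n k (S.ι n (Y + Z)) v I) =
          (fun I => parOp n k * insAlg n k (S.ι n Y) v I) +
            fun I => parOp n k * insAlg n k (S.ι n Z) v I := by
        funext I
        rw [map_add, map_add, LinearMap.add_apply, Pi.add_apply, mul_add]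
        rfl
      rw [e, h1, h2]
      simp only [map_add, LinearMap.add_apply]
  | mul a b ha hb =>
    rw [map_mul, map_mul, map_mul, Module.End.mul_apply, Module.End.mul_apply, ha, hb]
  | add a b ha hb =>
    have e : (fun I => parOp n k * insAlg n k (a + b) v I) =
        (fun I => parOp n k * insAlg n k a v I) + fun I => parOp n k * insAlg n k b v I := by
      funext I
      rw [map_add, LinearMap.add_apply, Pi.add_apply, mul_add]
      rfl
    rw [e, ha, hb]
    simp only [map_add, LinearMap.add_apply]

/-- The family whose only nonzero member is the identity operator, for the empty set. -/
def vac (n k : ℕ) : Fam n k := Pi.single ∅ 1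

/-- The polarization of an element of the symmetric algebra, with values in the operators on the
slots of a given set. -/
def pol (n k : ℕ) (I : Finset (Fin k)) : S n →ₗ[ℂ] Op n k :=
  LinearMap.proj I ∘ₗ (LinearMap.applyₗ (vac n k)) ∘ₗ (insAlg n k).toLinearMap

theorem pol_apply {n k : ℕ} (I : Finset (Fin k)) (a : S n) :
    pol n k I a = insAlg n k a (vac n k) I := rfl

/-- The only nonzero member of the vacuum is the identity. Hence operators acting on the vacuum from
the left reappear on the right of the polarization. -/
theorem mul_vac {n k : ℕ} (T : Op n k) :
    (fun I => T * vac n k I) = fun I => vac n k I * T := by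
  funext I
  by_cases h : I = ∅
  · subst h
    simp [vac]
  · simp [vac, h]

theorem diag_mul_pol {n k : ℕ} {r : ZMod 2} {X : q n} (hX : X ∈ qDeg n r) (a : S n)
    (I : Finset (Fin k)) : diag n k X * pol n k I a =
      pol n k I (adComp n r X a) + pol n k I (S.twist n r a) * diag n k X := by
  have h := congrFun (diag_mul_insAlg hX a (vac n k)) I
  rw [mul_vac, insAlg_mulRight] at h
  exact h

theorem parOp_mul_pol {n k : ℕ} (a : S n) (I : Finset (Fin k)) :
    parOp n k * pol n k I a = pol n k I (S.twist n 1 a) * parOp n k := by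
  have h := congrFun (parOp_mul_insAlg a (vac n k)) I
  rw [mul_vac, insAlg_mulRight] at h
  exact h

theorem pol_ι_mul {n k : ℕ} (X : q n) (a : S n) (I : Finset (Fin k)) :
    pol n k I (S.ι n X * a) = ∑ p ∈ I, rho p (X : gl n) * pol n k (I.erase p) a := by
  rw [pol_apply, map_mul, Module.End.mul_apply, insAlg_ι]
  rfl

theorem pol_one {n k : ℕ} (I : Finset (Fin k)) : pol n k I 1 = if I = ∅ then 1 else 0 := by
  rw [pol_apply, map_one]
  change vac n k I = _
  rw [vac, Pi.single_apply]

theorem pol_prod_of_ne {n k : ℕ} (l : List (q n)) (I : Finset (Fin k)) (h : I.card ≠ l.length) :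
    pol n k I (l.map (S.ι n)).prod = 0 := by
  induction l generalizing I with
  | nil =>
    rw [List.map_nil, List.prod_nil, pol_one, if_neg]
    rintro rfl
    exact h rfl
  | cons X l ih =>
    rw [List.map_cons, List.prod_cons, pol_ι_mul]
    refine Finset.sum_eq_zero fun p hp => ?_
    rw [ih, mul_zero]
    rw [Finset.card_erase_of_mem hp]
    intro h'
    have := Finset.card_pos.2 ⟨p, hp⟩
    exact h (by rw [List.length_cons]; omega)

/-- Each of the k! distributions of the factors among the slots corresponds to the same product in
the symmetric algebra, and each factor X contributes `toQ n X`, which is 2X. -/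
theorem pol_prod_mem_corr {n k : ℕ} (l : List (q n)) (L : List (Fin k)) (hL : L.Nodup)
    (h : L.length = l.length) :
    (pol n k L.toFinset (l.map (S.ι n)).prod,
      ((2 : ℂ) ^ l.length * (l.length).factorial) • (l.map (S.ι n)).prod) ∈ corr n L := by
  induction l generalizing L with
  | nil =>
    obtain rfl := List.length_eq_zero_iff.1 h
    have e : (pol n k ([] : List (Fin k)).toFinset ((([] : List (q n)).map (S.ι n)).prod),
      ((2 : ℂ) ^ ([] : List (q n)).length * (([] : List (q n)).length).factorial) •
        ((([] : List (q n)).map (S.ι n)).prod)) = 1 := by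
      refine Prod.ext ?_ ?_
      · rw [List.map_nil, List.prod_nil, pol_one]
        rfl
      · simp
    rw [e]
    exact Submodule.one_le.1 le_rfl
  | cons X l ih =>
    have key : ∀ p ∈ L.toFinset, (rho p (X : gl n) *
        pol n k (L.toFinset.erase p) (l.map (S.ι n)).prod,
        ((2 : ℂ) ^ (l.length + 1) * (l.length).factorial) •
          (S.ι n X * (l.map (S.ι n)).prod)) ∈ corr n L := by
      intro p hp
      have hp' := List.mem_toFinset.1 hp
      have h1 := ih (L.erase p) (hL.erase p) (by rw [List.length_erase_of_mem hp', h]; rfl)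
      have e1 : (L.erase p).toFinset = L.toFinset.erase p := by
        ext u
        rw [List.mem_toFinset, hL.mem_erase_iff, Finset.mem_erase, List.mem_toFinset]
      rw [e1] at h1
      rw [corr_perm (List.perm_cons_erase hp') hL]
      have h2 : corr n (p :: L.erase p) = LinearMap.range (ep p) * corr n (L.erase p) :=
        List.prod_cons
      rw [h2]
      have h0 : ep p (X : gl n) ∈ LinearMap.range (ep (n := n) p) := ⟨_, rfl⟩
      have h3 := Submodule.mul_mem_mul h0 h1
      convert h3 using 1
      refine Prod.ext rfl ?_
      change _ = S.ι n (toQ n X) * _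
      rw [toQ_of_mem, map_smul, smul_mul_smul_comm]
      refine congrArg₂ (· • ·) ?_ rfl
      ring
    have h4 := Submodule.sum_mem _ key
    convert h4 using 1
    refine Prod.ext ?_ ?_
    · rw [Prod.fst_sum, List.map_cons, List.prod_cons, pol_ι_mul]
    · rw [Prod.snd_sum, Finset.sum_const, List.toFinset_card_of_nodup hL, h, List.map_cons,
        List.prod_cons, ← Nat.cast_smul_eq_nsmul ℂ, smul_smul, List.length_cons,
        Nat.factorial_succ]
      refine congrArg₂ (· • ·) ?_ rfl
      push_cast
      ring

theorem symb_pol_prod {n k : ℕ} (l : List (q n)) :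
    symb n k (pol n k Finset.univ (l.map (S.ι n)).prod) =
      if l.length = k then ((2 : ℂ) ^ k * k.factorial) • (l.map (S.ι n)).prod else 0 := by
  split_ifs with h
  · subst h
    have h1 := pol_prod_mem_corr l (List.finRange l.length) (List.nodup_finRange _)
      (List.length_finRange)
    have h2 := symb_of_mem_corr (List.Perm.refl _) h1
    have e : (List.finRange l.length).toFinset = Finset.univ := by ext; simp
    rw [e] at h2
    exact h2
  · rw [pol_prod_of_ne, map_zero]
    rw [Finset.card_univ, Fintype.card_fin]
    exact fun h' => h h'.symm

theorem mem_span_prod {n : ℕ} (a : S n) :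
    a ∈ Submodule.span ℂ {b | ∃ l : List (q n), b = (l.map (S.ι n)).prod} := by
  have h : a ∈ Algebra.adjoin ℂ (Set.range (S.ι n)) := by
    induction a using S.induction with
    | scalar c => exact Subalgebra.algebraMap_mem _ c
    | gen X => exact Algebra.subset_adjoin ⟨X, rfl⟩
    | mul a b ha hb => exact mul_mem ha hb
    | add a b ha hb => exact add_mem ha hb
  rw [← Subalgebra.mem_toSubmodule, Algebra.adjoin_eq_span] at h
  refine Submodule.span_mono ?_ h
  intro b hb
  obtain ⟨l, hl, rfl⟩ := Submonoid.exists_list_of_mem_closure hb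
  clear hb
  induction l with
  | nil => exact ⟨[], rfl⟩
  | cons y l ih =>
    obtain ⟨X, rfl⟩ := hl y List.mem_cons_self
    obtain ⟨l', h'⟩ := ih fun z hz => hl z (List.mem_cons_of_mem _ hz)
    exact ⟨X :: l', by rw [List.prod_cons, h', List.map_cons, List.prod_cons]⟩

/-- The k-th summand restores the products of length k and kills the others. The quantifier over all
larger bounds allows the bounds for two elements to be merged. -/
theorem exists_sum_symb_pol {n : ℕ} (a : S n) : ∃ K : ℕ, ∀ K' ≥ K,
    ∑ k ∈ Finset.range K', ((2 : ℂ) ^ k * k.factorial)⁻¹ •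
      symb n k (pol n k Finset.univ a) = a := by
  induction mem_span_prod a using Submodule.span_induction with
  | mem a h =>
    obtain ⟨l, rfl⟩ := h
    refine ⟨l.length + 1, fun K' hK => ?_⟩
    rw [Finset.sum_eq_single l.length]
    · rw [symb_pol_prod, if_pos rfl, smul_smul, inv_mul_cancel₀, one_smul]
      exact mul_ne_zero (pow_ne_zero _ two_ne_zero) (Nat.cast_ne_zero.2 (Nat.factorial_ne_zero _))
    · intro k _ hk
      rw [symb_pol_prod, if_neg (Ne.symm hk), smul_zero]
    · exact fun h => absurd (Finset.mem_range.2 (by omega)) h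
  | zero => exact ⟨0, fun K' _ => by simp⟩
  | add a b _ _ h1 h2 =>
    obtain ⟨K₁, h1⟩ := h1
    obtain ⟨K₂, h2⟩ := h2
    refine ⟨max K₁ K₂, fun K' hK => ?_⟩
    simp only [map_add, smul_add, Finset.sum_add_distrib]
    rw [h1 K' (le_trans (le_max_left _ _) hK), h2 K' (le_trans (le_max_right _ _) hK)]
  | smul c a _ h =>
    obtain ⟨K, h⟩ := h
    refine ⟨K, fun K' hK => ?_⟩
    simp only [map_smul, smul_comm _ c, ← Finset.smul_sum]
    rw [h K' hK]

/-- An element of the symmetric algebra belongs to a subalgebra if the symbols of all its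
polarizations do. -/
theorem mem_of_symb_pol_mem {n : ℕ} {B : Subalgebra ℂ (S n)} {a : S n}
    (h : ∀ k, symb n k (pol n k Finset.univ a) ∈ B) : a ∈ B := by
  obtain ⟨K, hK⟩ := exists_sum_symb_pol a
  rw [← hK K le_rfl]
  exact Subalgebra.sum_mem _ fun k _ => Subalgebra.smul_mem _ (h k) _

/-! ### The centralizer -/

/-- The matrices which commute with `Π` and which differ from a scalar matrix only in the rows
and the columns of absolute value greater than `N`. -/
def core (n N : ℕ) : Submodule ℂ (gl n) where
  carrier := {y | y * flp n = flp n * y ∧ ∃ c : ℂ, ∀ i j, i.abs ≤ N ∨ j.abs ≤ N →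
    y i j = c * (1 : gl n) i j}
  zero_mem' := ⟨by rw [zero_mul, mul_zero], 0, fun i j _ => by rw [zero_mul]; rfl⟩
  add_mem' := by
    rintro x y ⟨hx, a, ha⟩ ⟨hy, b, hb⟩
    refine ⟨by rw [add_mul, mul_add, hx, hy], a + b, fun i j h => ?_⟩
    rw [Matrix.add_apply, ha i j h, hb i j h, add_mul]
  smul_mem' := by
    rintro c x ⟨hx, a, ha⟩
    refine ⟨by rw [smul_mul_assoc, mul_smul_comm, hx], c * a, fun i j h => ?_⟩
    rw [Matrix.smul_apply, ha i j h, smul_eq_mul, mul_assoc]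

/-- Closure under products is what keeps the correction terms in `exists_ins_mul` among insertions
from `core`. -/
theorem mul_mem_core {n N : ℕ} {x y : gl n} (hx : x ∈ core n N) (hy : y ∈ core n N) :
    x * y ∈ core n N := by
  obtain ⟨hx, a, ha⟩ := hx
  obtain ⟨hy, b, hb⟩ := hy
  refine ⟨by rw [mul_assoc, hy, ← mul_assoc, hx, mul_assoc], a * b, fun i j h => ?_⟩
  rw [Matrix.mul_apply]
  rcases h with h | h
  · rw [Finset.sum_eq_single i]
    · rw [ha i i (Or.inl h), hb i j (Or.inl h), Matrix.one_apply_eq, mul_one, mul_assoc]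
    · intro k _ hk
      rw [ha i k (Or.inl h), Matrix.one_apply_ne (Ne.symm hk), mul_zero, zero_mul]
    · exact fun h => absurd (Finset.mem_univ _) h
  · rw [Finset.sum_eq_single j]
    · rw [ha i j (Or.inr h), hb j j (Or.inr h), Matrix.one_apply_eq, mul_one]
      ring
    · intro k _ hk
      rw [hb k j (Or.inr h), Matrix.one_apply_ne hk, mul_zero, mul_zero]
    · exact fun h => absurd (Finset.mem_univ _) h

theorem mem_q_iff_commute_flp {n : ℕ} {x : gl n} : x ∈ q n ↔ x * flp n = flp n * x := by
  refine ⟨commute_flp_of_mem_q, fun h => ?_⟩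
  change eta n x = x
  rw [eta_eq, ← h, mul_assoc, flp_mul_self, mul_one]

theorem glProj_mem_core {n N : ℕ} (p : ZMod 2) {y : gl n} (hy : y ∈ core n N) :
    glProj n p y ∈ core n N := by
  obtain ⟨h, c, hc⟩ := hy
  refine ⟨mem_q_iff_commute_flp.1 (glProj_mem_q p (mem_q_iff_commute_flp.2 h)),
    if p = 0 then c else 0, fun i j hij => ?_⟩
  have h1 := glProj_of_isHom (isHom_one (n := n)) p
  have h2 := congrFun (congrFun h1 i) j
  rw [glProj_apply] at h2 ⊢
  rw [hc i j hij]
  by_cases e : i = j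
  · subst e
    rw [zmod_two_add_self]
    by_cases hp : p = 0
    · simp [hp]
    · simp [hp, Ne.symm hp]
  · simp [Matrix.one_apply_ne e]

theorem core_induction {n N : ℕ} {C : (x : gl n) → x ∈ core n N → Prop}
    (hom : ∀ p x (_ : IsHom p x) (h : x ∈ core n N), C x h)
    (add : ∀ x y hx hy, C x hx → C y hy → C (x + y) (add_mem hx hy))
    {x : gl n} (hx : x ∈ core n N) : C x hx := by
  have h : x = glProj n 0 x + glProj n 1 x := by
    have h1 : (Finset.univ : Finset (ZMod 2)) = {0, 1} := rfl
    have h2 := sum_glProj x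
    rw [h1, Finset.sum_pair (by decide)] at h2
    exact h2.symm
  have h' := add _ _ _ _ (hom 0 _ (isHom_glProj _ _) (glProj_mem_core 0 hx))
    (hom 1 _ (isHom_glProj _ _) (glProj_mem_core 1 hx))
  simpa only [← h] using h'

/-! ### Symmetric products of operators -/

/-- The span of the insertions of the elements of `core n N`. -/
def insCore (n N k : ℕ) : Submodule ℂ (Module.End ℂ (Fam n k)) := (core n N).map (ins n k)

/-- The span of the products of `m` insertions of elements of `core n N`. -/
def insPow (n N k : ℕ) : ℕ → Submodule ℂ (Module.End ℂ (Fam n k))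
  | 0 => 1
  | m + 1 => insCore n N k * insPow n N k m

/-- The operator on families which acts diagonally by `x`. -/
def diagFam {n k : ℕ} (x : gl n) : Module.End ℂ (Fam n k) where
  toFun v I := (∑ p ∈ I, rho p x) * v I
  map_add' v w := by
    funext I
    exact mul_add _ _ _
  map_smul' c v := by
    funext I
    exact mul_smul_comm c (∑ p ∈ I, rho p x) (v I)

theorem diagFam_apply {n k : ℕ} (x : gl n) (v : Fam n k) (I : Finset (Fin k)) :
    diagFam x v I = (∑ p ∈ I, rho p x) * v I := rfl

theorem diagFam_mul_ins {n k : ℕ} {a b : ZMod 2} {x y : gl n} (hx : IsHom a x)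
    (hy : IsHom b y) : diagFam x * ins n k y =
      ins n k (x * y) + sgn (a * b) • (ins n k y * diagFam x) := by
  refine LinearMap.ext fun v => funext fun I => ?_
  simp only [Module.End.mul_apply, LinearMap.add_apply, LinearMap.smul_apply, Pi.add_apply,
    Pi.smul_apply, ins_apply, diagFam_apply]
  rw [Finset.mul_sum, Finset.smul_sum, ← Finset.sum_add_distrib]
  refine Finset.sum_congr rfl fun p hp => ?_
  rw [← Finset.add_sum_erase _ _ hp, add_mul, ← mul_assoc, ← rho_mul]
  refine congrArg _ ?_
  rw [Finset.sum_mul, Finset.sum_mul, Finset.mul_sum, Finset.smul_sum]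
  refine Finset.sum_congr rfl fun r hr => ?_
  rw [← mul_assoc, ← mul_assoc, rho_swap (Finset.ne_of_mem_erase hr) hx hy, smul_mul_assoc]

/-- w' is w with the signs of moving x through it. When the diagonal action of x passes an insertion
of y, it leaves behind an insertion of xy, so the number of insertions does not grow. -/
theorem exists_ins_mul {n N k : ℕ} {a : ZMod 2} {x : gl n} (hx : IsHom a x)
    (hx' : x ∈ core n N) (m : ℕ) {w : Module.End ℂ (Fam n k)} (hw : w ∈ insPow n N k m) :
    ∃ w', ins n k x * w = w' * ins n k x ∧ diagFam x * w - w' * diagFam x ∈ insPow n N k m := by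
  induction m generalizing w with
  | zero =>
    obtain ⟨c, rfl⟩ := Submodule.mem_one.1 hw
    refine ⟨algebraMap ℂ _ c, (Algebra.commutes _ _).symm, ?_⟩
    rw [← Algebra.commutes, sub_self]
    exact Submodule.zero_mem _
  | succ m ih =>
    rw [insPow] at hw ⊢
    induction hw using Submodule.mul_induction_on' with
    | mem_mul_mem y hy w hw =>
      obtain ⟨y, hy, rfl⟩ := hy
      obtain ⟨w', h1, h2⟩ := ih hw
      induction hy using core_induction with
      | hom b y hb hy =>
        refine ⟨sgn (a * b) • (ins n k y * w'), ?_, ?_⟩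
        · rw [← mul_assoc, ins_swap hx hb, smul_mul_assoc, smul_mul_assoc, mul_assoc, h1, mul_assoc]
        · have e : diagFam x * (ins n k y * w) - sgn (a * b) • (ins n k y * w') * diagFam x =
              ins n k (x * y) * w +
                sgn (a * b) • (ins n k y * (diagFam x * w - w' * diagFam x)) := by
            rw [← mul_assoc, diagFam_mul_ins hx hb, add_mul, smul_mul_assoc, smul_mul_assoc,
              mul_sub, smul_sub, mul_assoc, mul_assoc, add_sub_assoc]
          rw [e]
          exact Submodule.add_mem _
            (Submodule.mul_mem_mul ⟨_, mul_mem_core hx' hy, rfl⟩ hw)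
            (Submodule.smul_mem _ _ (Submodule.mul_mem_mul ⟨_, hy, rfl⟩ h2))
      | add y z _ _ h3 h4 =>
        obtain ⟨u, h5, h6⟩ := h3
        obtain ⟨v, h7, h8⟩ := h4
        refine ⟨u + v, ?_, ?_⟩
        · rw [map_add, add_mul, mul_add, h5, h7, add_mul]
        · rw [map_add, add_mul, mul_add, add_mul, add_sub_add_comm]
          exact Submodule.add_mem _ h6 h8
    | add y z _ _ h3 h4 =>
      obtain ⟨u, h5, h6⟩ := h3
      obtain ⟨v, h7, h8⟩ := h4
      refine ⟨u + v, ?_, ?_⟩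
      · rw [mul_add, h5, h7, add_mul]
      · rw [mul_add, add_mul, add_sub_add_comm]
        exact Submodule.add_mem _ h6 h8

/-- The algebra generated by the diagonal action of `core n N`. -/
def diagAlg (n N k : ℕ) : Subalgebra ℂ (Op n k) :=
  Algebra.adjoin ℂ {t | ∃ x ∈ core n N, t = diag n k x}

theorem diag_mem_diagAlg {n N k : ℕ} {x : gl n} (hx : x ∈ core n N) :
    diag n k x ∈ diagAlg n N k := Algebra.subset_adjoin ⟨x, hx, rfl⟩

/-- On the constant family 1, inserting y and acting diagonally by y agree. So inserting y into w is
acting by y on w up to a term with only m insertions, to which the induction applies. -/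
theorem apply_one_mem_diagAlg {n N k : ℕ} (m : ℕ) {w : Module.End ℂ (Fam n k)}
    (hw : w ∈ insPow n N k m) : w 1 Finset.univ ∈ diagAlg n N k := by
  induction m generalizing w with
  | zero =>
    obtain ⟨c, rfl⟩ := Submodule.mem_one.1 hw
    exact Subalgebra.smul_mem _ (one_mem _) c
  | succ m ih =>
    rw [insPow] at hw
    induction hw using Submodule.mul_induction_on' with
    | mem_mul_mem y hy w hw =>
      obtain ⟨y, hy, rfl⟩ := hy
      induction hy using core_induction with
      | hom b y hb hy =>
        obtain ⟨w', h1, h2⟩ := exists_ins_mul hb hy m hw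
        have e : ins n k y 1 = diagFam y 1 := by
          funext I
          rw [ins_apply, diagFam_apply, Finset.sum_mul]
          rfl
        have h3 := ih h2
        rw [LinearMap.sub_apply, Module.End.mul_apply, Module.End.mul_apply, ← e,
          ← Module.End.mul_apply, ← Module.End.mul_apply, ← h1, Pi.sub_apply] at h3
        have h4 : ((diagFam y : Module.End ℂ (Fam n k)) * w) 1 Finset.univ ∈ diagAlg n N k := by
          rw [Module.End.mul_apply, diagFam_apply, ← diag_apply]
          exact mul_mem (diag_mem_diagAlg hy) (ih hw)
        have h5 := sub_mem h4 h3
        rwa [sub_sub_cancel] at h5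
      | add y z _ _ h3 h4 =>
        rw [map_add, add_mul]
        exact add_mem h3 h4
    | add y z _ _ h3 h4 => exact add_mem h3 h4

/-- The sum of the conjugates of an operator by the permutations of the slots from a list. -/
def symm {n k : ℕ} : List (Fin k) → Op n k → Op n k
  | [], A => A
  -- The recursion uses the identity and the transpositions (p l) with p in L as coset
  -- representatives.
  | l :: L, A => symm L A + ∑ p ∈ L.toFinset, trans p l * symm L A * trans p l

theorem symm_add {n k : ℕ} (L : List (Fin k)) (A B : Op n k) :
    symm L (A + B) = symm L A + symm L B := by
  induction L with
  | nil => rfl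
  | cons l L ih =>
    simp only [symm, ih, mul_add, add_mul, Finset.sum_add_distrib]
    abel

theorem symm_rho_mul {n k : ℕ} (L : List (Fin k)) (p : Fin k) (hp : p ∉ L) (y : gl n)
    (A : Op n k) : symm L (rho p y * A) = rho p y * symm L A := by
  induction L with
  | nil => rfl
  | cons l L ih =>
    rw [List.mem_cons, not_or] at hp
    rw [symm, symm, ih hp.2, mul_add, Finset.mul_sum]
    refine congrArg _ (Finset.sum_congr rfl fun r hr => ?_)
    have h : p ≠ r := fun h => hp.2 (h ▸ List.mem_toFinset.1 hr)
    rw [← mul_assoc, trans_mul_rho_of_ne h hp.1, mul_assoc, mul_assoc, mul_assoc]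

theorem symm_of_commute {n k : ℕ} (L : List (Fin k)) (hL : L.Nodup) (A : Op n k)
    (hA : ∀ p r, p ≠ r → A * trans p r = trans p r * A) :
    symm L A = (L.length.factorial : ℂ) • A := by
  induction L with
  | nil => simp [symm]
  | cons l L ih =>
    rw [List.nodup_cons] at hL
    rw [symm, ih hL.2, Finset.sum_congr rfl (g := fun _ => (L.length.factorial : ℂ) • A)]
    · rw [Finset.sum_const, List.toFinset_card_of_nodup hL.2, List.length_cons,
        Nat.factorial_succ, ← Nat.cast_smul_eq_nsmul ℂ, smul_smul, ← add_smul]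
      congr 1
      push_cast
      ring
    · intro p hp
      have h : p ≠ l := fun h => hL.1 (h ▸ List.mem_toFinset.1 hp)
      rw [mul_smul_comm, smul_mul_assoc, ← hA p l h, mul_assoc, trans_mul_self h, mul_one]

theorem trans_conj_apply_one {n N k : ℕ} {p r : Fin k} (h : p ≠ r) (m : ℕ)
    {w : Module.End ℂ (Fam n k)} (hw : w ∈ insPow n N k m) (I : Finset (Fin k)) :
    trans p r * w 1 I = w 1 (I.map (Equiv.swap p r).toEmbedding) * trans p r := by
  induction m generalizing w I with
  | zero =>
    obtain ⟨c, rfl⟩ := Submodule.mem_one.1 hw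
    change trans p r * (c • 1) = (c • 1) * trans p r
    rw [mul_smul_comm, smul_mul_assoc, one_mul, mul_one]
  | succ m ih =>
    rw [insPow] at hw
    induction hw using Submodule.mul_induction_on' with
    | mem_mul_mem y hy w hw =>
      obtain ⟨y, -, rfl⟩ := hy
      rw [Module.End.mul_apply, ins_apply, ins_apply, Finset.mul_sum, Finset.sum_map,
        Finset.sum_mul]
      refine Finset.sum_congr rfl fun u _ => ?_
      have e : trans p r * rho u y = rho (Equiv.swap p r u) y * trans p r := by
        by_cases hp : u = p
        · rw [hp, Equiv.swap_apply_left, trans_mul_rho_left h]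
        by_cases hr : u = r
        · rw [hr, Equiv.swap_apply_right, trans_mul_rho_right]
        rw [Equiv.swap_apply_of_ne_of_ne hp hr, trans_mul_rho_of_ne hp hr]
      rw [← mul_assoc, e, mul_assoc, ih hw, mul_assoc, Finset.map_erase]
      rfl
    | add y z _ _ h1 h2 =>
      rw [LinearMap.add_apply, Pi.add_apply, Pi.add_apply, mul_add, add_mul, h1, h2]

/-- Conjugation by the coset representatives carries the factor y from slot l to each slot p and the
other factors to the remaining slots; the sum is an insertion of y. -/
theorem exists_symm_eq {n N k : ℕ} (L : List (Fin k)) (hL : L.Nodup) {A : Op n k}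
    (hA : A ∈ (L.map fun p => (core n N).map (rho p)).prod) :
    ∃ w ∈ insPow n N k L.length, symm L A = w 1 L.toFinset := by
  induction L generalizing A with
  | nil =>
    obtain ⟨c, rfl⟩ := Submodule.mem_one.1 hA
    exact ⟨algebraMap ℂ _ c, Submodule.mem_one.2 ⟨c, rfl⟩, Algebra.algebraMap_eq_smul_one c⟩
  | cons l L ih =>
    rw [List.nodup_cons] at hL
    rw [List.map_cons, List.prod_cons] at hA
    induction hA using Submodule.mul_induction_on' with
    | mem_mul_mem y hy B hB =>
      obtain ⟨y, hy, rfl⟩ := hy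
      obtain ⟨w, hw, e⟩ := ih hL.2 hB
      refine ⟨ins n k y * w, ?_, ?_⟩
      · rw [List.length_cons, insPow]
        exact Submodule.mul_mem_mul ⟨y, hy, rfl⟩ hw
      · have hl : l ∉ L.toFinset := fun h => hL.1 (List.mem_toFinset.1 h)
        rw [symm, symm_rho_mul L l hL.1, e, List.toFinset_cons, Module.End.mul_apply, ins_apply,
          Finset.sum_insert hl, Finset.erase_insert hl]
        refine congrArg _ (Finset.sum_congr rfl fun p hp => ?_)
        have h : p ≠ l := fun h => hl (h ▸ hp)
        rw [← mul_assoc, trans_mul_rho_right, mul_assoc, mul_assoc, ← mul_assoc (trans p l),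
          trans_conj_apply_one h _ hw, mul_assoc, trans_mul_self h, mul_one]
        -- What remains is that exchanging p and l turns the set of L into that of l :: L with p
        -- removed.
        refine congrArg _ (congrArg _ (Finset.ext fun u => ?_))
        rw [Finset.mem_map_equiv, Equiv.symm_swap, Finset.mem_erase, Finset.mem_insert]
        by_cases hp' : u = p
        · subst hp'
          simp [hl]
        by_cases hr : u = l
        · subst hr
          simp [hp, Ne.symm h]
        · rw [Equiv.swap_apply_of_ne_of_ne hp' hr]
          simp [hp', hr]
    | add y z _ _ h1 h2 =>
      obtain ⟨w, hw, e⟩ := h1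
      obtain ⟨w', hw', e'⟩ := h2
      exact ⟨w + w', add_mem hw hw', by rw [symm_add, e, e']; rfl⟩

/-- An operator commuting with the transpositions equals its symmetrization divided by k!, and
symmetrized products of elements of `core` are polynomials in the diagonal action. -/
theorem mem_diagAlg_of_mem_prod {n N k : ℕ} {A : Op n k}
    (hA : A ∈ ((List.finRange k).map fun p => (core n N).map (rho p)).prod)
    (hA' : ∀ p r, p ≠ r → A * trans p r = trans p r * A) : A ∈ diagAlg n N k := by
  obtain ⟨w, hw, e⟩ := exists_symm_eq _ (List.nodup_finRange k) hA
  have h := apply_one_mem_diagAlg _ hw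
  have e1 : (List.finRange k).toFinset = Finset.univ := by ext; simp
  rw [symm_of_commute _ (List.nodup_finRange k) A hA', e1] at e
  rw [← e] at h
  have h' := Subalgebra.smul_mem _ h (((List.finRange k).length.factorial : ℂ)⁻¹)
  rwa [smul_smul, inv_mul_cancel₀ (Nat.cast_ne_zero.2 (Nat.factorial_ne_zero _)),
    one_smul] at h'

/-! ### The Sergeev algebra -/

theorem isHom_Dp_mul_flp (n : ℕ) : IsHom 1 (Dp n 1 * flp n) := by
  have h := (isHom_Dp n 1).mul (isHom_flp n)
  rwa [zero_add] at h

/-- The operator `Π` in the slot `p`, with signs such that it commutes with the diagonal action of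
the matrices which commute with `Π`. -/
def flipOp {n k : ℕ} (p : Fin k) : Op n k := rho p (Dp n 1 * flp n) * parOp n k

theorem flp_mul_Dp (n : ℕ) : flp n * Dp n 1 = -(Dp n 1 * flp n) := by
  rw [(isHom_flp n).Dp_mul, mul_one, sgn_one, neg_smul, one_smul, neg_neg]

/-- The sign from exchanging the slots is cancelled by the sign from `parOp`; this is the reason for
the factor `parOp` in `flipOp`. -/
theorem flipOp_mul_rho_of_ne {n k : ℕ} {p r : Fin k} (h : r ≠ p) (x : gl n) :
    flipOp p * rho r x = rho r x * flipOp p := by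
  induction x using gl_induction with
  | hom a x hx =>
    rw [flipOp, mul_assoc, parOp_mul_rho r hx, mul_smul_comm, ← mul_assoc,
      rho_swap h.symm (isHom_Dp_mul_flp n) hx, smul_mul_assoc, smul_smul, one_mul, sgn_mul_self,
      one_smul, mul_assoc]
  | add x y h1 h2 => rw [map_add, mul_add, add_mul, h1, h2]

/-- The signs of D and of `parOp` cancel, leaving ordinary conjugation by Π. So commuting with
`flipOp` corresponds to the condition defining q_n. -/
theorem flipOp_conj_rho {n k : ℕ} (p : Fin k) (x : gl n) :
    flipOp p * rho p x * flipOp p = rho p (flp n * x * flp n) := by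
  induction x using gl_induction with
  | hom a x hx =>
    have h1 : Dp n 1 * flp n * (x * (Dp n 1 * flp n)) = -(sgn a • (flp n * x * flp n)) := by
      have h2 := hx.Dp_mul 1
      rw [one_mul] at h2
      have h3 : x * Dp n 1 = sgn a • (Dp n 1 * x) := by
        rw [h2, smul_smul, sgn_mul_self, one_smul]
      rw [← mul_assoc x, h3, smul_mul_assoc, mul_smul_comm, mul_assoc (Dp n 1), mul_assoc (Dp n 1),
        ← mul_assoc (flp n) (Dp n 1), flp_mul_Dp, neg_mul, mul_neg, mul_assoc (Dp n 1),
        ← mul_assoc (Dp n 1) (Dp n 1), Dp_mul_self, one_mul, smul_neg, mul_assoc (flp n)]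
    have h4 : parOp n k * rho p (x * (Dp n 1 * flp n)) = sgn (a + 1) •
        (rho p (x * (Dp n 1 * flp n)) * parOp n k) := parOp_mul_rho p (hx.mul (isHom_Dp_mul_flp n))
    calc flipOp p * rho p x * flipOp p =
        rho p (Dp n 1 * flp n) * (parOp n k * rho p (x * (Dp n 1 * flp n))) * parOp n k := by
          rw [rho_mul p x]
          simp only [flipOp, mul_assoc]
      _ = sgn (a + 1) • rho p (Dp n 1 * flp n * (x * (Dp n 1 * flp n))) := by
          rw [h4, mul_smul_comm, smul_mul_assoc, rho_mul p (Dp n 1 * flp n)]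
          simp only [mul_assoc, parOp_mul_self, mul_one]
      _ = _ := by
          rw [h1, map_neg, map_smul, sgn_add, sgn_one, mul_neg_one, neg_smul, smul_neg, neg_neg,
            smul_smul, sgn_mul_self, one_smul]
  | add x y h1 h2 => rw [map_add, mul_add, add_mul, h1, h2, mul_add, add_mul, map_add]

theorem flipOp_mul_self {n k : ℕ} (p : Fin k) : flipOp (n := n) p * flipOp p = 1 := by
  have h := flipOp_conj_rho p (1 : gl n)
  rwa [rho_one, mul_one, mul_one, flp_mul_self, rho_one] at h

theorem flipOp_conjTranspose {n k : ℕ} (p : Fin k) :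
    (flipOp (n := n) p).conjTranspose = flipOp p := by
  rw [flipOp, Matrix.conjTranspose_mul, parOp_conjTranspose, rho_conjTranspose,
    Matrix.conjTranspose_mul, flp_conjTranspose, Dp_conjTranspose, flp_mul_Dp, map_neg,
    mul_neg, parOp_mul_rho p (isHom_Dp_mul_flp n), sgn_one, neg_smul, one_smul, neg_neg]

/-- The generators of the Sergeev algebra: the permutations of the slots, the operators `Π` and
the even matrix units with indices of absolute value at most `N` in the slots. -/
inductive SergeevGen {n k : ℕ} (N : ℕ) : Op n k → Prop
  | trans (p r : Fin k) (h : p ≠ r) : SergeevGen N (trans p r)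
  | unit (p : Fin k) (i j : Idx n) (hi : i.abs ≤ N) (hj : j.abs ≤ N) (h : i.par = j.par) :
      SergeevGen N (rho p (Matrix.single i j 1))
  | flip (p : Fin k) : SergeevGen N (flipOp p)

theorem SergeevGen.conjTranspose {n k N : ℕ} {t : Op n k} (h : SergeevGen N t) :
    SergeevGen N t.conjTranspose := by
  cases h with
  | trans p r h => rw [trans_conjTranspose h]; exact .trans p r h
  | unit p i j hi hj h =>
    rw [rho_conjTranspose, Matrix.conjTranspose_single, star_one]
    exact .unit p j i hj hi h.symm
  | flip p => rw [flipOp_conjTranspose]; exact .flip p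

/-- The algebra generated by the permutations of the slots, the operators `Π` and
the even matrix units with indices of absolute value at most `N` in the slots. -/
def sergeevAlg (n N k : ℕ) : Subalgebra ℂ (Op n k) := Algebra.adjoin ℂ {t | SergeevGen N t}

theorem conjTranspose_mem_sergeevAlg {n N k : ℕ} {t : Op n k} (h : t ∈ sergeevAlg n N k) :
    t.conjTranspose ∈ sergeevAlg n N k := by
  induction h using Algebra.adjoin_induction with
  | mem t h => exact Algebra.subset_adjoin (SergeevGen.conjTranspose h)
  | algebraMap c =>
    rw [Algebra.algebraMap_eq_smul_one, Matrix.conjTranspose_smul, Matrix.conjTranspose_one]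
    exact Subalgebra.smul_mem _ (one_mem _) _
  | add a b _ _ h1 h2 => rw [Matrix.conjTranspose_add]; exact add_mem h1 h2
  | mul a b _ _ h1 h2 => rw [Matrix.conjTranspose_mul]; exact mul_mem h2 h1

/-! ### Averaging -/

/-- The projection to the span of the basis vectors with indices of absolute value greater
than `N`. -/
def bulk (n N : ℕ) : gl n := Matrix.diagonal fun i => if i.abs ≤ N then 0 else 1

/-- The index of absolute value `1` with the same sign. -/
def Idx.base {n : ℕ} (i : Idx n) : Idx n := (⟨0, i.1.pos⟩, i.2)

theorem Idx.base_abs {n N : ℕ} {i : Idx n} (h : i.abs ≤ N) : i.base.abs ≤ N :=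
  le_trans (Nat.succ_le_succ (Nat.zero_le _)) h

/-- The set of the indices of absolute value at most `N`. -/
def small (n N : ℕ) : Finset (Idx n) := Finset.univ.filter fun i => i.abs ≤ N

theorem mem_small {n N : ℕ} {i : Idx n} : i ∈ small n N ↔ i.abs ≤ N := by simp [small]

theorem bulk_add_sum (n N : ℕ) :
    bulk n N + ∑ i ∈ small n N, (Matrix.single i i 1 : gl n) = 1 := by
  ext i j
  rw [Matrix.add_apply, Matrix.sum_apply]
  by_cases h : i = j
  · subst h
    rw [bulk, Matrix.diagonal_apply_eq, Matrix.one_apply_eq]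
    by_cases hi : i.abs ≤ N
    · rw [if_pos hi, Finset.sum_eq_single i, Matrix.single_apply_same, zero_add]
      · intro k _ hk
        exact Matrix.single_apply_of_ne _ _ _ _ _ fun e => hk e.1
      · exact fun h => absurd (mem_small.2 hi) h
    · rw [if_neg hi, Finset.sum_eq_zero, add_zero]
      intro k hk
      refine Matrix.single_apply_of_ne _ _ _ _ _ fun e => hi ?_
      rw [← e.1]
      exact mem_small.1 hk
  · rw [bulk, Matrix.diagonal_apply_ne _ h, Matrix.one_apply_ne h, zero_add]
    refine Finset.sum_eq_zero fun k _ => Matrix.single_apply_of_ne _ _ _ _ _ fun e => h ?_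
    rw [← e.1, ← e.2]

theorem bulk_mul_self (n N : ℕ) : bulk n N * bulk n N = bulk n N := by
  rw [bulk, Matrix.diagonal_mul_diagonal]
  congr 1
  funext i
  split_ifs <;> simp

theorem isHom_bulk (n N : ℕ) : IsHom 0 (bulk n N) := by
  intro i j h
  by_cases e : i = j
  · rw [e, zmod_two_add_self]
  · exact absurd (Matrix.diagonal_apply_ne _ e) h

theorem isHom_single_base {n : ℕ} (i : Idx n) : IsHom 0 (Matrix.single i i.base (1 : ℂ)) := by
  have h := isHom_single i i.base 1
  have e : i.base.par = i.par := rfl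
  rwa [e, zmod_two_add_self] at h

theorem isHom_base_single {n : ℕ} (i : Idx n) : IsHom 0 (Matrix.single i.base i (1 : ℂ)) := by
  have h := isHom_single i.base i 1
  have e : i.base.par = i.par := rfl
  rwa [e, zmod_two_add_self] at h

/-- The projection to the operators which commute with the even matrix units with indices of
absolute value at most `N` in the slot `p`. -/
def avgUnit {n k : ℕ} (N : ℕ) (p : Fin k) : Op n k →ₗ[ℂ] Op n k :=
  -- The sum over i is the usual averaging over matrix units with a fixed base index. There is one
  -- base index for each parity, since only even units may be used.
  LinearMap.mulLeftRight ℂ (rho p (bulk n N), rho p (bulk n N)) +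
    ∑ i ∈ small n N, LinearMap.mulLeftRight ℂ
      (rho p (Matrix.single i i.base 1), rho p (Matrix.single i.base i 1))

/-- The projection to the operators which commute with `Π` and the even matrix units with indices
of absolute value at most `N` in the slot `p`. -/
def avg {n k : ℕ} (N : ℕ) (p : Fin k) : Op n k →ₗ[ℂ] Op n k :=
  (2⁻¹ : ℂ) • (avgUnit N p + LinearMap.mulLeftRight ℂ (flipOp p, flipOp p) ∘ₗ avgUnit N p)

theorem avgUnit_apply {n k N : ℕ} (p : Fin k) (A : Op n k) :
    avgUnit N p A = rho p (bulk n N) * A * rho p (bulk n N) +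
      ∑ i ∈ small n N, rho p (Matrix.single i i.base 1) * A * rho p (Matrix.single i.base i 1) := by
  rw [avgUnit, LinearMap.add_apply, LinearMap.sum_apply]
  simp only [LinearMap.mulLeftRight_apply]

theorem avg_apply {n k N : ℕ} (p : Fin k) (A : Op n k) :
    avg N p A = (2⁻¹ : ℂ) • (avgUnit N p A + flipOp p * avgUnit N p A * flipOp p) := by
  rw [avg, LinearMap.smul_apply, LinearMap.add_apply, LinearMap.comp_apply,
    LinearMap.mulLeftRight_apply]

/-- An operator commuting with the generators can be pulled out of every term; the remaining units
add up to the identity by `bulk_add_sum`. -/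
theorem avg_of_commute {n k N : ℕ} {A : Op n k} (hA : ∀ t, SergeevGen N t → A * t = t * A)
    (p : Fin k) : avg N p A = A := by
  have h0 : bulk n N = 1 - ∑ i ∈ small n N, (Matrix.single i i 1 : gl n) :=
    eq_sub_of_add_eq (bulk_add_sum n N)
  have h1 : A * rho p (bulk n N) = rho p (bulk n N) * A := by
    rw [h0, map_sub, rho_one, map_sum, mul_sub, sub_mul, mul_one, one_mul, Finset.mul_sum,
      Finset.sum_mul]
    refine congrArg _ (Finset.sum_congr rfl fun i hi => ?_)
    exact hA _ (.unit p i i (mem_small.1 hi) (mem_small.1 hi) rfl)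
  have h2 : avgUnit N p A = A := by
    rw [avgUnit_apply, ← h1, mul_assoc, ← rho_mul, bulk_mul_self]
    have : ∀ i ∈ small n N, rho p (Matrix.single i i.base 1) * A *
        rho p (Matrix.single i.base i 1) = A * rho p (Matrix.single i i 1) := by
      intro i hi
      rw [← hA _ (.unit p i i.base (mem_small.1 hi) (Idx.base_abs (mem_small.1 hi)) rfl),
        mul_assoc, ← rho_mul, Matrix.single_mul_single_same, mul_one]
    rw [Finset.sum_congr rfl this, ← Finset.mul_sum, ← mul_add, ← map_sum, ← map_add,
      bulk_add_sum, rho_one, mul_one]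
  rw [avg_apply, h2, ← hA _ (.flip p), mul_assoc, flipOp_mul_self, mul_one, ← two_smul ℂ,
    smul_smul, inv_mul_cancel₀ two_ne_zero, one_smul]

/-- The operators which commute with `Π` and with the even operators in the slot `p`. -/
def slotCentralizer (n : ℕ) {k : ℕ} (p : Fin k) : Subalgebra ℂ (Op n k) :=
  Subalgebra.centralizer ℂ ({t | ∃ x, IsHom 0 x ∧ t = rho p x} ∪ {flipOp p})

theorem rho_mul_of_mem_slotCentralizer {n k : ℕ} {p : Fin k} {A : Op n k}
    (hA : A ∈ slotCentralizer n p) {x : gl n} (hx : IsHom 0 x) : rho p x * A = A * rho p x :=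
  Subalgebra.mem_centralizer_iff ℂ |>.1 hA _ (Or.inl ⟨x, hx, rfl⟩)

theorem flipOp_mul_of_mem_slotCentralizer {n k : ℕ} {p : Fin k} {A : Op n k}
    (hA : A ∈ slotCentralizer n p) : flipOp p * A = A * flipOp p :=
  Subalgebra.mem_centralizer_iff ℂ |>.1 hA _ (Or.inr rfl)

/-- Operators in another slot, even odd ones, commute with even operators in slot p and with `flipOp
p`. Averaging in one slot therefore leaves the other slots untouched. -/
theorem rho_mem_slotCentralizer {n k : ℕ} {p r : Fin k} (h : r ≠ p) (y : gl n) :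
    rho r y ∈ slotCentralizer n p := by
  rw [slotCentralizer, Subalgebra.mem_centralizer_iff]
  rintro t (⟨x, hx, rfl⟩ | ht)
  · induction y using gl_induction with
    | hom b y hy => rw [rho_swap h.symm hx hy, zero_mul, sgn_zero, one_smul]
    | add y z h1 h2 => rw [map_add, mul_add, add_mul, h1, h2]
  · rw [Set.mem_singleton_iff.1 ht]
    exact flipOp_mul_rho_of_ne h y

theorem prod_le_slotCentralizer {n k : ℕ} {p : Fin k} (W : Submodule ℂ (gl n)) (L : List (Fin k))
    (h : p ∉ L) : (L.map fun r => W.map (rho r)).prod ≤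
      Subalgebra.toSubmodule (slotCentralizer n p) := by
  induction L with
  | nil =>
    rw [List.map_nil, List.prod_nil, Submodule.one_le]
    exact one_mem (slotCentralizer n p)
  | cons r L ih =>
    rw [List.mem_cons, not_or] at h
    rw [List.map_cons, List.prod_cons, Submodule.mul_le]
    rintro _ ⟨y, -, rfl⟩ B hB
    exact mul_mem (S := Subalgebra ℂ (Op n k)) (rho_mem_slotCentralizer (Ne.symm h.1) y) (ih h.2 hB)

theorem avg_mul_mul {n k N : ℕ} {p : Fin k} {A₁ A₂ : Op n k} (h₁ : A₁ ∈ slotCentralizer n p)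
    (h₂ : A₂ ∈ slotCentralizer n p) (B : Op n k) :
    avg N p (A₁ * (B * A₂)) = A₁ * (avg N p B * A₂) := by
  have key : ∀ {s t : Op n k}, s * A₁ = A₁ * s → t * A₂ = A₂ * t → ∀ C,
      s * (A₁ * (C * A₂)) * t = A₁ * (s * C * t * A₂) := by
    intro s t h h' C
    rw [← mul_assoc s, h, mul_assoc, mul_assoc, mul_assoc, ← h']
    simp only [mul_assoc]
  have h3 : ∀ C, avgUnit N p (A₁ * (C * A₂)) = A₁ * (avgUnit N p C * A₂) := by
    intro C
    rw [avgUnit_apply, avgUnit_apply, add_mul, mul_add, Finset.sum_mul, Finset.mul_sum,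
      key (rho_mul_of_mem_slotCentralizer h₁ (isHom_bulk n N))
        (rho_mul_of_mem_slotCentralizer h₂ (isHom_bulk n N))]
    refine congrArg _ (Finset.sum_congr rfl fun i _ => ?_)
    exact key (rho_mul_of_mem_slotCentralizer h₁ (isHom_single_base i))
      (rho_mul_of_mem_slotCentralizer h₂ (isHom_base_single i)) C
  rw [avg_apply, avg_apply, h3, key (flipOp_mul_of_mem_slotCentralizer h₁)
    (flipOp_mul_of_mem_slotCentralizer h₂), smul_mul_assoc, mul_smul_comm, add_mul, mul_add]

/-- Averaging over units keeps the block of large indices and leaves only y_{1,1} and y_{-1,-1}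
along the small diagonal; averaging over Π makes these two equal and the matrix commute with Π. -/
theorem avg_rho_mem {n k : ℕ} (N : ℕ) (p : Fin k) (y : gl n) :
    avg N p (rho p y) ∈ (core n N).map (rho p) := by
  have h1 : ∀ i, Matrix.single i i.base 1 * y * Matrix.single i.base i 1 =
      y i.base i.base • (Matrix.single i i 1 : gl n) := by
    intro i
    rw [Matrix.single_mul_mul_single, one_mul, mul_one, ← smul_single_one]
  set z : gl n := bulk n N * y * bulk n N + ∑ i ∈ small n N, y i.base i.base •
    Matrix.single i i 1 with hz
  have h2 : avgUnit N p (rho p y) = rho p z := by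
    rw [avgUnit_apply, hz, map_add, map_sum, rho_mul, rho_mul]
    refine congrArg _ (Finset.sum_congr rfl fun i _ => ?_)
    rw [← h1, rho_mul, rho_mul]
  refine ⟨(2⁻¹ : ℂ) • (z + flp n * z * flp n), Submodule.smul_mem _ _ ⟨?_, ?_⟩, ?_⟩
  · clear_value z
    rw [add_mul, mul_add, mul_assoc, flp_mul_self, mul_one, ← mul_assoc, ← mul_assoc,
      flp_mul_self, one_mul, add_comm]
  · have h3 : ∀ i j, i.abs ≤ N ∨ j.abs ≤ N →
        z i j = if i = j then y i.base i.base else 0 := by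
      intro i j h
      have e1 : (bulk n N * y * bulk n N) i j = 0 := by
        rw [bulk, Matrix.mul_diagonal, Matrix.diagonal_mul]
        rcases h with h | h <;> simp [h]
      rw [hz, Matrix.add_apply, e1, zero_add, Matrix.sum_apply]
      by_cases e : i = j
      · subst e
        have hi : i.abs ≤ N := by rcases h with h | h <;> exact h
        rw [if_pos rfl, Finset.sum_eq_single i]
        · simp
        · intro k _ hk
          rw [Matrix.smul_apply, Matrix.single_apply_of_ne _ _ _ _ _ fun e => hk e.1, smul_zero]
        · exact fun h => absurd (mem_small.2 hi) h
      · rw [if_neg e]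
        refine Finset.sum_eq_zero fun k _ => ?_
        rw [Matrix.smul_apply, Matrix.single_apply_of_ne _ _ _ _ _ fun e' => e (e'.1.symm.trans e'.2),
          smul_zero]
    have h4 : ∀ i j, i.abs ≤ N ∨ j.abs ≤ N → (z + flp n * z * flp n) i j =
        if i = j then y i.base i.base + y i.opp.base i.opp.base else 0 := by
      intro i j h
      rw [Matrix.add_apply, mul_flp, flp_mul, h3 i j h, h3 i.opp j.opp h]
      simp only [Idx.opp_injective.eq_iff]
      split_ifs
      · rfl
      · exact add_zero _
    by_cases hn : 0 < n
    -- The scalar is y_{1,1} + y_{-1,-1}, before the factor 1/2; for an index of either sign the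
    -- same two terms occur.
    · refine ⟨y (⟨0, hn⟩, 0) (⟨0, hn⟩, 0) + y (⟨0, hn⟩, 1) (⟨0, hn⟩, 1), fun i j h => ?_⟩
      rw [h4 i j h, Matrix.one_apply]
      split_ifs
      · rw [mul_one]
        rcases i with ⟨a, e⟩
        have e2 : (1 : ZMod 2) + 1 = 0 := by decide
        rcases zmod_two_cases e with rfl | rfl
        · simp [Idx.base, Idx.opp]
        · simp only [Idx.base, Idx.opp, e2]
          exact add_comm _ _
      · rw [mul_zero]
    · exact ⟨0, fun i => absurd i.1.pos hn⟩
  · rw [avg_apply, h2, flipOp_conj_rho, map_smul, map_add]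

theorem mem_mul_mul_of_commute {n k N : ℕ} {A : Op n k}
    (hA : ∀ t, SergeevGen N t → A * t = t * A) {p : Fin k} {M₁ M₂ : Submodule ℂ (Op n k)}
    (h₁ : M₁ ≤ Subalgebra.toSubmodule (slotCentralizer n p))
    (h₂ : M₂ ≤ Subalgebra.toSubmodule (slotCentralizer n p))
    (h : A ∈ M₁ * ((⊤ : Submodule ℂ (gl n)).map (rho p) * M₂)) :
    A ∈ M₁ * ((core n N).map (rho p) * M₂) := by
  rw [← avg_of_commute hA p]
  clear hA
  induction h using Submodule.mul_induction_on' with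
  | mem_mul_mem A₁ hA₁ B hB =>
    induction hB using Submodule.mul_induction_on' with
    | mem_mul_mem y hy A₂ hA₂ =>
      obtain ⟨y, -, rfl⟩ := hy
      rw [avg_mul_mul (h₁ hA₁) (h₂ hA₂)]
      exact Submodule.mul_mem_mul hA₁ (Submodule.mul_mem_mul (avg_rho_mem N p y) hA₂)
    | add B C _ _ h1 h2 => rw [mul_add, map_add]; exact add_mem h1 h2
  | add B C _ _ h1 h2 => rw [map_add]; exact add_mem h1 h2

/-- The slots are averaged one at a time: those in L₁ already carry elements of `core`, those in L₂
are still arbitrary. -/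
theorem mem_prod_of_commute {n k N : ℕ} {A : Op n k}
    (hA : ∀ t, SergeevGen N t → A * t = t * A) (L₂ L₁ : List (Fin k)) (hL : (L₁ ++ L₂).Nodup)
    (h : A ∈ (L₁.map fun p => (core n N).map (rho p)).prod *
      (L₂.map fun p => (⊤ : Submodule ℂ (gl n)).map (rho p)).prod) :
    A ∈ ((L₁ ++ L₂).map fun p => (core n N).map (rho p)).prod := by
  induction L₂ generalizing L₁ with
  | nil => simpa using h
  | cons p L₂ ih =>
    have h1 : p ∉ L₁ := fun h => List.disjoint_of_nodup_append hL h List.mem_cons_self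
    have h2 : p ∉ L₂ := (List.nodup_cons.1 (List.nodup_append.1 hL).2.1).1
    have e : L₁ ++ p :: L₂ = (L₁ ++ [p]) ++ L₂ := by simp
    rw [e] at hL ⊢
    refine ih _ hL ?_
    rw [List.map_cons, List.prod_cons] at h
    rw [List.map_append, List.prod_append, List.map_singleton, List.prod_singleton, mul_assoc]
    exact mem_mul_mul_of_commute hA (prod_le_slotCentralizer _ _ h1)
      (prod_le_slotCentralizer _ _ h2) h

theorem mem_prod_top {n k : ℕ} (A : Op n k) :
    A ∈ ((List.finRange k).map fun p => (⊤ : Submodule ℂ (gl n)).map (rho p)).prod := by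
  rw [Matrix.matrix_eq_sum_single A]
  refine Submodule.sum_mem _ fun I _ => Submodule.sum_mem _ fun J _ => ?_
  have h : Matrix.single I J (A I J) =
      (A I J * (unitSign I J)⁻¹) • (unitSign I J • Matrix.single I J (1 : ℂ)) := by
    rw [smul_smul, inv_mul_cancel_right₀ (unitSign_ne_zero I J)]
    simp
  rw [h, ← prod_rho_single]
  refine Submodule.smul_mem _ _ ?_
  generalize List.finRange k = L
  induction L with
  | nil => exact Submodule.one_le.1 le_rfl
  | cons p L ih =>
    rw [List.map_cons, List.map_cons, List.prod_cons, List.prod_cons]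
    exact Submodule.mul_mem_mul ⟨_, Submodule.mem_top, rfl⟩ ih

theorem mem_diagAlg_of_commute {n k N : ℕ} {A : Op n k}
    (hA : ∀ t, SergeevGen N t → A * t = t * A) : A ∈ diagAlg n N k := by
  refine mem_diagAlg_of_mem_prod ?_ fun p r h => hA _ (.trans p r h)
  refine mem_prod_of_commute hA (List.finRange k) [] (List.nodup_finRange k) ?_
  rw [List.map_nil, List.prod_nil, one_mul]
  exact mem_prod_top A

/-- The operators which commute with the diagonal action of `core n N` belong to the Sergeev
algebra. -/
theorem mem_sergeevAlg_of_commute {n k N : ℕ} {T : Op n k}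
    (hT : ∀ x ∈ core n N, diag n k x * T = T * diag n k x) : T ∈ sergeevAlg n N k := by
  -- By the bicommutant theorem T has only to commute with the commutant of the Sergeev algebra,
  -- which lies in `diagAlg`.
  refine mem_of_commute_commutant _ (fun X hX => conjTranspose_mem_sergeevAlg hX) T
    fun A hA => ?_
  have h : A ∈ diagAlg n N k :=
    mem_diagAlg_of_commute fun t ht => hA t (Algebra.subset_adjoin ht)
  clear hA
  induction h using Algebra.adjoin_induction with
  | mem A h =>
    obtain ⟨x, hx, rfl⟩ := h
    exact hT x hx
  | algebraMap c => exact Algebra.commutes c T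
  | add A B _ _ h1 h2 => rw [add_mul, mul_add, h1, h2]
  | mul A B _ _ h1 h2 => rw [mul_assoc, h2, ← mul_assoc, h1, mul_assoc]

/-! ### The elements of the Sergeev algebra -/

/-- Closure of the letters under products, up to scalars, keeps one letter per slot in the normal
forms. -/
theorem Letter.exists_sup_mul {n N : ℕ} (y z : Letter n N) :
    y.sup * z.sup = 0 ∨
      ∃ (w : Letter n N) (c : ℂ), w.deg = y.deg + z.deg ∧ y.sup * z.sup = c • w.sup := by
  have h : y.mat * z.mat = 0 ∨ ∃ w : Letter n N, w.deg = y.deg + z.deg ∧ y.mat * z.mat = w.mat := by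
    have e : ∀ a b : ZMod 2, a + 1 + b = 1 + (a + b) ∧ a + (b + 1) = a + b + 1 := by decide
    cases y with
    | one => exact Or.inr ⟨z, (zero_add _).symm, one_mul _⟩
    | flip =>
      cases z with
      | one => exact Or.inr ⟨flip, (add_zero _).symm, mul_one _⟩
      | flip => exact Or.inr ⟨one, (zmod_two_add_self 1).symm, flp_mul_self n⟩
      | unit i j hi hj =>
        exact Or.inr ⟨unit i.opp j hi hj, (e i.par j.par).1, flp_mul_single i j 1⟩
    | unit i j hi hj =>
      cases z with
      | one => exact Or.inr ⟨unit i j hi hj, (add_zero _).symm, mul_one _⟩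
      | flip => exact Or.inr ⟨unit i j.opp hi hj, (e i.par j.par).2, single_mul_flp i j 1⟩
      | unit k l hk hl =>
        by_cases h : j = k
        · subst h
          refine Or.inr ⟨unit i l hi hl, ?_, ?_⟩
          · change i.par + l.par = i.par + j.par + (j.par + l.par)
            rw [add_assoc, ← add_assoc j.par, zmod_two_add_self, zero_add]
          · exact (Matrix.single_mul_single_same _ _ _ _ _).trans (by rw [mul_one]; rfl)
        · exact Or.inl (Matrix.single_mul_single_of_ne _ _ _ _ h _)
  have e : y.sup * z.sup = sgn (z.deg * y.deg) • (Dp n (y.deg + z.deg) * (y.mat * z.mat)) := by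
    have h1 : y.mat * Dp n z.deg = sgn (z.deg * y.deg) • (Dp n z.deg * y.mat) := by
      rw [y.isHom.Dp_mul, smul_smul, sgn_mul_self, one_smul]
    rw [sup, sup, mul_assoc, ← mul_assoc y.mat, h1, smul_mul_assoc, mul_smul_comm, ← Dp_mul_Dp]
    simp only [mul_assoc]
  rcases h with h | ⟨w, hw, h⟩
  · left
    rw [e, h, mul_zero, smul_zero]
  · right
    exact ⟨w, _, hw, by rw [e, h, sup, hw]⟩

/-- The span of the products of transpositions and letters of the given degree. -/
def sergeevSpan {n k : ℕ} (N : ℕ) (L : List (Fin k)) (d : ZMod 2) : Submodule ℂ (Op n k) :=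
  Submodule.span ℂ {t | Sergeev N L d t}

/-- The span of the products of a letter in the slot `l` and of the products of transpositions
and letters in further slots. -/
def letterSpan {n k : ℕ} (N : ℕ) (l : Fin k) (L : List (Fin k)) (d : ZMod 2) :
    Submodule ℂ (Op n k) :=
  Submodule.span ℂ {t | ∃ (y : Letter n N) (e : ZMod 2) (u : Op n k), Sergeev N L e u ∧
    d = y.deg + e ∧ t = rho l y.sup * u}

/-! ### Left multiplication on the span of the normal forms. -/

section Span

variable {n k N : ℕ} {l : Fin k} {L : List (Fin k)} {d : ZMod 2}

theorem rho_mul_mem_letterSpan (l : Fin k) (y : Letter n N) {t : Op n k}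
    (ht : t ∈ sergeevSpan N L d) : rho l y.sup * t ∈ letterSpan N l L (y.deg + d) := by
  induction ht using Submodule.span_induction with
  | mem t h => exact Submodule.subset_span ⟨y, d, t, h, rfl, rfl⟩
  | zero => rw [mul_zero]; exact Submodule.zero_mem _
  | add a b _ _ h1 h2 => rw [mul_add]; exact Submodule.add_mem _ h1 h2
  | smul c a _ h => rw [mul_smul_comm]; exact Submodule.smul_mem _ _ h

theorem letterSpan_le : letterSpan (n := n) N l L d ≤ sergeevSpan N (l :: L) d := by
  refine Submodule.span_le.2 ?_
  rintro _ ⟨y, e, u, hu, rfl, rfl⟩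
  exact Submodule.subset_span (.self l y hu)

theorem trans_mul_mem_sergeevSpan {q : Fin k} (hq : q ∈ L) {t : Op n k}
    (ht : t ∈ letterSpan N l L d) : trans q l * t ∈ sergeevSpan N (l :: L) d := by
  induction ht using Submodule.span_induction with
  | mem t h =>
    obtain ⟨y, e, u, hu, rfl, rfl⟩ := h
    exact Submodule.subset_span (.swap l q hq y hu)
  | zero => rw [mul_zero]; exact Submodule.zero_mem _
  | add a b _ _ h1 h2 => rw [mul_add]; exact Submodule.add_mem _ h1 h2
  | smul c a _ h => rw [mul_smul_comm]; exact Submodule.smul_mem _ _ h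

theorem rho_mul_rho_mul_mem {y z : Letter n N} {a : Fin k} {t : Op n k}
    (ha : a ∈ l :: L) (ht : Sergeev N L d t)
    (ih : a ∈ L → rho a y.sup * t ∈ sergeevSpan N L (y.deg + d)) :
    rho a y.sup * (rho l z.sup * t) ∈ letterSpan N l L (y.deg + (z.deg + d)) := by
  by_cases h : a = l
  · subst h
    rw [← mul_assoc, ← rho_mul]
    rcases y.exists_sup_mul z with h | ⟨w, c, hw, h⟩
    · rw [h, map_zero, zero_mul]
      exact Submodule.zero_mem _
    · rw [h, map_smul, smul_mul_assoc, ← add_assoc, ← hw]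
      exact Submodule.smul_mem _ _ (rho_mul_mem_letterSpan _ _ (Submodule.subset_span ht))
  · rw [← mul_assoc, rho_swap h y.isHom_sup z.isHom_sup, smul_mul_assoc, mul_assoc,
      add_left_comm]
    exact Submodule.smul_mem _ _ (rho_mul_mem_letterSpan _ _
      (ih ((List.mem_cons.1 ha).resolve_left h)))

/-- A letter passes the transposition (q l), changing its slot accordingly. It then merges with the
letter in slot l or passes it and goes on to the shorter normal form. -/
theorem Sergeev.rho_mul_mem {t : Op n k} (ht : Sergeev N L d t) (hL : L.Nodup)
    (y : Letter n N) {a : Fin k} (ha : a ∈ L) :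
    rho a y.sup * t ∈ sergeevSpan N L (y.deg + d) := by
  induction ht generalizing a with
  | nil => exact absurd ha List.not_mem_nil
  | @self L d t l z ht ih =>
    exact letterSpan_le (rho_mul_rho_mul_mem ha ht (ih (List.nodup_cons.1 hL).2))
  | @swap L d t l q hq z ht ih =>
    have hql : q ≠ l := fun h => (List.nodup_cons.1 hL).1 (h ▸ hq)
    have key : ∀ b ∈ l :: L, rho a y.sup * trans q l = trans q l * rho b y.sup →
        rho a y.sup * (trans q l * (rho l z.sup * t)) ∈
          sergeevSpan N (l :: L) (y.deg + (z.deg + d)) := by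
      intro b hb h
      rw [← mul_assoc, h, mul_assoc]
      exact trans_mul_mem_sergeevSpan hq
        (rho_mul_rho_mul_mem hb ht (ih (List.nodup_cons.1 hL).2))
    by_cases h1 : a = q
    · exact key l List.mem_cons_self (by rw [h1, trans_mul_rho_right])
    by_cases h2 : a = l
    · exact key q (List.mem_cons_of_mem _ hq) (by rw [h2, trans_mul_rho_left hql])
    · exact key a ha (by rw [trans_mul_rho_of_ne h1 h2])

theorem Sergeev.trans_mul_mem {t : Op n k} (ht : Sergeev N L d t) (hL : L.Nodup)
    {a b : Fin k} (ha : a ∈ L) (hb : b ∈ L) (hab : a ≠ b) :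
    trans a b * t ∈ sergeevSpan N L d := by
  induction ht generalizing a b with
  | nil => exact absurd ha List.not_mem_nil
  | @self L d t l z ht ih =>
    have hl := List.nodup_cons.1 hL
    by_cases h1 : b = l
    · subst h1
      exact Submodule.subset_span (.swap b a ((List.mem_cons.1 ha).resolve_left hab) z ht)
    by_cases h2 : a = l
    · subst h2
      rw [trans_comm hab]
      exact Submodule.subset_span (.swap a b ((List.mem_cons.1 hb).resolve_left h1) z ht)
    · rw [← mul_assoc, trans_mul_rho_of_ne (Ne.symm h2) (Ne.symm h1), mul_assoc]
      exact letterSpan_le (rho_mul_mem_letterSpan _ _ (ih hl.2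
        ((List.mem_cons.1 ha).resolve_left h2) ((List.mem_cons.1 hb).resolve_left h1) hab))
  | @swap L d t l q hq z ht ih =>
    have hl := List.nodup_cons.1 hL
    have hql : q ≠ l := fun h => hl.1 (h ▸ hq)
    -- Every case but the cancellation in `key3` is a rewriting (a b)(q l) = (q' l)(a' b') with a',
    -- b' in L: a change of coset representative followed by a transposition of L, to which the
    -- induction applies.
    have key : ∀ {q' a' b' : Fin k}, q' ∈ L → a' ∈ L → b' ∈ L → a' ≠ b' →
        trans (n := n) a b * trans q l = trans q' l * trans a' b' →
        trans a b * (trans q l * (rho l z.sup * t)) ∈ sergeevSpan N (l :: L) (z.deg + d) := by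
      intro q' a' b' h1 h2 h3 h4 h
      have h5 : l ≠ a' := fun h => hl.1 (h ▸ h2)
      have h6 : l ≠ b' := fun h => hl.1 (h ▸ h3)
      rw [← mul_assoc, h, mul_assoc, ← mul_assoc (trans a' b'), trans_mul_rho_of_ne h5 h6,
        mul_assoc]
      exact trans_mul_mem_sergeevSpan h1 (rho_mul_mem_letterSpan _ _ (ih hl.2 h2 h3 h4))
    have key2 : ∀ {a : Fin k}, a ∈ L → a ≠ q → trans (n := n) a l * trans q l =
        trans q l * trans q a := by
      intro a ha haq
      have h5 : a ≠ l := fun h => hl.1 (h ▸ ha)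
      rw [trans_mul_trans haq h5, trans_comm h5]
    have key3 : trans q l * (trans q l * (rho l z.sup * t)) ∈
        sergeevSpan N (l :: L) (z.deg + d) := by
      rw [← mul_assoc, trans_mul_self hql, one_mul]
      exact Submodule.subset_span (.self l z ht)
    by_cases h1 : b = l
    · subst h1
      have ha' := (List.mem_cons.1 ha).resolve_left hab
      by_cases h : a = q
      · rw [h]
        exact key3
      · exact key hq hq ha' (Ne.symm h) (key2 ha' h)
    by_cases h2 : a = l
    · subst h2
      have hb' := (List.mem_cons.1 hb).resolve_left h1
      by_cases h : b = q
      · rw [trans_comm hab, h]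
        exact key3
      · exact key hq hq hb' (Ne.symm h) (by rw [trans_comm hab]; exact key2 hb' h)
    have ha' := (List.mem_cons.1 ha).resolve_left h2
    have hb' := (List.mem_cons.1 hb).resolve_left h1
    by_cases h3 : a = q
    · refine key hb' ha' hb' hab ?_
      subst h3
      exact trans_mul_trans (Ne.symm h2) (Ne.symm h1)
    by_cases h4 : b = q
    · refine key ha' ha' hb' hab ?_
      subst h4
      rw [trans_comm hab, trans_mul_trans (Ne.symm h1) (Ne.symm h2)]
    · exact key hq ha' hb' hab
        (trans_mul_trans_of_ne (Ne.symm h3) (Ne.symm h4) (Ne.symm h2) (Ne.symm h1))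

theorem rho_mul_mem_sergeevSpan (hL : L.Nodup) (y : Letter n N) {a : Fin k} (ha : a ∈ L)
    {t : Op n k} (ht : t ∈ sergeevSpan N L d) :
    rho a y.sup * t ∈ sergeevSpan N L (y.deg + d) := by
  induction ht using Submodule.span_induction with
  | mem t h => exact Sergeev.rho_mul_mem h hL y ha
  | zero => rw [mul_zero]; exact Submodule.zero_mem _
  | add a b _ _ h1 h2 => rw [mul_add]; exact Submodule.add_mem _ h1 h2
  | smul c a _ h => rw [mul_smul_comm]; exact Submodule.smul_mem _ _ h

theorem trans_mul_mem_sergeevSpan_self (hL : L.Nodup) {a b : Fin k} (ha : a ∈ L) (hb : b ∈ L)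
    (hab : a ≠ b) {t : Op n k} (ht : t ∈ sergeevSpan N L d) :
    trans a b * t ∈ sergeevSpan N L d := by
  induction ht using Submodule.span_induction with
  | mem t h => exact Sergeev.trans_mul_mem h hL ha hb hab
  | zero => rw [mul_zero]; exact Submodule.zero_mem _
  | add a b _ _ h1 h2 => rw [mul_add]; exact Submodule.add_mem _ h1 h2
  | smul c a _ h => rw [mul_smul_comm]; exact Submodule.smul_mem _ _ h

theorem one_mem_sergeevSpan (L : List (Fin k)) : (1 : Op n k) ∈ sergeevSpan N L 0 := by
  induction L with
  | nil => exact Submodule.subset_span .nil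
  | cons l L ih =>
    have h := letterSpan_le (rho_mul_mem_letterSpan l (Letter.one : Letter n N) ih)
    have e : (Letter.one : Letter n N).sup = 1 := by
      rw [Letter.sup]
      exact (mul_one _).trans (Dp_zero n)
    rw [e, rho_one, one_mul] at h
    exact h

theorem parOp_mul_sergeev {t : Op n k} (h : Sergeev N L d t) :
    parOp n k * t = sgn d • (t * parOp n k) := by
  induction h with
  | nil => rw [sgn_zero, one_smul, one_mul, mul_one]
  | self l y _ ih =>
    rw [← mul_assoc, parOp_mul_rho l y.isHom_sup, smul_mul_assoc, mul_assoc, ih, mul_smul_comm,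
      smul_smul, sgn_add, mul_assoc]
  | swap l q _ y _ ih =>
    rw [← mul_assoc, parOp_mul_trans, mul_assoc, ← mul_assoc (parOp n k),
      parOp_mul_rho l y.isHom_sup, smul_mul_assoc, mul_assoc, ih, mul_smul_comm,
      mul_smul_comm, mul_smul_comm, smul_smul, sgn_add]
    simp only [mul_assoc]

theorem parOp_mul_of_mem {t : Op n k} (h : t ∈ sergeevSpan N L d) :
    parOp n k * t = sgn d • (t * parOp n k) := by
  induction h using Submodule.span_induction with
  | mem t h => exact parOp_mul_sergeev h
  | zero => rw [mul_zero, zero_mul, smul_zero]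
  | add a b _ _ h1 h2 => rw [mul_add, add_mul, h1, h2, smul_add]
  | smul c a _ h => rw [mul_smul_comm, smul_mul_assoc, h, smul_comm]

end Span

/-- Transpositions and even units preserve both summands, while `flipOp` is odd and contains
`parOp`, so it exchanges them. The even normal forms thus occur alone and the odd ones together with
the parity operator. -/
theorem SergeevGen.mul_mem {n k N : ℕ} {g : Op n k} (hg : SergeevGen N g) {t₀ t₁ : Op n k}
    (h₀ : t₀ ∈ sergeevSpan N (List.finRange k) 0) (h₁ : t₁ ∈ sergeevSpan N (List.finRange k) 1) :
    ∃ u₀ ∈ sergeevSpan N (List.finRange k) 0, ∃ u₁ ∈ sergeevSpan N (List.finRange k) 1,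
      g * (t₀ + t₁ * parOp n k) = u₀ + u₁ * parOp n k := by
  have hL := List.nodup_finRange k
  cases hg with
  | trans p r h =>
    exact ⟨_, trans_mul_mem_sergeevSpan_self hL (List.mem_finRange p) (List.mem_finRange r) h h₀,
      _, trans_mul_mem_sergeevSpan_self hL (List.mem_finRange p) (List.mem_finRange r) h h₁,
      by rw [mul_add, mul_assoc]⟩
  | unit p i j hi hj h =>
    have e1 : (Letter.unit i j hi hj).deg = 0 := by
      change i.par + j.par = 0
      rw [h, zmod_two_add_self]
    have e2 : (Letter.unit i j hi hj).sup = Matrix.single i j 1 := by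
      rw [Letter.sup, e1, Dp_zero, one_mul]
      rfl
    have k₀ := rho_mul_mem_sergeevSpan hL (Letter.unit i j hi hj) (List.mem_finRange p) h₀
    have k₁ := rho_mul_mem_sergeevSpan hL (Letter.unit i j hi hj) (List.mem_finRange p) h₁
    rw [e1, e2, zero_add] at k₀ k₁
    exact ⟨_, k₀, _, k₁, by rw [mul_add, mul_assoc]⟩
  | flip p =>
    have k₀ := rho_mul_mem_sergeevSpan hL (Letter.flip (n := n) (N := N)) (List.mem_finRange p) h₀
    have k₁ := rho_mul_mem_sergeevSpan hL (Letter.flip (n := n) (N := N)) (List.mem_finRange p) h₁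
    have e : (1 : ZMod 2) + 1 = 0 := rfl
    rw [Letter.deg, add_zero] at k₀
    rw [Letter.deg, e] at k₁
    refine ⟨_, neg_mem k₁, _, k₀, ?_⟩
    have e1 : (Letter.flip (n := n) (N := N)).sup = Dp n 1 * flp n := rfl
    rw [e1, flipOp, mul_add, mul_assoc, mul_assoc, ← mul_assoc (parOp n k) t₁,
      parOp_mul_of_mem h₀, parOp_mul_of_mem h₁, sgn_zero, sgn_one, one_smul, neg_smul, one_smul,
      neg_mul, mul_assoc t₁, parOp_mul_self, mul_one, mul_neg, mul_assoc, add_comm]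

theorem exists_of_mem_sergeevAlg {n k N : ℕ} {T : Op n k} (hT : T ∈ sergeevAlg n N k) :
    ∃ u₀ ∈ sergeevSpan N (List.finRange k) 0, ∃ u₁ ∈ sergeevSpan N (List.finRange k) 1,
      T = u₀ + u₁ * parOp n k := by
  have key : ∀ t₀ ∈ sergeevSpan N (List.finRange k) 0, ∀ t₁ ∈ sergeevSpan N (List.finRange k) 1,
      ∃ u₀ ∈ sergeevSpan N (List.finRange k) 0, ∃ u₁ ∈ sergeevSpan N (List.finRange k) 1,
        T * (t₀ + t₁ * parOp n k) = u₀ + u₁ * parOp n k := by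
    induction hT using Algebra.adjoin_induction with
    | mem g hg => exact fun t₀ h₀ t₁ h₁ => SergeevGen.mul_mem hg h₀ h₁
    | algebraMap c =>
      intro t₀ h₀ t₁ h₁
      exact ⟨_, Submodule.smul_mem _ c h₀, _, Submodule.smul_mem _ c h₁,
        by rw [← Algebra.smul_def, smul_add, smul_mul_assoc]⟩
    | add A B _ _ hA hB =>
      intro t₀ h₀ t₁ h₁
      obtain ⟨u₀, hu₀, u₁, hu₁, e⟩ := hA t₀ h₀ t₁ h₁
      obtain ⟨v₀, hv₀, v₁, hv₁, e'⟩ := hB t₀ h₀ t₁ h₁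
      exact ⟨_, add_mem hu₀ hv₀, _, add_mem hu₁ hv₁,
        by rw [add_mul, e, e', add_mul, add_add_add_comm]⟩
    | mul A B _ _ hA hB =>
      intro t₀ h₀ t₁ h₁
      obtain ⟨u₀, hu₀, u₁, hu₁, e⟩ := hB t₀ h₀ t₁ h₁
      obtain ⟨v₀, hv₀, v₁, hv₁, e'⟩ := hA u₀ hu₀ u₁ hu₁
      exact ⟨_, hv₀, _, hv₁, by rw [mul_assoc, e, e']⟩
  obtain ⟨u₀, h₀, u₁, h₁, e⟩ := key 1 (one_mem_sergeevSpan _) 0 (Submodule.zero_mem _)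
  rw [zero_mul, add_zero, mul_one] at e
  exact ⟨u₀, h₀, u₁, h₁, e⟩

/-! ### The invariants -/

/-- After the scalar is subtracted, the matrix is supported on large indices. Applying `toQ` expands
it in the F_ij with |i|, |j| > N and doubles it. -/
theorem exists_of_mem_core {N M : ℕ} {x : gl (N + M)} (hx : x ∈ core (N + M) N) :
    ∃ c : ℂ, ∃ X ∈ qM N M, x = c • 1 + (X : gl (N + M)) := by
  obtain ⟨h, c, hc⟩ := hx
  have hX : x - c • 1 ∈ q (N + M) := by
    rw [mem_q_iff_commute_flp, sub_mul, mul_sub, h, smul_mul_assoc, mul_smul_comm, one_mul,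
      mul_one]
  refine ⟨c, ⟨x - c • 1, hX⟩, ?_, (add_sub_cancel _ _).symm⟩
  have h1 := toQ_of_mem (⟨x - c • 1, hX⟩ : q (N + M))
  have h2 : toQ (N + M) (x - c • 1) ∈ qM N M := by
    rw [Matrix.matrix_eq_sum_single (x - c • 1), map_sum]
    refine Submodule.sum_mem _ fun i _ => ?_
    rw [map_sum]
    refine Submodule.sum_mem _ fun j _ => ?_
    rw [smul_single_one, map_smul, toQ_single]
    by_cases hij : i.abs ≤ N ∨ j.abs ≤ N
    · rw [Matrix.sub_apply, hc i j hij, Matrix.smul_apply, smul_eq_mul, sub_self, zero_smul]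
      exact Submodule.zero_mem _
    · rw [not_or, not_le, not_le] at hij
      exact Submodule.smul_mem _ _ (Submodule.subset_span ⟨i, j, hij.1, hij.2, rfl⟩)
  have h3 := Submodule.smul_mem _ (2⁻¹ : ℂ) h2
  have h4 : toQ (N + M) (x - c • 1) = (2 : ℂ) • (⟨x - c • 1, hX⟩ : q (N + M)) := h1
  rwa [h4, smul_smul, inv_mul_cancel₀ two_ne_zero, one_smul] at h3

theorem twist_zero {n : ℕ} (a : S n) : S.twist n 0 a = a := by
  induction a using S.induction with
  | scalar c => exact AlgHom.commutes _ c
  | gen X =>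
    induction X using q_induction with
    | hom p X hX => rw [twist_ι 0 hX, zero_mul, sgn_zero, one_smul]
    | add X Y h1 h2 => rw [map_add, map_add, h1, h2]
  | mul a b ha hb => rw [map_mul, ha, hb]
  | add a b ha hb => rw [map_add, ha, hb]

theorem parOp_mul_diag {n k : ℕ} {r : ZMod 2} {x : gl n} (hx : IsHom r x) :
    parOp n k * diag n k x = sgn r • (diag n k x * parOp n k) := by
  rw [diag_apply, Finset.mul_sum, Finset.sum_mul, Finset.smul_sum]
  exact Finset.sum_congr rfl fun p _ => parOp_mul_rho p hx

/-! ### From supercommuting operators to commuting ones and back. -/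

section Parity

variable {R : Type*} [Ring R] {P T Z : R}

theorem commute_even_part (h : Z * T = T * Z) (h' : Z * P = P * Z) :
    Z * (T + P * T * P + (T - P * T * P) * P) = (T + P * T * P + (T - P * T * P) * P) * Z := by
  have hT : Commute Z T := h
  have hP : Commute Z P := h'
  have hT' : Commute Z (P * T * P) := (hP.mul_right hT).mul_right hP
  exact (hT.add_right hT').add_right ((hT.sub_right hT').mul_right hP)

/-- An odd Z commutes with the even part of T and anticommutes both with the odd part and with P, so
it commutes with the odd part times P. -/
theorem commute_odd_part (hP : P * P = 1) (h : Z * T = P * T * P * Z) (h' : P * Z = -(Z * P)) :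
    Z * (T + P * T * P + (T - P * T * P) * P) = (T + P * T * P + (T - P * T * P) * P) * Z := by
  have h0 : Z * P = -(P * Z) := by rw [h', neg_neg]
  have h1 : Z * (P * T * P) = T * Z := by
    calc Z * (P * T * P) = Z * P * T * P := by simp only [mul_assoc]
      _ = -(P * (Z * T) * P) := by rw [h0]; noncomm_ring
      _ = -((P * P) * T * (P * Z) * P) := by rw [h]; noncomm_ring
      _ = T * Z * (P * P) := by
        rw [h', hP, one_mul, mul_one, mul_neg, neg_mul, neg_neg, mul_assoc, mul_assoc, hP, mul_one]
      _ = T * Z := by rw [hP, mul_one]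
  have h2 : Z * (T - P * T * P) = -((T - P * T * P) * Z) := by
    rw [mul_sub, sub_mul, h, h1, neg_sub]
  rw [mul_add, mul_add, add_mul, add_mul, h, h1, ← mul_assoc Z, h2, neg_mul, mul_assoc _ Z, h0,
    mul_neg, neg_neg, mul_assoc _ P Z, mul_assoc _ P Z, add_comm (T * Z)]

/-- Conjugation by P negates exactly the terms containing the factor P. This separates the equation
into T + T' = u₀ and T - T' = u₁. -/
theorem eq_of_parity [Algebra ℂ R] {T' u₀ u₁ : R} (hP : P * P = 1) (h : P * T = T' * P)
    (h' : P * T' = T * P) (h₀ : P * u₀ = u₀ * P) (h₁ : P * u₁ = -(u₁ * P))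
    (e : T + T' + (T - T') * P = u₀ + u₁ * P) : T = (2⁻¹ : ℂ) • (u₀ + u₁) := by
  have e2 : P * (T + T' + (T - T') * P) * P = P * (u₀ + u₁ * P) * P := by rw [e]
  have e3 : P * (T + T' + (T - T') * P) * P = T + T' - (T - T') * P := by
    calc P * (T + T' + (T - T') * P) * P =
        (P * T + P * T') * P + (P * T - P * T') * (P * P) := by noncomm_ring
      _ = (T' + T) * (P * P) + (T' * P - T * P) := by
        rw [h, h', hP, mul_one, ← add_mul, mul_assoc, hP]
      _ = _ := by rw [hP]; noncomm_ring
  have e4 : P * (u₀ + u₁ * P) * P = u₀ - u₁ * P := by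
    calc P * (u₀ + u₁ * P) * P = P * u₀ * P + P * u₁ * (P * P) := by noncomm_ring
      _ = u₀ * (P * P) - u₁ * P := by rw [h₀, h₁, hP, mul_assoc, hP, mul_one, mul_one, sub_eq_add_neg]
      _ = _ := by rw [hP, mul_one]
  rw [e3, e4] at e2
  have cancel : ∀ x y : R, x + x = y + y → x = y := by
    intro x y hxy
    rw [← two_smul ℂ, ← two_smul ℂ] at hxy
    exact smul_right_injective R (two_ne_zero (α := ℂ)) hxy
  have e5 : T + T' = u₀ := by
    refine cancel _ _ ?_
    calc T + T' + (T + T') = (T + T' + (T - T') * P) + (T + T' - (T - T') * P) := by abel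
      _ = u₀ + u₀ := by rw [e, e2]; abel
  have e6 : (T - T') * P = u₁ * P := by
    rw [e5] at e
    exact add_left_cancel e
  have e7 : T - T' = u₁ := by
    have := congrArg (· * P) e6
    simpa only [mul_assoc, hP, mul_one] using this
  rw [← e5, ← e7]
  module

end Parity

/-- Invariance makes T supercommute with q_M. The combination T + T' + (T - T')P, twice the even
part plus twice the odd part times P, then commutes with `core` and has a normal form in the Sergeev
algebra. -/
theorem symb_pol_mem {N M : ℕ} {a : S (N + M)} (ha : a ∈ invariants N M) (k : ℕ) :
    symb (N + M) k (pol (N + M) k Finset.univ a) ∈ genAlg (N + M) N := by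
  set T := pol (N + M) k Finset.univ a with hT
  set P := parOp (N + M) k with hP
  have hPP : P * P = 1 := parOp_mul_self _ _
  obtain ⟨T', hT'⟩ : ∃ T', T' = pol (N + M) k Finset.univ (S.twist (N + M) 1 a) := ⟨_, rfl⟩
  have h1 : P * T = T' * P := by rw [hT']; exact parOp_mul_pol a _
  have h2 : P * T' = T * P := by
    calc P * T' = P * (T' * P) * P := by rw [mul_assoc, mul_assoc, hPP, mul_one]
      _ = T * P := by rw [← h1, ← mul_assoc, hPP, one_mul]
  have hcomm : ∀ x ∈ core (N + M) N, diag (N + M) k x * (T + T' + (T - T') * P) =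
      (T + T' + (T - T') * P) * diag (N + M) k x := by
    intro x hx
    -- The scalar part acts diagonally as c k; the rest lies in q_M and is treated one parity at a
    -- time.
    obtain ⟨c, X, hX, rfl⟩ := exists_of_mem_core hx
    have key : ∀ r, ∀ Y ∈ qM N M, Y ∈ qDeg (N + M) r →
        diag (N + M) k Y * (T + T' + (T - T') * P) =
          (T + T' + (T - T') * P) * diag (N + M) k Y := by
      intro r Y hY hr
      have h3 : diag (N + M) k Y * T = pol (N + M) k Finset.univ (S.twist (N + M) r a) *
          diag (N + M) k Y := by
        have h4 := diag_mul_pol hr a (Finset.univ : Finset (Fin k))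
        rwa [← ad_qProj, ha _ (qProj_mem_qM r hY), map_zero, zero_add] at h4
      have h5 := parOp_mul_diag (k := k) (mem_qDeg_iff.1 hr)
      have e1 : T' = P * T * P := by rw [h1, mul_assoc, hPP, mul_one]
      generalize diag (N + M) k (Y : gl (N + M)) = Z at *
      rw [e1]
      rcases zmod_two_cases r with rfl | rfl
      · rw [twist_zero, ← hT] at h3
        rw [sgn_zero, one_smul, ← hP] at h5
        exact commute_even_part h3 h5.symm
      · rw [← hT', e1] at h3
        rw [sgn_one, neg_smul, one_smul, ← hP] at h5
        exact commute_odd_part hPP h3 h5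
    have hd : diag (N + M) k (c • 1 : gl (N + M)) = (c * k) • 1 := by
      rw [map_smul, diag_apply]
      simp only [rho_one]
      rw [Finset.sum_const, Finset.card_univ, Fintype.card_fin, ← Nat.cast_smul_eq_nsmul ℂ,
        smul_smul]
    have hX' : (X : gl (N + M)) = (qProj (N + M) 0 X : gl (N + M)) + (qProj (N + M) 1 X) := by
      have h1 : (Finset.univ : Finset (ZMod 2)) = {0, 1} := rfl
      have h2 := sum_glProj (X : gl (N + M))
      rw [h1, Finset.sum_pair (by decide)] at h2
      exact h2.symm
    generalize T + T' + (T - T') * P = A at key ⊢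
    rw [map_add, hd, hX', map_add, add_mul, add_mul, mul_add, mul_add,
      key 0 _ (qProj_mem_qM 0 hX) (qProj_mem 0 X), key 1 _ (qProj_mem_qM 1 hX) (qProj_mem 1 X),
      smul_one_mul, mul_smul_one]
  obtain ⟨u₀, hu₀, u₁, hu₁, e⟩ := exists_of_mem_sergeevAlg (mem_sergeevAlg_of_commute hcomm)
  have p₀ := parOp_mul_of_mem hu₀
  have p₁ := parOp_mul_of_mem hu₁
  rw [sgn_zero, one_smul, ← hP] at p₀
  rw [sgn_one, neg_smul, one_smul, ← hP] at p₁
  -- T itself needs no parity operator: it is half the sum of the even and the odd combinations of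
  -- normal forms, and their symbols are known.
  have h7 : T = (2⁻¹ : ℂ) • (u₀ + u₁) := eq_of_parity hPP h1 h2 p₀ p₁ e
  have h8 : ∀ {d : ZMod 2} {u : Op (N + M) k}, u ∈ sergeevSpan N (List.finRange k) d →
      symb (N + M) k u ∈ genAlg (N + M) N := by
    intro d u hu
    induction hu using Submodule.span_induction with
    | mem t h => exact Sergeev.symb_mem h (List.Perm.refl _)
    | zero => rw [map_zero]; exact zero_mem _
    | add a b _ _ h1 h2 => rw [map_add]; exact add_mem h1 h2
    | smul c a _ h => rw [map_smul]; exact Subalgebra.smul_mem _ h c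
  rw [h7, map_smul, map_add]
  exact Subalgebra.smul_mem _ (add_mem (h8 hu₀) (h8 hu₁)) _

theorem invariants_le_genAlg (N M : ℕ) : invariants N M ≤ genAlg (N + M) N :=
  fun _ ha => mem_of_symb_pol_mem (symb_pol_mem ha)

end Queer
end

theorem proposition2p5 (N M : ℕ) :
    Algebra.adjoin ℂ
      ({a | ∃ m : ℕ, Odd m ∧ a = Queer.c (N + M) m} ∪
        {a | ∃ (m : ℕ) (i j : Queer.Idx (N + M)),
          1 ≤ m ∧ i.abs ≤ N ∧ j.abs ≤ N ∧ a = Queer.f (N + M) m i j}) =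
      Queer.invariants N M :=
  le_antisymm (Queer.genAlg_le_invariants N M) (Queer.invariants_le_genAlg N M)
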